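/- Let $n\ge 2$, $0<\beta<\infty$, and let $Q\in\mathcal D'(\mathbb R^n)$ be a (complex-valued) distribution. Write $\langle Qu,u\rangle=\langle Q,|u|^2\rangle$ for $u\in C_0^\infty(\mathbb R^n)$, let $B_\delta(x_0)$ be the open Euclidean ball, and $m_B(f)=|B|^{-1}\int_B f\,dx$. Say that $Q$ has property (T) if there are $\epsilon_0>0$ and $c>0$ such that for every $\epsilon\in(0,\epsilon_0)$ $$|\langle Qu,u\rangle|\le \epsilon\,\|\nabla u\|_{L^2(\mathbb R^n)}^2+c\,\epsilon^{-\beta}\,\|u\|_{L^2(\mathbb R^n)}^2,\qquad \forall u\in C_0^\infty(\mathbb R^n).\tag{T}$$ For $\vec\Gamma\in L^2_{\rm loc}(\mathbb R^n)^n$ and $\gamma\in L^1_{\rm loc}(\mathbb R^n)$ (complex-valued) consider the conditions that for some $\delta_0>0$ and $c>0$, for all $x_0\in\mathbb R^n$ and $0<\delta<\delta_0$, $$\int_{B_\delta(x_0)}|\vec\Gamma-m_{B_\delta(x_0)}(\vec\Gamma)|^2\,dx\le c\,\delta^{\,n-2\frac{\beta-1}{\beta+1}},\tag{A}$$ $$\int_{B_\delta(x_0)}|\gamma|\,dx\le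 c\,\delta^{\,n-\frac{2\beta}{\beta+1}}.\tag{B}$$ Write $\vec\Gamma\in L^2_{\rm unif}$ if $\vec\Gamma\in L^2_{\rm loc}$ and $\sup_{x_0}\int_{B_1(x_0)}|\vec\Gamma|^2\,dx<\infty$. (i) If $Q$ has property (T), then $Q$ is a tempered distribution, and $Q=\operatorname{div}\vec\Gamma+\gamma$ in the sense of distributions, where $\vec\Gamma=-\nabla(1-\Delta)^{-1}Q\in L^2_{\rm loc}(\mathbb R^n)^n$ and $\gamma=(1-\Delta)^{-1}Q\in L^1_{\rm loc}(\mathbb R^n)$ satisfy (A) and (B). Here $(1-\Delta)^{-1}$ is the inverse of $1-\Delta$ on tempered distributions. Furthermore $\vec\Gamma\in L^2_{\rm unif}$ if $\beta\ge1$, and $\vec\Gamma\in L^\infty(\mathbb R^n)^n$ if $0<\beta<1$. (ii) Conversely, if $Q=\operatorname{div}\vec\Gamma+\gamma$ for some $\vec\Gamma\in L^2_{\rm loc}(\mathbb R^n)^n$ and $\gamma\in L^1_{\rm loc}(\mathbb R^n)$ satisfying (A) and (B), then $Q$ has property (T). (iii) For $\vec\Gamma\in L^2_{\rm loc}(\mathbb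 R^n)^n$, condition (A) has the following meaning. If $\beta>1$: $\vec\Gamma\in L^2_{\rm unif}$ and (A) holds if and only if $\vec\Gamma$ satisfies the Morrey condition $\int_{B_\delta(x_0)}|\vec\Gamma|^2dx\le c\,\delta^{\,n-2\frac{\beta-1}{\beta+1}}$ for all $x_0\in\mathbb R^n$, $0<\delta<\delta_0$, with some $\delta_0,c>0$. If $\beta=1$: $\vec\Gamma\in L^2_{\rm unif}$ and (A) holds if and only if $\vec\Gamma$ is in local BMO, that is, $\vec\Gamma\in L^2_{\rm unif}$ and $\sup_{x_0\in\mathbb R^n,\,0<\delta\le1}|B_\delta(x_0)|^{-1}\int_{B_\delta(x_0)}|\vec\Gamma-m_{B_\delta(x_0)}(\vec\Gamma)|^2dx<\infty$. If $0<\beta<1$: (A) holds if and only if, after modification on a null set, $|\vec\Gamma(x)-\vec\Gamma(x')|\le c\,|x-x'|^{\frac{1-\beta}{1+\beta}}$ whenever $|x-x'|<\delta_0$, for some $\delta_0,c>0$. -/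

import Mathlib

open MeasureTheory TopologicalSpace
open scoped Distributions SchwartzMap LineDeriv Laplacian ContDiff

noncomputable section

namespace FormSubordination

/-- Euclidean space `ℝⁿ`. -/
abbrev Rn (n : ℕ) : Type := EuclideanSpace ℝ (Fin n)

/-- Complex Euclidean space `ℂⁿ`, where the vector fields take their values. -/
abbrev Cn (n : ℕ) : Type := EuclideanSpace ℂ (Fin n)

/-- The `i`-th standard basis vector of `ℝⁿ`. -/
def basisVec {n : ℕ} (i : Fin n) : Rn n := EuclideanSpace.single i 1

/-- Complex-valued test functions, `C₀^∞(ℝⁿ)`. -/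
abbrev Test (n : ℕ) : Type := 𝓓((⊤ : Opens (Rn n)), ℂ)

/-- Real-valued test functions, on which Mathlib's distributions act. -/
abbrev RealTest (n : ℕ) : Type := 𝓓((⊤ : Opens (Rn n)), ℝ)

/-- Complex-valued distributions on `ℝⁿ`. -/
abbrev Distr (n : ℕ) : Type := 𝓓'((⊤ : Opens (Rn n)), ℂ)

/-- Complex-valued tempered distributions on `ℝⁿ`. -/
abbrev Tempered (n : ℕ) : Type := 𝓢'(Rn n, ℂ)

/-! ### The quadratic form inequality -/

/-- The test function `|u|²`, so that `⟨Qu, u⟩ = Q (normSqTest u)`. -/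
def normSqTest {n : ℕ} (u : Test n) : RealTest n where
  toFun := fun x => ‖u x‖ ^ 2
  contDiff' := u.contDiff.norm_sq ℝ
  hasCompactSupport' := u.hasCompactSupport.comp_left (g := fun z : ℂ => ‖z‖ ^ 2) (by simp)
  tsupport_subset' := fun _ _ => trivial

/-- `‖∇u‖²` in `L²(ℝⁿ)`. -/
def gradNormSq {n : ℕ} (u : Test n) : ℝ :=
  ∫ x, ∑ i : Fin n, ‖fderiv ℝ u x (basisVec i)‖ ^ 2

/-- `‖u‖²` in `L²(ℝⁿ)`. -/
def normSqL2 {n : ℕ} (u : Test n) : ℝ := ∫ x, ‖u x‖ ^ 2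

/-- Trudinger's form subordination property with exponent `β`: for some `ε₀, c > 0`,
`|⟨Qu, u⟩| ≤ ε ‖∇u‖² + c ε^{-β} ‖u‖²` for all `0 < ε < ε₀` and all `u ∈ C₀^∞(ℝⁿ)`. -/
def TrudingerSubordinate {n : ℕ} (Q : Distr n) (β : ℝ) : Prop :=
  ∃ ε₀ > 0, ∃ c > 0, ∀ ε : ℝ, 0 < ε → ε < ε₀ → ∀ u : Test n,
    ‖Q (normSqTest u)‖ ≤ ε * gradNormSq u + c * ε ^ (-β) * normSqL2 u

/-! ### Functions as distributions, divergence -/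

/-- The distribution `φ ↦ ∫ φ f` defined by a locally integrable function `f`. -/
def ofFun {n : ℕ} (f : Rn n → ℂ) : Distr n :=
  TestFunction.integralAgainstBilinCLM (ContinuousLinearMap.lsmul ℝ ℝ) volume f

/-- The distributional divergence of a locally integrable vector field. -/
def divergence {n : ℕ} (Γ : Rn n → Cn n) : Distr n :=
  ∑ i : Fin n, ∂_{basisVec i} (ofFun fun x => Γ x i)

/-! ### The operator `(1 - Δ)⁻¹` -/

/-- The operator `(1 - Δ)⁻¹` on tempered distributions: the Fourier multiplier with symbol
`(1 + |2πξ|²)⁻¹`, the Fourier transform being `∫ e^{-2πi⟨x,ξ⟩} f(x) dx`. -/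
def resolvent (n : ℕ) : Tempered n →L[ℂ] Tempered n :=
  TemperedDistribution.fourierMultiplierCLM ℂ
    (fun ξ : Rn n => (((1 + ‖(2 * Real.pi) • ξ‖ ^ 2)⁻¹ : ℝ) : ℂ))

/-- The symbol of `(1 - Δ)⁻¹` has temperate growth, so the multiplier is not a junk value. -/
theorem resolvent_symbol_temperate (n : ℕ) :
    (fun ξ : Rn n => (((1 + ‖(2 * Real.pi) • ξ‖ ^ 2)⁻¹ : ℝ) : ℂ)).HasTemperateGrowth := by
  have h : (fun x : Rn n => (1 + ‖x‖ ^ 2) ^ (-1 : ℝ)).HasTemperateGrowth := by fun_prop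
  have h2 : (fun x : Rn n => (2 * Real.pi) • x).HasTemperateGrowth := by fun_prop
  have h3 := Function.HasTemperateGrowth.comp h h2
  have : (fun ξ : Rn n => (((1 + ‖(2 * Real.pi) • ξ‖ ^ 2)⁻¹ : ℝ) : ℂ)) = fun ξ =>
      ((((fun x : Rn n => (1 + ‖x‖ ^ 2) ^ (-1 : ℝ)) ∘ fun x : Rn n => (2 * Real.pi) • x) ξ : ℝ) : ℂ) := by
    funext ξ
    simp only [Function.comp, Real.rpow_neg_one]
  rw [this]
  fun_prop

/-- `(1 - Δ) (1 - Δ)⁻¹ T = T`. -/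
theorem resolvent_sub_laplacian (n : ℕ) (T : Tempered n) :
    resolvent n T - Δ (resolvent n T) = T := by
  rw [TemperedDistribution.laplacian_eq_fourierMultiplierCLM, resolvent,
    TemperedDistribution.fourierMultiplierCLM_fourierMultiplierCLM_apply
      (resolvent_symbol_temperate n) (by fun_prop), ← Complex.coe_smul,
    ← smul_apply, ← TemperedDistribution.fourierMultiplierCLM_smul
      ((resolvent_symbol_temperate n).mul (by fun_prop))]
  have hg := resolvent_symbol_temperate n
  have hm : (((-(2 * Real.pi) ^ 2 : ℝ) : ℂ) • ((fun ξ : Rn n =>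
      (((1 + ‖(2 * Real.pi) • ξ‖ ^ 2)⁻¹ : ℝ) : ℂ)) *
        fun x => ((‖x‖ ^ 2 : ℝ) : ℂ))).HasTemperateGrowth :=
    (Function.HasTemperateGrowth.const _).smul (hg.mul (by fun_prop))
  ext u
  have key : ∀ v : 𝓢(Rn n, ℂ), SchwartzMap.smulLeftCLM ℂ
      (fun ξ : Rn n => (((1 + ‖(2 * Real.pi) • ξ‖ ^ 2)⁻¹ : ℝ) : ℂ)) v
      - SchwartzMap.smulLeftCLM ℂ (((-(2 * Real.pi) ^ 2 : ℝ) : ℂ) • ((fun ξ : Rn n =>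
      (((1 + ‖(2 * Real.pi) • ξ‖ ^ 2)⁻¹ : ℝ) : ℂ)) *
        fun x => ((‖x‖ ^ 2 : ℝ) : ℂ))) v = v := by
    intro v
    ext x
    have h0 : (1 + ‖(2 * Real.pi) • x‖ ^ 2 : ℝ) ≠ 0 := by positivity
    rw [sub_apply, SchwartzMap.smulLeftCLM_apply_apply hg,
      SchwartzMap.smulLeftCLM_apply_apply hm, ← sub_smul]
    have h1 : ((((1 + ‖(2 * Real.pi) • x‖ ^ 2)⁻¹ : ℝ) : ℂ)) - ((-(2 * Real.pi) ^ 2 : ℝ) : ℂ) *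
        ((((1 + ‖(2 * Real.pi) • x‖ ^ 2)⁻¹ : ℝ) : ℂ) * ((‖x‖ ^ 2 : ℝ) : ℂ)) = 1 := by
      rw [← Complex.ofReal_mul, ← Complex.ofReal_mul, ← Complex.ofReal_sub, ← Complex.ofReal_one]
      congr 1
      have h2 : ‖(2 * Real.pi) • x‖ ^ 2 = (2 * Real.pi) ^ 2 * ‖x‖ ^ 2 := by
        rw [norm_smul, mul_pow, Real.norm_eq_abs, sq_abs]
      rw [h2] at h0 ⊢
      field_simp
      ring
    simp only [Pi.smul_apply, Pi.mul_apply, smul_eq_mul] at h1 ⊢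
    rw [h1, one_mul]
  rw [sub_apply, TemperedDistribution.fourierMultiplierCLM_apply_apply,
    TemperedDistribution.fourierMultiplierCLM_apply_apply, ← map_sub]
  congr 1
  have h4 := congrArg (FourierTransform.fourierCLM ℂ 𝓢(Rn n, ℂ)) (key (FourierTransformInv.fourierInv u))
  rw [map_sub] at h4
  simpa using h4

/-- A real test function as a complex Schwartz function. -/
def toSchwartz {n : ℕ} (φ : RealTest n) : 𝓢(Rn n, ℂ) :=
  (φ.hasCompactSupport.comp_left (g := fun t : ℝ => (t : ℂ)) (by simp)).toSchwartzMap
    (Complex.ofRealCLM.contDiff.comp φ.contDiff)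

/-- The tempered distribution `T` and the distribution `Q` agree on test functions, i.e. `Q` is
tempered and equals `T`. (For given `Q` there is at most one such `T`.) -/
def Agrees {n : ℕ} (T : Tempered n) (Q : Distr n) : Prop :=
  ∀ φ : RealTest n, T (toSchwartz φ) = Q φ

/-- `γ = (1 - Δ)⁻¹ T` as distributions. -/
def IsResolvent {n : ℕ} (T : Tempered n) (γ : Rn n → ℂ) : Prop :=
  Agrees (resolvent n T) (ofFun γ)

/-- `Γ = -∇ (1 - Δ)⁻¹ T` as distributions. -/
def IsNegGradResolvent {n : ℕ} (T : Tempered n) (Γ : Rn n → Cn n) : Prop :=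
  ∀ i : Fin n, Agrees (-(∂_{basisVec i} (resolvent n T))) (ofFun fun x => Γ x i)

/-! ### Function classes -/

/-- `Γ ∈ L²_loc(ℝⁿ)ⁿ`. -/
def IsL2Loc {n : ℕ} (Γ : Rn n → Cn n) : Prop :=
  ∀ K : Set (Rn n), IsCompact K → MemLp Γ 2 (volume.restrict K)

/-- `Γ ∈ L²_unif(ℝⁿ)ⁿ`: the `L²` norms over unit balls are uniformly bounded. -/
def IsL2Unif {n : ℕ} (Γ : Rn n → Cn n) : Prop :=
  IsL2Loc Γ ∧ ∃ A : ℝ, ∀ x₀ : Rn n, ∫ x in Metric.ball x₀ 1, ‖Γ x‖ ^ 2 ≤ A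

/-- The mean oscillation bound
`∫_{B_δ(x₀)} |Γ - m_{B_δ(x₀)}(Γ)|² ≤ c δ^{n - 2(β-1)/(β+1)}`, `x₀ ∈ ℝⁿ`, `0 < δ < δ₀`. -/
def OscillationBound {n : ℕ} (β δ₀ c : ℝ) (Γ : Rn n → Cn n) : Prop :=
  ∀ x₀ : Rn n, ∀ δ : ℝ, 0 < δ → δ < δ₀ →
    ∫ x in Metric.ball x₀ δ, ‖Γ x - ⨍ y in Metric.ball x₀ δ, Γ y‖ ^ 2
      ≤ c * δ ^ ((n : ℝ) - 2 * ((β - 1) / (β + 1)))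

/-- The bound `∫_{B_δ(x₀)} |γ| ≤ c δ^{n - 2β/(β+1)}`, `x₀ ∈ ℝⁿ`, `0 < δ < δ₀`. -/
def MassBound {n : ℕ} (β δ₀ c : ℝ) (γ : Rn n → ℂ) : Prop :=
  ∀ x₀ : Rn n, ∀ δ : ℝ, 0 < δ → δ < δ₀ →
    ∫ x in Metric.ball x₀ δ, ‖γ x‖ ≤ c * δ ^ ((n : ℝ) - 2 * β / (β + 1))

/-- The Morrey bound `∫_{B_δ(x₀)} |Γ|² ≤ c δ^{n - 2(β-1)/(β+1)}`, `x₀ ∈ ℝⁿ`, `0 < δ < δ₀`. -/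
def MorreyBound {n : ℕ} (β δ₀ c : ℝ) (Γ : Rn n → Cn n) : Prop :=
  ∀ x₀ : Rn n, ∀ δ : ℝ, 0 < δ → δ < δ₀ →
    ∫ x in Metric.ball x₀ δ, ‖Γ x‖ ^ 2 ≤ c * δ ^ ((n : ℝ) - 2 * ((β - 1) / (β + 1)))

/-- Local BMO: `Γ ∈ L²_unif` with bounded mean square oscillation over balls of radius at
most `1`. -/
def IsLocalBMO {n : ℕ} (Γ : Rn n → Cn n) : Prop :=
  IsL2Unif Γ ∧ ∃ A : ℝ, ∀ x₀ : Rn n, ∀ δ : ℝ, 0 < δ → δ ≤ 1 →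
    ⨍ x in Metric.ball x₀ δ, ‖Γ x - ⨍ y in Metric.ball x₀ δ, Γ y‖ ^ 2 ≤ A

/-- `Γ` coincides almost everywhere with a function `Γ'` such that
`|Γ'(x) - Γ'(x')| ≤ c |x - x'|^α` whenever `|x - x'| < δ₀`. -/
def IsLocallyUniformlyHolder {n : ℕ} (α : ℝ) (Γ : Rn n → Cn n) : Prop :=
  ∃ δ₀ > 0, ∃ c > 0, ∃ Γ' : Rn n → Cn n, Γ' =ᵐ[volume] Γ ∧
    ∀ x x' : Rn n, ‖x - x'‖ < δ₀ → ‖Γ' x - Γ' x'‖ ≤ c * ‖x - x'‖ ^ α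

end FormSubordination

end

open FormSubordination

/-! Put `α = (1 - β) / (1 + β)`, so that `-1 < α < 1` and (A) says that the square oscillation of
`Γ` over a ball of radius `t` is `O(t^(n + 2α))`. Everything rests on one scaling relation: if the
parameter `ε` of (T) and a length `r` are tied by `ε ~ r^(2/(β+1))`, then `ε r⁻²` and `ε^(-β)` are
both of order `r^(-2β/(β+1))`.

Sufficiency. Split `Γ` into its mollification `Γ_r` and the rest. In `Γ_r` the derivative falls on
the kernel; the differentiated kernel has mean zero, so `|div Γ_r| ≤ C r^(α-1) = C ε^(-β)`. The rest
is paired with `∇|u|²`, bounded by `ε |∇u|² + ε⁻¹ |Γ - Γ_r|² |u|²`, and the density `|Γ - Γ_r|²`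
satisfies a Morrey bound on balls of radius at most `r`. A trace inequality
(`exists_integral_mul_norm_sq_le`), proved by averaging the fundamental theorem of calculus over all
directions, turns Morrey bounds into form bounds. It handles `γ` as well.

Necessity. Take a kernel `ρ` of mass one and `σ` with `∇σ = -xρ`. Then `d/ds (ρ_s * v) = s σ_s * Δv`
(`KernelPair.hasDerivAt_av`), an explicit heat-like flow with compactly supported kernels.
Polarising (T) and testing with scaled bumps shows that `Q * ψ_s` is `O(s^(-2β/(β+1)))`
(`exists_scaling_bound`). Multiplied by `s` this is integrable at zero, so integrating the flow over
`0 < s ≤ 1` gives `Q = q - ΔF` with `F`, `q` bounded. Hence `Q` is tempered. As `(1 - Δ)⁻¹` is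
convolution with a probability measure, `γ = (1 - Δ)⁻¹ Q = F + (1 - Δ)⁻¹ (q - F)` is bounded, which
gives (B).

For (A), mollify `γ` to a smooth `v`; the form bound for `v - Δv` keeps its constants. Integrating
the flow over `(0, r)` and over `(r, 1)` bounds `v - ρ_r * v` by `r^(2/(β+1))` and the Hessian of
`ρ_r * v` by `r^(-2β/(β+1))`. So on a ball of radius `2δ` the function `v` differs from an affine
function by `O(δ^(2/(β+1)))`. A Caccioppoli inequality, with the form bound in place of an equation,
converts this into the oscillation estimate for `∇v` (`KernelPair.exists_gradient_oscillation`).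
Fatou's lemma removes the mollification.

The description of (A) in the three ranges is Campanato's theory: averages over consecutive dyadic
balls differ by `O(r^α)`. For `α < 0` the sum is dominated by the smallest ball (Morrey), for `α >
0` it converges (Hölder), and `α = 0` is BMO. For `β < 1` a Hölder field that is uniformly locally
square integrable is bounded. -/

noncomputable section

namespace FormSubordination

open Metric Filter Topology

variable {n : ℕ}

/-! ### Averages over balls -/

/-- The volume of the unit ball of `ℝⁿ`. -/
def unitVol (n : ℕ) : ℝ := volume.real (ball (0 : Rn n) 1)

theorem unitVol_pos (n : ℕ) : 0 < unitVol n :=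
  ENNReal.toReal_pos (measure_ball_pos _ _ one_pos).ne' measure_ball_lt_top.ne

theorem volume_real_ball (x : Rn n) {r : ℝ} (hr : 0 < r) :
    volume.real (ball x r) = r ^ n * unitVol n := by
  rw [Measure.real, Measure.addHaar_ball_of_pos _ _ hr, ENNReal.toReal_mul, finrank_euclideanSpace,
    Fintype.card_fin, ENNReal.toReal_ofReal (by positivity)]
  rfl

theorem volume_real_ball_pos (x : Rn n) {r : ℝ} (hr : 0 < r) : 0 < volume.real (ball x r) :=
  ENNReal.toReal_pos (measure_ball_pos _ _ hr).ne' measure_ball_lt_top.ne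

theorem IsL2Loc.memLp_ball {Γ : Rn n → Cn n} (h : IsL2Loc Γ) (x : Rn n) (r : ℝ) :
    MemLp Γ 2 (volume.restrict (ball x r)) :=
  (h _ (isCompact_closedBall x r)).mono_measure
    (Measure.restrict_mono ball_subset_closedBall le_rfl)

theorem IsL2Loc.locallyIntegrable {Γ : Rn n → Cn n} (h : IsL2Loc Γ) :
    LocallyIntegrable Γ volume := by
  rw [locallyIntegrable_iff]
  intro K hK
  have : IsFiniteMeasure (volume.restrict K) := ⟨by simpa using hK.measure_lt_top⟩
  exact (h K hK).integrable one_le_two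

theorem IsL2Loc.integrableOn_ball {Γ : Rn n → Cn n} (h : IsL2Loc Γ) (x : Rn n) (r : ℝ) :
    IntegrableOn Γ (ball x r) volume :=
  (h.locallyIntegrable.integrableOn_isCompact (isCompact_closedBall x r)).mono_set
    ball_subset_closedBall

theorem IsL2Loc.integrableOn_norm_sub_sq {Γ : Rn n → Cn n} (h : IsL2Loc Γ) (x : Rn n) (r : ℝ)
    (b : Cn n) : IntegrableOn (fun y => ‖Γ y - b‖ ^ 2) (ball x r) volume := by
  have : IsFiniteMeasure (volume.restrict (ball x r)) :=
    ⟨by simpa using measure_ball_lt_top⟩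
  exact ((h.memLp_ball x r).sub (memLp_const b)).integrable_norm_pow (by norm_num)

theorem IsL2Loc.integrableOn_norm_sq {Γ : Rn n → Cn n} (h : IsL2Loc Γ) (x : Rn n) (r : ℝ) :
    IntegrableOn (fun y => ‖Γ y‖ ^ 2) (ball x r) volume := by
  simpa using h.integrableOn_norm_sub_sq x r 0

/-- Jensen's inequality for the convex function `z ↦ ‖z - b‖ ^ 2`. -/
theorem norm_average_sub_sq_le {Γ : Rn n → Cn n} (h : IsL2Loc Γ) (x : Rn n) {r : ℝ} (hr : 0 < r)
    (b : Cn n) :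
    ‖(⨍ y in ball x r, Γ y) - b‖ ^ 2 * volume.real (ball x r) ≤ ∫ y in ball x r, ‖Γ y - b‖ ^ 2 := by
  have hc : ConvexOn ℝ Set.univ (fun z : Cn n => ‖z - b‖ ^ 2) := by
    have h1 : ConvexOn ℝ Set.univ (fun z : Cn n => ‖z - b‖) := by
      have := (convexOn_univ_norm (E := Cn n)).translate_left (-b)
      simpa [sub_eq_add_neg, Function.comp_def] using this
    exact h1.pow (fun _ _ => norm_nonneg _) 2
  have hJ := hc.map_set_average_le (μ := volume) (t := ball x r) (f := Γ)
    (by fun_prop) isClosed_univ (measure_ball_pos _ _ hr).ne' measure_ball_lt_top.ne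
    (by simp) (h.integrableOn_ball x r) (h.integrableOn_norm_sub_sq x r b)
  rw [setAverage_eq volume (fun y => ‖Γ y - b‖ ^ 2), smul_eq_mul] at hJ
  have hp := volume_real_ball_pos x hr
  calc _ ≤ ((volume.real (ball x r))⁻¹ * ∫ y in ball x r, ‖Γ y - b‖ ^ 2) * volume.real (ball x r) :=
        mul_le_mul_of_nonneg_right hJ hp.le
    _ = _ := by field_simp

/-- The triangle inequality through `b`, then Jensen for the distance from `b` to the mean. The
factor is not optimal, but it lets any constant replace the mean when (A) is to be verified. -/
theorem integral_norm_sub_average_sq_le {Γ : Rn n → Cn n} (h : IsL2Loc Γ) (x : Rn n) {r : ℝ}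
    (hr : 0 < r) (b : Cn n) :
    ∫ y in ball x r, ‖Γ y - ⨍ z in ball x r, Γ z‖ ^ 2 ≤ 4 * ∫ y in ball x r, ‖Γ y - b‖ ^ 2 := by
  set m := ⨍ z in ball x r, Γ z with hm
  have h1 := norm_average_sub_sq_le h x hr b
  have h2 : ∫ y in ball x r, ‖Γ y - m‖ ^ 2 ≤
      ∫ y in ball x r, (2 * ‖Γ y - b‖ ^ 2 + 2 * ‖m - b‖ ^ 2) := by
    refine setIntegral_mono_on (h.integrableOn_norm_sub_sq x r m)
      (((h.integrableOn_norm_sub_sq x r b).const_mul 2).add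
        (integrableOn_const measure_ball_lt_top.ne)) measurableSet_ball fun y _ => ?_
    have : ‖Γ y - m‖ ≤ ‖Γ y - b‖ + ‖m - b‖ := by
      rw [← norm_neg (m - b)]
      refine le_trans (le_of_eq ?_) (norm_add_le _ _)
      congr 1; abel
    nlinarith [norm_nonneg (Γ y - m), norm_nonneg (Γ y - b), norm_nonneg (m - b),
      sq_nonneg (‖Γ y - b‖ - ‖m - b‖)]
  rw [integral_add ((h.integrableOn_norm_sub_sq x r b).const_mul 2)
    (integrableOn_const measure_ball_lt_top.ne), integral_const_mul, setIntegral_const,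
    smul_eq_mul] at h2
  linarith

theorem norm_average_sub_average_sq_le {Γ : Rn n → Cn n} (h : IsL2Loc Γ) {x y : Rn n} {r R : ℝ}
    (hr : 0 < r) (hs : ball x r ⊆ ball y R) :
    ‖(⨍ z in ball x r, Γ z) - ⨍ z in ball y R, Γ z‖ ^ 2 * volume.real (ball x r) ≤
      ∫ z in ball y R, ‖Γ z - ⨍ w in ball y R, Γ w‖ ^ 2 :=
  (norm_average_sub_sq_le h x hr _).trans <|
    setIntegral_mono_set (h.integrableOn_norm_sub_sq y R _)
      (Eventually.of_forall fun _ => by positivity) hs.eventuallyLE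

/-- Mean oscillation of order `t ^ α` on balls of radius `t < δ₀`. -/
def OscLE (α δ₀ c : ℝ) (Γ : Rn n → Cn n) : Prop :=
  ∀ x : Rn n, ∀ t : ℝ, 0 < t → t < δ₀ →
    ∫ y in ball x t, ‖Γ y - ⨍ z in ball x t, Γ z‖ ^ 2 ≤ c * t ^ ((n : ℝ) + 2 * α)

/-- Jensen on the smaller ball bounds the difference by the oscillation over the larger one;
comparable radii cost a factor `2 ^ n` in volume. The balls need not be concentric, which the Hölder
estimate uses for two nearby centres. -/
theorem OscLE.average_sub_le {α δ₀ c : ℝ} {Γ : Rn n → Cn n} (hc : 0 ≤ c) (h : IsL2Loc Γ)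
    (ho : OscLE α δ₀ c Γ)
    {x y : Rn n} {r R : ℝ} (hr : 0 < r) (hs : ball x r ⊆ ball y R) (hR : R < δ₀) (hrR : R ≤ 2 * r)
    (hR0 : 0 < R) :
    ‖(⨍ z in ball x r, Γ z) - ⨍ z in ball y R, Γ z‖ ≤
      √(c * 2 ^ n / unitVol n) * R ^ α := by
  have h1 := (norm_average_sub_average_sq_le h hr hs).trans (ho y R hR0 hR)
  rw [volume_real_ball x hr] at h1
  have hω := unitVol_pos n
  have h2 : R ^ n ≤ 2 ^ n * r ^ n := by
    rw [← mul_pow]; exact pow_le_pow_left₀ hR0.le hrR n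
  have e : R ^ ((n : ℝ) + 2 * α) = R ^ n * (R ^ α) ^ 2 := by
    rw [Real.rpow_add hR0, Real.rpow_natCast, mul_comm 2 α, Real.rpow_mul hR0.le]
    norm_num
  rw [e] at h1
  set N := ‖(⨍ z in ball x r, Γ z) - ⨍ z in ball y R, Γ z‖
  have hN : 0 ≤ N := norm_nonneg _
  have hRa : 0 ≤ R ^ α := Real.rpow_nonneg hR0.le _
  refine abs_le_of_sq_le_sq' ?_ (by positivity) |>.2
  rw [mul_pow, Real.sq_sqrt (by positivity), div_mul_eq_mul_div, le_div_iff₀ hω]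
  have hrn : 0 < r ^ n := by positivity
  have h3 : N ^ 2 * unitVol n * r ^ n ≤ c * 2 ^ n * (R ^ α) ^ 2 * r ^ n := by
    calc N ^ 2 * unitVol n * r ^ n = N ^ 2 * (r ^ n * unitVol n) := by ring
      _ ≤ c * (R ^ n * (R ^ α) ^ 2) := h1
      _ ≤ c * ((2 ^ n * r ^ n) * (R ^ α) ^ 2) := by gcongr
      _ = _ := by ring
  exact le_of_mul_le_mul_right h3 hrn

/-- The geometric sum is kept in closed form because both ratios occur: `q > 1` for negative
exponents, `q < 1` for positive ones. -/
theorem norm_sub_le_of_geometric {E : Type*} [NormedAddCommGroup E] {a : ℕ → E} {D q : ℝ}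
    (hq : q ≠ 1) (h : ∀ k, ‖a (k + 1) - a k‖ ≤ D * q ^ k) (k : ℕ) :
    ‖a k - a 0‖ ≤ D * ((q ^ k - 1) / (q - 1)) := by
  induction k with
  | zero => simp
  | succ k ih =>
    have hq' : q - 1 ≠ 0 := sub_ne_zero.2 hq
    calc ‖a (k + 1) - a 0‖ = ‖(a (k + 1) - a k) + (a k - a 0)‖ := by congr 1; abel
      _ ≤ D * q ^ k + D * ((q ^ k - 1) / (q - 1)) := (norm_add_le _ _).trans (add_le_add (h k) ih)
      _ = _ := by field_simp; ring

theorem OscLE.dyadic_le {α δ₀ c : ℝ} {Γ : Rn n → Cn n} (hc : 0 ≤ c) (h : IsL2Loc Γ)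
    (ho : OscLE α δ₀ c Γ) (x : Rn n) {r : ℝ} (hr : 0 < r) (hrδ : r < δ₀) (k : ℕ) :
    ‖(⨍ z in ball x ((1 / 2) ^ (k + 1) * r), Γ z) - ⨍ z in ball x ((1 / 2) ^ k * r), Γ z‖ ≤
      √(c * 2 ^ n / unitVol n) * r ^ α * ((1 / 2 : ℝ) ^ α) ^ k := by
  have hp : (0 : ℝ) < (1 / 2) ^ k := by positivity
  have h1 : ((1 : ℝ) / 2) ^ k ≤ 1 := pow_le_one₀ (by norm_num) (by norm_num)
  have := ho.average_sub_le hc h (x := x) (y := x) (r := (1 / 2) ^ (k + 1) * r)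
    (R := (1 / 2) ^ k * r) (by positivity) (ball_subset_ball (by rw [pow_succ]; nlinarith))
    (by nlinarith) (by rw [pow_succ]; nlinarith) (by positivity)
  refine this.trans (le_of_eq ?_)
  have e : ((1 / 2 : ℝ) ^ k) ^ α = ((1 / 2 : ℝ) ^ α) ^ k := by
    rw [← Real.rpow_natCast, ← Real.rpow_natCast, ← Real.rpow_mul (by norm_num),
      ← Real.rpow_mul (by norm_num), mul_comm]
  rw [Real.mul_rpow hp.le hr.le, e]
  ring

theorem exists_dyadic_between {t r : ℝ} (ht : 0 < t) (htr : t ≤ r) :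
    ∃ k : ℕ, t ≤ (1 / 2) ^ k * r ∧ (1 / 2) ^ k * r ≤ 2 * t := by
  have hr : 0 < r := ht.trans_le htr
  obtain ⟨k, hk1, hk2⟩ := exists_nat_pow_near_of_lt_one (x := t / r) (y := (1 / 2 : ℝ))
    (by positivity) ((div_le_one hr).2 htr) (by norm_num) (by norm_num)
  refine ⟨k, (div_le_iff₀ hr).1 hk2, ?_⟩
  rw [lt_div_iff₀ hr, pow_succ] at hk1
  linarith

/-- Comparison of the averages over two concentric balls, in terms of an exponent `α' < 0` not
exceeding the oscillation exponent. -/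
theorem OscLE.average_sub_average_le {α α' δ₀ c : ℝ} {Γ : Rn n → Cn n} (hc : 0 ≤ c) (h : IsL2Loc Γ)
    (ho : OscLE α δ₀ c Γ) (hα' : α' < 0) (hα : α' ≤ α) (x : Rn n) {t r : ℝ} (ht : 0 < t)
    (htr : t ≤ r) (hrδ : r < δ₀) :
    ‖(⨍ z in ball x t, Γ z) - ⨍ z in ball x r, Γ z‖ ≤
      √(c * 2 ^ n / unitVol n) * (1 + ((1 / 2 : ℝ) ^ α' - 1)⁻¹) *
        (r ^ α * (t / r) ^ α') := by
  have hr : 0 < r := ht.trans_le htr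
  obtain ⟨k, hk1, hk2⟩ := exists_dyadic_between ht htr
  set K := √(c * 2 ^ n / unitVol n) with hK
  have hK0 : 0 ≤ K := Real.sqrt_nonneg _
  -- A strictly negative exponent gives `q > 1`, so the telescoping sum is comparable to its last
  -- term. With exponent zero the sum would grow logarithmically; passing to `α' < 0` avoids this.
  set q := (1 / 2 : ℝ) ^ α' with hq
  have hq1 : 1 < q := Real.one_lt_rpow_of_pos_of_lt_one_of_neg (by norm_num) (by norm_num) hα'
  have hp : (0 : ℝ) < (1 / 2) ^ k := by positivity
  have h1k : ((1 : ℝ) / 2) ^ k ≤ 1 := pow_le_one₀ (by norm_num) (by norm_num)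
  have hra : 0 < r ^ α := Real.rpow_pos_of_pos hr _
  have hqα : ((1 : ℝ) / 2) ^ α ≤ q :=
    Real.rpow_le_rpow_of_exponent_ge (by norm_num) (by norm_num) hα
  have hqk : q ^ k ≤ (t / r) ^ α' := by
    rw [hq, ← Real.rpow_natCast, ← Real.rpow_mul (by norm_num), mul_comm,
      Real.rpow_mul (by norm_num), Real.rpow_natCast]
    exact Real.rpow_le_rpow_of_nonpos (by positivity) ((div_le_iff₀ hr).2 hk1) hα'.le
  have step1 := norm_sub_le_of_geometric (a := fun k => ⨍ z in ball x ((1 / 2) ^ k * r), Γ z)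
    (D := K * r ^ α) hq1.ne' (fun k => (ho.dyadic_le hc h x hr hrδ k).trans (by gcongr)) k
  simp only [pow_zero, one_mul] at step1
  have step2 := ho.average_sub_le hc h (x := x) (y := x) ht (ball_subset_ball hk1)
    (by nlinarith : (1 / 2) ^ k * r < δ₀) hk2 (by positivity)
  have e2 : ((1 / 2 : ℝ) ^ k * r) ^ α ≤ r ^ α * q ^ k := by
    have e : ((1 / 2 : ℝ) ^ k) ^ α = ((1 / 2 : ℝ) ^ α) ^ k := by
      rw [← Real.rpow_natCast, ← Real.rpow_natCast, ← Real.rpow_mul (by norm_num),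
        ← Real.rpow_mul (by norm_num), mul_comm]
    rw [Real.mul_rpow hp.le hr.le, mul_comm, e]
    gcongr
  have hq0 : 0 < q - 1 := by linarith
  calc _ = ‖((⨍ z in ball x t, Γ z) - ⨍ z in ball x ((1 / 2) ^ k * r), Γ z) +
        ((⨍ z in ball x ((1 / 2) ^ k * r), Γ z) - ⨍ z in ball x r, Γ z)‖ := by congr 1; abel
    _ ≤ K * (r ^ α * q ^ k) + K * r ^ α * ((q ^ k - 1) / (q - 1)) :=
        (norm_add_le _ _).trans (add_le_add (step2.trans (by gcongr)) step1)
    _ ≤ K * (r ^ α * q ^ k) + K * r ^ α * (q ^ k / (q - 1)) := by gcongr; linarith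
    _ = K * (1 + (q - 1)⁻¹) * (r ^ α * q ^ k) := by field_simp
    _ ≤ _ := by gcongr

end FormSubordination

end

noncomputable section

namespace FormSubordination

open Metric Filter Topology

variable {n : ℕ}

/-! ### The meaning of the oscillation condition -/

theorem oscillationBound_iff {β δ₀ c : ℝ} (hβ : 0 < β) {Γ : Rn n → Cn n} :
    OscillationBound β δ₀ c Γ ↔ OscLE ((1 - β) / (1 + β)) δ₀ c Γ := by
  have e : (n : ℝ) - 2 * ((β - 1) / (β + 1)) = (n : ℝ) + 2 * ((1 - β) / (1 + β)) := by
    have : β + 1 ≠ 0 := by positivity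
    have : 1 + β ≠ 0 := by positivity
    field_simp
    ring
  simp only [OscillationBound, OscLE, e]

theorem rpow_add_two_mul {t α : ℝ} (ht : 0 < t) :
    t ^ ((n : ℝ) + 2 * α) = t ^ n * (t ^ α) ^ 2 := by
  rw [Real.rpow_add ht, Real.rpow_natCast, mul_comm 2 α, Real.rpow_mul ht.le]
  norm_num

theorem setIntegral_biUnion_le_sum {ι : Type*} (S : Finset ι) (s : ι → Set (Rn n))
    (hs : ∀ i, MeasurableSet (s i)) {f : Rn n → ℝ} (hf : ∀ x, 0 ≤ f x)
    (hi : ∀ i, IntegrableOn f (s i)) :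
    ∫ x in ⋃ i ∈ S, s i, f x ≤ ∑ i ∈ S, ∫ x in s i, f x := by
  classical
  induction S using Finset.induction_on with
  | empty => simp
  | insert a S ha ih =>
    have hU : MeasurableSet (⋃ i ∈ S, s i) := Finset.measurableSet_biUnion S fun i _ => hs i
    have hIU : IntegrableOn f (⋃ i ∈ S, s i) := by
      rw [integrableOn_finset_iUnion]; exact fun i _ => hi i
    rw [Finset.set_biUnion_insert, Finset.sum_insert ha]
    refine le_trans ?_ (add_le_add le_rfl ih)
    have h1 : s a ∪ ⋃ i ∈ S, s i = s a ∪ ((⋃ i ∈ S, s i) \ s a) := by simp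
    rw [h1, setIntegral_union Set.disjoint_sdiff_right (hU.diff (hs a)) (hi a)
      (hIU.mono_set Set.sdiff_subset)]
    gcongr
    · exact Eventually.of_forall hf
    · exact Set.sdiff_subset

/-- A bound on balls of one radius implies one on balls of any other radius. -/
theorem exists_integral_ball_le {Γ : Rn n → Cn n} (h : IsL2Loc Γ) {r A : ℝ} (hr : 0 < r)
    (hA : ∀ x : Rn n, ∫ y in ball x r, ‖Γ y‖ ^ 2 ≤ A) (R : ℝ) :
    ∃ A' : ℝ, ∀ x : Rn n, ∫ y in ball x R, ‖Γ y‖ ^ 2 ≤ A' := by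
  -- A finite cover of the ball at the origin is translated to every centre, so the number of balls
  -- does not depend on the centre.
  obtain ⟨S, -, hS⟩ := (isCompact_closedBall (0 : Rn n) R).elim_finite_subcover_image
    (b := Set.univ) (c := fun s => ball s r) (fun _ _ => isOpen_ball)
    (fun x _ => Set.mem_biUnion (Set.mem_univ x) (mem_ball_self hr))
  obtain ⟨hfin, hS⟩ := hS
  refine ⟨∑ s ∈ hfin.toFinset, A, fun x => ?_⟩
  have hsub : ball x R ⊆ ⋃ s ∈ hfin.toFinset, ball (x + s) r := by
    intro y hy
    have : y - x ∈ closedBall (0 : Rn n) R := by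
      rw [mem_closedBall, dist_zero_right]
      rw [mem_ball, dist_eq_norm] at hy
      exact hy.le
    obtain ⟨s, hs, hys⟩ := Set.mem_iUnion₂.1 (hS this)
    refine Set.mem_iUnion₂.2 ⟨s, by simpa using hs, ?_⟩
    rw [mem_ball, dist_eq_norm] at hys ⊢
    rwa [← sub_sub]
  have hI : ∀ s : Rn n, IntegrableOn (fun y => ‖Γ y‖ ^ 2) (ball (x + s) r) :=
    fun s => h.integrableOn_norm_sq _ _
  calc ∫ y in ball x R, ‖Γ y‖ ^ 2 ≤ ∫ y in ⋃ s ∈ hfin.toFinset, ball (x + s) r, ‖Γ y‖ ^ 2 := by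
        refine setIntegral_mono_set ?_ (Eventually.of_forall fun _ => by positivity)
          hsub.eventuallyLE
        rw [integrableOn_finset_iUnion]; exact fun i _ => hI i
    _ ≤ ∑ s ∈ hfin.toFinset, ∫ y in ball (x + s) r, ‖Γ y‖ ^ 2 :=
        setIntegral_biUnion_le_sum _ _ (fun _ => measurableSet_ball) (fun _ => by positivity) hI
    _ ≤ _ := Finset.sum_le_sum fun s _ => hA _

theorem integral_norm_sq_ball_mono {Γ : Rn n → Cn n} (h : IsL2Loc Γ) (x : Rn n) {r R : ℝ}
    (hrR : r ≤ R) : ∫ y in ball x r, ‖Γ y‖ ^ 2 ≤ ∫ y in ball x R, ‖Γ y‖ ^ 2 :=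
  setIntegral_mono_set (h.integrableOn_norm_sq x R) (Eventually.of_forall fun _ => by positivity)
    (ball_subset_ball hrR).eventuallyLE

theorem integral_norm_sq_le_osc_add {Γ : Rn n → Cn n} (h : IsL2Loc Γ) (x : Rn n) {t : ℝ}
    (ht : 0 < t) (b : Cn n) :
    ∫ y in ball x t, ‖Γ y‖ ^ 2 ≤
      2 * (∫ y in ball x t, ‖Γ y - b‖ ^ 2) + 2 * (‖b‖ ^ 2 * (t ^ n * unitVol n)) := by
  have h2 : ∫ y in ball x t, ‖Γ y‖ ^ 2 ≤
      ∫ y in ball x t, (2 * ‖Γ y - b‖ ^ 2 + 2 * ‖b‖ ^ 2) := by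
    refine setIntegral_mono_on (h.integrableOn_norm_sq x t)
      (((h.integrableOn_norm_sub_sq x t b).const_mul 2).add
        (integrableOn_const measure_ball_lt_top.ne)) measurableSet_ball fun y _ => ?_
    have : ‖Γ y‖ ≤ ‖Γ y - b‖ + ‖b‖ := by
      refine le_trans (le_of_eq ?_) (norm_add_le _ _)
      congr 1; abel
    nlinarith [norm_nonneg (Γ y), norm_nonneg (Γ y - b), norm_nonneg b,
      sq_nonneg (‖Γ y - b‖ - ‖b‖)]
  rw [integral_add ((h.integrableOn_norm_sub_sq x t b).const_mul 2)
    (integrableOn_const measure_ball_lt_top.ne), integral_const_mul, setIntegral_const,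
    smul_eq_mul, volume_real_ball x ht] at h2
  linarith

/-- For `α < 0` the average over the ball of radius `t` differs from the one over a fixed radius `r`
by `O(t ^ α)`. The latter average is bounded by the uniform `L²` norm, and a bounded quantity is
itself `O(t ^ α)` since `t ^ α ≥ r ^ α`. -/
theorem OscLE.morrey {α δ₀ c : ℝ} (hα : α < 0) (hδ₀ : 0 < δ₀) (hc : 0 < c)
    {Γ : Rn n → Cn n} (h : IsL2Unif Γ) (ho : OscLE α δ₀ c Γ) :
    ∃ δ₁ > 0, ∃ c' > 0, ∀ x : Rn n, ∀ t : ℝ, 0 < t → t < δ₁ →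
      ∫ y in ball x t, ‖Γ y‖ ^ 2 ≤ c' * t ^ ((n : ℝ) + 2 * α) := by
  obtain ⟨hL, A, hA⟩ := h
  set r := min 1 (δ₀ / 2) with hrdef
  have hr : 0 < r := by positivity
  have hr1 : r ≤ 1 := min_le_left _ _
  have hrδ : r < δ₀ := (min_le_right _ _).trans_lt (by linarith)
  have hω := unitVol_pos n
  have hA0 : 0 ≤ A := (integral_nonneg fun _ => by positivity).trans (hA 0)
  set C := √(c * 2 ^ n / unitVol n) * (1 + ((1 / 2 : ℝ) ^ α - 1)⁻¹) with hC
  set D := √(A / (r ^ n * unitVol n)) with hD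
  have hq1 : 1 < (1 / 2 : ℝ) ^ α :=
    Real.one_lt_rpow_of_pos_of_lt_one_of_neg (by norm_num) (by norm_num) hα
  have hC0 : 0 ≤ C := by
    have : 0 ≤ ((1 / 2 : ℝ) ^ α - 1)⁻¹ := inv_nonneg.2 (by linarith)
    positivity
  refine ⟨r, hr, 2 * c + 2 * ((C + D * r ^ (-α)) ^ 2 * unitVol n), by positivity,
    fun x t ht htr => ?_⟩
  have hm := ho.average_sub_average_le hc.le hL hα le_rfl x ht htr.le hrδ
  have hta : r ^ α * (t / r) ^ α = t ^ α := by
    rw [← Real.mul_rpow hr.le (by positivity)]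
    congr 1; field_simp
  rw [hta] at hm
  have hmr : ‖⨍ z in ball x r, Γ z‖ ≤ D := by
    have h1 := norm_average_sub_sq_le hL x hr 0
    simp only [sub_zero] at h1
    rw [volume_real_ball x hr] at h1
    have h2 := h1.trans ((integral_norm_sq_ball_mono hL x hr1).trans (hA x))
    exact Real.le_sqrt_of_sq_le ((le_div_iff₀ (by positivity)).2 h2)
  have hmt : ‖⨍ z in ball x t, Γ z‖ ≤ (C + D * r ^ (-α)) * t ^ α := by
    have h3 : ‖⨍ z in ball x t, Γ z‖ ≤ C * t ^ α + D := by
      refine le_trans ?_ (add_le_add hm hmr)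
      refine le_trans (le_of_eq ?_) (norm_add_le _ _)
      congr 1; abel
    have h4 : 1 ≤ r ^ (-α) * t ^ α := by
      rw [Real.rpow_neg hr.le, ← div_eq_inv_mul, one_le_div (by positivity)]
      exact Real.rpow_le_rpow_of_nonpos ht htr.le hα.le
    have hD0 : 0 ≤ D := Real.sqrt_nonneg _
    nlinarith
  have h5 := integral_norm_sq_le_osc_add hL x ht (⨍ z in ball x t, Γ z)
  have h6 := ho x t ht (htr.trans hrδ)
  rw [rpow_add_two_mul ht] at h6 ⊢
  have hm0 := norm_nonneg (⨍ z in ball x t, Γ z)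
  have h7 : ‖⨍ z in ball x t, Γ z‖ ^ 2 ≤ (C + D * r ^ (-α)) ^ 2 * (t ^ α) ^ 2 := by
    rw [← mul_pow]
    exact pow_le_pow_left₀ hm0 hmt 2
  have htn : 0 < t ^ n := by positivity
  calc _ ≤ _ := h5
    _ ≤ 2 * (c * (t ^ n * (t ^ α) ^ 2)) +
        2 * (((C + D * r ^ (-α)) ^ 2 * (t ^ α) ^ 2) * (t ^ n * unitVol n)) := by gcongr
    _ = _ := by ring

theorem oscLE_of_morrey {α δ₀ c : ℝ} {Γ : Rn n → Cn n} (h : IsL2Loc Γ)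
    (hM : ∀ x : Rn n, ∀ t : ℝ, 0 < t → t < δ₀ →
      ∫ y in ball x t, ‖Γ y‖ ^ 2 ≤ c * t ^ ((n : ℝ) + 2 * α)) :
    OscLE α δ₀ (4 * c) Γ := by
  intro x t ht htδ
  have h1 := integral_norm_sub_average_sq_le h x ht 0
  simp only [sub_zero] at h1
  linarith [hM x t ht htδ]

theorem morrey_iff {β : ℝ} (hβ : 1 < β) {Γ : Rn n → Cn n} (h : IsL2Loc Γ) :
    (IsL2Unif Γ ∧ ∃ δ₀ > 0, ∃ c > 0, OscillationBound β δ₀ c Γ) ↔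
      ∃ δ₀ > 0, ∃ c > 0, MorreyBound β δ₀ c Γ := by
  have hβ0 : 0 < β := by linarith
  have e : (n : ℝ) - 2 * ((β - 1) / (β + 1)) = (n : ℝ) + 2 * ((1 - β) / (1 + β)) := by
    have : β + 1 ≠ 0 := by positivity
    have : 1 + β ≠ 0 := by positivity
    field_simp
    ring
  simp only [oscillationBound_iff hβ0, MorreyBound, e]
  constructor
  · rintro ⟨hU, δ₀, hδ₀, c, hc, ho⟩
    exact ho.morrey (div_neg_of_neg_of_pos (by linarith) (by linarith)) hδ₀ hc hU
  · rintro ⟨δ₀, hδ₀, c, hc, hM⟩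
    refine ⟨⟨h, ?_⟩, δ₀, hδ₀, 4 * c, by positivity, oscLE_of_morrey h hM⟩
    exact exists_integral_ball_le h (half_pos hδ₀)
      (fun x => hM x (δ₀ / 2) (half_pos hδ₀) (half_lt_self hδ₀)) 1

/-- For `β = 1` the exponent is exactly `n`, so (A) already is the BMO bound for small balls. Only
radii between `δ₀` and `1` need an argument, and there the uniform `L²` bound suffices. -/
theorem localBMO_iff {Γ : Rn n → Cn n} :
    (IsL2Unif Γ ∧ ∃ δ₀ > 0, ∃ c > 0, OscillationBound 1 δ₀ c Γ) ↔ IsLocalBMO Γ := by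
  have hω := unitVol_pos n
  have hav : ∀ (x : Rn n) (t : ℝ), 0 < t →
      (⨍ y in ball x t, ‖Γ y - ⨍ z in ball x t, Γ z‖ ^ 2) =
        (t ^ n * unitVol n)⁻¹ * ∫ y in ball x t, ‖Γ y - ⨍ z in ball x t, Γ z‖ ^ 2 := by
    intro x t ht
    rw [setAverage_eq, volume_real_ball x ht, smul_eq_mul]
  have e : ((n : ℝ) - 2 * ((1 - 1) / (1 + 1))) = n := by norm_num
  simp only [OscillationBound, e, Real.rpow_natCast]
  constructor
  · rintro ⟨hU, δ₀, hδ₀, c, hc, ho⟩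
    refine ⟨hU, ?_⟩
    obtain ⟨hL, A, hA⟩ := hU
    have hA0 : 0 ≤ A := (integral_nonneg fun _ => by positivity).trans (hA 0)
    refine ⟨c / unitVol n + 4 * A / (δ₀ ^ n * unitVol n), fun x t ht ht1 => ?_⟩
    rw [hav x t ht, inv_mul_le_iff₀ (by positivity)]
    rcases lt_or_ge t δ₀ with htδ | htδ
    · refine (ho x t ht htδ).trans ?_
      have : 0 ≤ 4 * A / (δ₀ ^ n * unitVol n) := by positivity
      calc c * t ^ n = t ^ n * unitVol n * (c / unitVol n) := by field_simp
        _ ≤ _ := by gcongr; linarith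
    · have h1 := integral_norm_sub_average_sq_le hL x ht 0
      simp only [sub_zero] at h1
      have h2 := (integral_norm_sq_ball_mono hL x ht1).trans (hA x)
      have h3 : δ₀ ^ n * unitVol n * (4 * A / (δ₀ ^ n * unitVol n)) = 4 * A := by field_simp
      have h4 : 4 * A ≤ t ^ n * unitVol n * (4 * A / (δ₀ ^ n * unitVol n)) := by
        calc 4 * A = δ₀ ^ n * unitVol n * (4 * A / (δ₀ ^ n * unitVol n)) := h3.symm
          _ ≤ _ := by gcongr
      have h5 : 0 ≤ t ^ n * unitVol n * (c / unitVol n) := by positivity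
      linarith
  · rintro ⟨hU, A, hA⟩
    refine ⟨hU, 1, one_pos, |A| * unitVol n + 1, by positivity, fun x t ht ht1 => ?_⟩
    have h1 := hA x t ht ht1.le
    rw [hav x t ht, inv_mul_le_iff₀ (by positivity)] at h1
    have h2 : t ^ n * unitVol n * A ≤ t ^ n * unitVol n * |A| := by gcongr; exact le_abs_self A
    nlinarith [pow_pos ht n]

theorem ae_tendsto_average_ball {Γ : Rn n → Cn n} (h : IsL2Loc Γ) {r : ℝ} (hr : 0 < r) :
    ∀ᵐ x, Tendsto (fun k : ℕ => ⨍ z in ball x ((1 / 2) ^ k * r), Γ z) atTop (𝓝 (Γ x)) := by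
  filter_upwards [IsUnifLocDoublingMeasure.ae_tendsto_average volume h.locallyIntegrable 1]
    with x hx
  have h0 : Tendsto (fun k : ℕ => (1 / 2 : ℝ) ^ k * r) atTop (𝓝[>] 0) := by
    refine tendsto_nhdsWithin_iff.2 ⟨?_, Eventually.of_forall fun k => ?_⟩
    · simpa using (tendsto_pow_atTop_nhds_zero_of_lt_one (r := (1 / 2 : ℝ)) (by norm_num)
        (by norm_num)).mul_const r
    · exact Set.mem_Ioi.2 (by positivity)
  refine (hx (fun _ => x) _ h0 (Eventually.of_forall fun k => ?_)).congr fun k => ?_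
  · exact mem_closedBall_self (by positivity)
  -- The differentiation theorem concerns closed balls; spheres are null sets.
  · refine setAverage_congr ?_
    have : ((1 : ℝ) / 2) ^ k * r ≠ 0 := by positivity
    rw [← ball_union_sphere]
    exact union_ae_eq_left_of_ae_eq_empty
      (ae_eq_empty.2 (Measure.addHaar_sphere_of_ne_zero _ _ this))

/-- Campanato's argument. Dyadic averages converge at every point, the limit `Γ'` agrees with `Γ` at
Lebesgue points, and `Γ' x` is within `O(r ^ α)` of the average over the ball of radius `r`. For `d
= ‖x - x'‖` the averages over `ball x d ⊆ ball x' (2 * d)` are then compared. -/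
theorem OscLE.exists_holder {α δ₀ c : ℝ} (hα : 0 < α) (hδ₀ : 0 < δ₀) (hc : 0 < c)
    {Γ : Rn n → Cn n} (h : IsL2Loc Γ) (ho : OscLE α δ₀ c Γ) :
    IsLocallyUniformlyHolder α Γ := by
  set K := √(c * 2 ^ n / unitVol n) with hK
  have hK0 : 0 ≤ K := Real.sqrt_nonneg _
  set q := (1 / 2 : ℝ) ^ α with hq
  have hq0 : 0 < q := by positivity
  have hq1 : q < 1 := Real.rpow_lt_one (by norm_num) (by norm_num) hα
  have hlim : ∀ (x : Rn n) (r : ℝ), 0 < r → r < δ₀ → ∃ z, Tendsto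
      (fun k : ℕ => ⨍ y in ball x ((1 / 2) ^ k * r), Γ y) atTop (𝓝 z) := fun x r hr hrδ =>
    cauchySeq_tendsto_of_complete <| cauchySeq_of_le_geometric q (K * r ^ α) hq1 fun k => by
      rw [dist_comm, dist_eq_norm]
      exact ho.dyadic_le hc.le h x hr hrδ k
  have hest : ∀ (x : Rn n) (r : ℝ) (z : Cn n), 0 < r → r < δ₀ → Tendsto
      (fun k : ℕ => ⨍ y in ball x ((1 / 2) ^ k * r), Γ y) atTop (𝓝 z) →
      ‖z - ⨍ y in ball x r, Γ y‖ ≤ K * (1 - q)⁻¹ * r ^ α := by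
    intro x r z hr hrδ hz
    refine le_of_tendsto ((hz.sub_const _).norm) (Eventually.of_forall fun k => ?_)
    have h1 := norm_sub_le_of_geometric (a := fun k => ⨍ z in ball x ((1 / 2) ^ k * r), Γ z)
      (D := K * r ^ α) hq1.ne (ho.dyadic_le hc.le h x hr hrδ) k
    simp only [pow_zero, one_mul] at h1
    refine h1.trans ?_
    have h2 : (q ^ k - 1) / (q - 1) ≤ (1 - q)⁻¹ := by
      rw [← neg_div_neg_eq, neg_sub, neg_sub, inv_eq_one_div]
      have : 0 < 1 - q := by linarith
      gcongr
      linarith [pow_pos hq0 k]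
    calc K * r ^ α * ((q ^ k - 1) / (q - 1)) ≤ K * r ^ α * (1 - q)⁻¹ := by gcongr
      _ = _ := by ring
  have hr0 : 0 < δ₀ / 2 := half_pos hδ₀
  choose Γ' hΓ' using fun x => hlim x (δ₀ / 2) hr0 (half_lt_self hδ₀)
  have hae : Γ' =ᵐ[volume] Γ := by
    filter_upwards [ae_tendsto_average_ball h hr0] with x hx using
      tendsto_nhds_unique (hΓ' x) hx
  -- Dropping the first `j` averages does not change the limit, so the tail estimate applies from
  -- every dyadic radius on.
  have hscale : ∀ (x : Rn n) (j : ℕ), Tendsto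
      (fun k : ℕ => ⨍ y in ball x ((1 / 2) ^ k * ((1 / 2) ^ j * (δ₀ / 2))), Γ y) atTop
        (𝓝 (Γ' x)) := by
    intro x j
    refine ((hΓ' x).comp (tendsto_add_atTop_nat j)).congr fun k => ?_
    simp only [Function.comp, pow_add, mul_assoc]
  have hbound : ∀ (x : Rn n) (r : ℝ), 0 < r → r ≤ δ₀ / 2 →
      ‖Γ' x - ⨍ y in ball x r, Γ y‖ ≤ (K * (1 - q)⁻¹ + K) * (2 * r) ^ α := by
    intro x r hr hrδ
    obtain ⟨j, hj1, hj2⟩ := exists_dyadic_between hr hrδ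
    set s := (1 / 2) ^ j * (δ₀ / 2) with hs
    have hs0 : 0 < s := by positivity
    have hsδ : s < δ₀ := by
      have : ((1 : ℝ) / 2) ^ j ≤ 1 := pow_le_one₀ (by norm_num) (by norm_num)
      nlinarith
    have h1 := hest x s (Γ' x) hs0 hsδ (hscale x j)
    have h2 := ho.average_sub_le hc.le h (x := x) (y := x) hr (ball_subset_ball hj1) hsδ hj2 hs0
    rw [norm_sub_rev] at h2
    have h3 : s ^ α ≤ (2 * r) ^ α := Real.rpow_le_rpow hs0.le hj2 hα.le
    have : 0 < (1 - q)⁻¹ := inv_pos.2 (by linarith)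
    calc ‖Γ' x - ⨍ y in ball x r, Γ y‖ = ‖(Γ' x - ⨍ y in ball x s, Γ y) +
          ((⨍ y in ball x s, Γ y) - ⨍ y in ball x r, Γ y)‖ := by congr 1; abel
      _ ≤ K * (1 - q)⁻¹ * s ^ α + K * s ^ α := (norm_add_le _ _).trans (add_le_add h1 h2)
      _ = (K * (1 - q)⁻¹ + K) * s ^ α := by ring
      _ ≤ _ := by gcongr
  have hq2 : 0 < (1 - q)⁻¹ := inv_pos.2 (by linarith)
  -- `hbound` is available up to radius `δ₀ / 2` and is used below with radius `2 * d`.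
  refine ⟨δ₀ / 4, by positivity,
    ((K * (1 - q)⁻¹ + K) * 2 ^ α + (K * (1 - q)⁻¹ + K) * 4 ^ α + K * 2 ^ α) + 1, by positivity,
    Γ', hae, fun x x' hxx => ?_⟩
  rcases eq_or_ne x x' with rfl | hne
  · simp [Real.zero_rpow hα.ne']
  set d := ‖x - x'‖ with hd
  have hd0 : 0 < d := norm_pos_iff.2 (sub_ne_zero.2 hne)
  have hsub : ball x d ⊆ ball x' (2 * d) := by
    refine ball_subset_ball' ?_
    rw [dist_eq_norm]; linarith
  have h1 := hbound x d hd0 (by linarith)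
  have h2 := hbound x' (2 * d) (by linarith) (by linarith)
  have h3 := ho.average_sub_le hc.le h hd0 hsub (by linarith) le_rfl (by linarith)
  rw [norm_sub_rev] at h2
  have e2 : (2 * d) ^ α = 2 ^ α * d ^ α := Real.mul_rpow (by norm_num) hd0.le
  have e4 : (2 * (2 * d)) ^ α = 4 ^ α * d ^ α := by
    rw [← Real.mul_rpow (by norm_num) hd0.le]; ring_nf
  rw [e2] at h1 h3
  rw [e4] at h2
  have hda : 0 ≤ d ^ α := by positivity
  calc ‖Γ' x - Γ' x'‖ = ‖(Γ' x - ⨍ y in ball x d, Γ y) +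
        (((⨍ y in ball x d, Γ y) - ⨍ y in ball x' (2 * d), Γ y) +
          ((⨍ y in ball x' (2 * d), Γ y) - Γ' x'))‖ := by congr 1; abel
    _ ≤ _ := (norm_add_le _ _).trans (add_le_add h1 ((norm_add_le _ _).trans (add_le_add h3 h2)))
    _ ≤ _ := by nlinarith

theorem oscLE_of_holder {α δ₀ c : ℝ} (hα : 0 < α) (hc : 0 < c) {Γ Γ' : Rn n → Cn n}
    (h : IsL2Loc Γ) (hae : Γ' =ᵐ[volume] Γ)
    (hH : ∀ x x' : Rn n, ‖x - x'‖ < δ₀ → ‖Γ' x - Γ' x'‖ ≤ c * ‖x - x'‖ ^ α) :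
    OscLE α δ₀ (4 * c ^ 2 * unitVol n) Γ := by
  intro x t ht htδ
  refine (integral_norm_sub_average_sq_le h x ht (Γ' x)).trans ?_
  have h1 : ∫ y in ball x t, ‖Γ y - Γ' x‖ ^ 2 ≤ ∫ y in ball x t, (c * t ^ α) ^ 2 := by
    refine setIntegral_mono_on_ae (h.integrableOn_norm_sub_sq x t _)
      (integrableOn_const measure_ball_lt_top.ne) measurableSet_ball ?_
    filter_upwards [hae] with y hy hyb
    rw [← hy]
    rw [mem_ball, dist_eq_norm] at hyb
    have : ‖Γ' y - Γ' x‖ ≤ c * t ^ α := (hH y x (hyb.trans htδ)).trans (by gcongr)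
    gcongr
  rw [setIntegral_const, smul_eq_mul, volume_real_ball x ht] at h1
  rw [rpow_add_two_mul ht]
  nlinarith

theorem holder_iff {β : ℝ} (hβ : 0 < β) (hβ1 : β < 1) {Γ : Rn n → Cn n} (h : IsL2Loc Γ) :
    (∃ δ₀ > 0, ∃ c > 0, OscillationBound β δ₀ c Γ) ↔
      IsLocallyUniformlyHolder ((1 - β) / (1 + β)) Γ := by
  have hα : 0 < (1 - β) / (1 + β) := div_pos (by linarith) (by linarith)
  simp only [oscillationBound_iff hβ]
  constructor
  · rintro ⟨δ₀, hδ₀, c, hc, ho⟩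
    exact ho.exists_holder hα hδ₀ hc h
  · rintro ⟨δ₀, hδ₀, c, hc, Γ', hae, hH⟩
    have := unitVol_pos n
    exact ⟨δ₀, hδ₀, 4 * c ^ 2 * unitVol n, by positivity, oscLE_of_holder hα hc h hae hH⟩

end FormSubordination

end

noncomputable section

namespace FormSubordination

open Metric Filter Topology

variable {n : ℕ}

/-! ### Partial derivatives and averages against a kernel -/

section Calculus

variable {F : Type*} [NormedAddCommGroup F] [NormedSpace ℝ F]

/-- The `i`-th partial derivative. -/
def pd (i : Fin n) (f : Rn n → F) : Rn n → F := fun x => fderiv ℝ f x (basisVec i)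

theorem norm_basisVec (i : Fin n) : ‖(basisVec i : Rn n)‖ = 1 := by
  simp [basisVec]

theorem contDiff_pd {f : Rn n → F} (hf : ContDiff ℝ ∞ f) (i : Fin n) : ContDiff ℝ ∞ (pd i f) :=
  (hf.fderiv_right (m := ∞) (by simp)).clm_apply contDiff_const

theorem continuous_pd {f : Rn n → F} (hf : ContDiff ℝ 1 f) (i : Fin n) : Continuous (pd i f) :=
  (hf.continuous_fderiv (by simp)).clm_apply continuous_const

theorem hasCompactSupport_pd {f : Rn n → F} (hf : HasCompactSupport f) (i : Fin n) :
    HasCompactSupport (pd i f) := hf.fderiv_apply (𝕜 := ℝ) _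

theorem integral_smul_pd_left {f : Rn n → ℝ} {g : Rn n → F} (hf : ContDiff ℝ 1 f)
    (hfc : HasCompactSupport f) (hg : ContDiff ℝ 1 g) (i : Fin n) :
    ∫ x, f x • pd i g x = -∫ x, pd i f x • g x := by
  refine integral_smul_fderiv_eq_neg_fderiv_smul_of_integrable ?_ ?_ ?_ ?_ ?_
  · exact ((continuous_pd hf i).smul hg.continuous).integrable_of_hasCompactSupport
      (hasCompactSupport_pd hfc i).smul_right
  · exact (hf.continuous.smul (continuous_pd hg i)).integrable_of_hasCompactSupport
      hfc.smul_right
  · exact (hf.continuous.smul hg.continuous).integrable_of_hasCompactSupport hfc.smul_right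
  · exact fun x _ => (hf.differentiable (by simp)).differentiableAt
  · exact fun x _ => (hg.differentiable (by simp)).differentiableAt

theorem integral_smul_pd_right {f : Rn n → ℝ} {g : Rn n → F} (hf : ContDiff ℝ 1 f)
    (hgc : HasCompactSupport g) (hg : ContDiff ℝ 1 g) (i : Fin n) :
    ∫ x, f x • pd i g x = -∫ x, pd i f x • g x := by
  refine integral_smul_fderiv_eq_neg_fderiv_smul_of_integrable ?_ ?_ ?_ ?_ ?_
  · exact ((continuous_pd hf i).smul hg.continuous).integrable_of_hasCompactSupport
      hgc.smul_left
  · exact (hf.continuous.smul (continuous_pd hg i)).integrable_of_hasCompactSupport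
      (hasCompactSupport_pd hgc i).smul_left
  · exact (hf.continuous.smul hg.continuous).integrable_of_hasCompactSupport hgc.smul_left
  · exact fun x _ => (hf.differentiable (by simp)).differentiableAt
  · exact fun x _ => (hg.differentiable (by simp)).differentiableAt

/-- The average `∫ ψ(z) v(x - s z) dz`. -/
def av (ψ : Rn n → ℝ) (s : ℝ) (v : Rn n → F) (x : Rn n) : F := ∫ z, ψ z • v (x - s • z)

theorem av_eq_setIntegral (ψ : Rn n → ℝ) (s : ℝ) (v : Rn n → F) (x : Rn n) :
    av ψ s v x = ∫ z in tsupport ψ, ψ z • v (x - s • z) := by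
  rw [av, setIntegral_eq_integral_of_forall_compl_eq_zero]
  intro z hz
  rw [image_eq_zero_of_notMem_tsupport hz, zero_smul]

/-- Joint continuity, including `s = 0`, is what permits integration in the scale down to zero. -/
theorem continuous_av {ψ : Rn n → ℝ} (hψ : Continuous ψ) (hψc : HasCompactSupport ψ)
    {v : Rn n → F} (hv : Continuous v) :
    Continuous (fun p : ℝ × Rn n => av ψ p.1 v p.2) := by
  simp only [av_eq_setIntegral]
  refine continuous_parametric_integral_of_continuous
    (f := fun (p : ℝ × Rn n) z => ψ z • v (p.2 - p.1 • z)) ?_ hψc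
  simp only [Function.uncurry_def]
  fun_prop

theorem integrable_av {ψ : Rn n → ℝ} (hψ : Continuous ψ) (hψc : HasCompactSupport ψ)
    {v : Rn n → F} (hv : Continuous v) (s : ℝ) (x : Rn n) :
    Integrable fun z => ψ z • v (x - s • z) :=
  (by fun_prop : Continuous fun z => ψ z • v (x - s • z)).integrable_of_hasCompactSupport
    hψc.smul_right

theorem hasFDerivAt_av {ψ : Rn n → ℝ} (hψ : Continuous ψ) (hψc : HasCompactSupport ψ)
    {v : Rn n → F} (hv : ContDiff ℝ 1 v) (s : ℝ) (x : Rn n) :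
    HasFDerivAt (av ψ s v) (av ψ s (fderiv ℝ v) x) x := by
  have hv' : Continuous (fderiv ℝ v) := hv.continuous_fderiv (by simp)
  obtain ⟨C, hC⟩ : ∃ C, ∀ p ∈ (closedBall x 1) ×ˢ tsupport ψ,
      ‖fderiv ℝ v (p.1 - s • p.2)‖ ≤ C :=
    ((isCompact_closedBall x 1).prod hψc).exists_bound_of_continuousOn
      (f := fun p : Rn n × Rn n => fderiv ℝ v (p.1 - s • p.2)) (by fun_prop)
  refine hasFDerivAt_integral_of_dominated_of_fderiv_le (𝕜 := ℝ)
    (F := fun x z => ψ z • v (x - s • z)) (F' := fun x z => ψ z • fderiv ℝ v (x - s • z))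
    (bound := fun z => ‖ψ z‖ * C) (s := ball x 1) (ball_mem_nhds x one_pos) ?_ ?_ ?_ ?_ ?_ ?_
  · exact Eventually.of_forall fun y => (integrable_av hψ hψc hv.continuous s y).1
  · exact integrable_av hψ hψc hv.continuous s x
  · exact (integrable_av hψ hψc hv' s x).1
  · refine Eventually.of_forall fun z y hy => ?_
    rw [norm_smul]
    by_cases hz : z ∈ tsupport ψ
    · exact mul_le_mul_of_nonneg_left (hC (y, z) ⟨ball_subset_closedBall hy, hz⟩) (norm_nonneg _)
    · simp [image_eq_zero_of_notMem_tsupport hz]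
  · exact (hψ.norm.integrable_of_hasCompactSupport hψc.norm).mul_const C
  · refine Eventually.of_forall fun z y _ => ?_
    have h1 : HasFDerivAt v (fderiv ℝ v (y - s • z)) (y - s • z) :=
      (hv.differentiable (by simp)).differentiableAt.hasFDerivAt
    exact ((h1.comp y ((hasFDerivAt_id y).sub_const (s • z))).const_smul (ψ z))

theorem fderiv_av {ψ : Rn n → ℝ} (hψ : Continuous ψ) (hψc : HasCompactSupport ψ)
    {v : Rn n → F} (hv : ContDiff ℝ 1 v) (s : ℝ) :
    fderiv ℝ (av ψ s v) = av ψ s (fderiv ℝ v) :=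
  funext fun x => (hasFDerivAt_av hψ hψc hv s x).fderiv

theorem pd_av {ψ : Rn n → ℝ} (hψ : Continuous ψ) (hψc : HasCompactSupport ψ)
    {v : Rn n → F} (hv : ContDiff ℝ 1 v) (s : ℝ) (i : Fin n) :
    pd i (av ψ s v) = av ψ s (pd i v) := by
  funext x
  rw [pd, fderiv_av hψ hψc hv, av,
    ContinuousLinearMap.integral_apply (integrable_av hψ hψc (hv.continuous_fderiv (by simp)) s x)]
  rfl

end Calculus

/-- The value space is quantified inside the induction because the derivative of `v` takes values in
a space of linear maps. -/
theorem contDiff_av_nat {ψ : Rn n → ℝ} (hψ : Continuous ψ) (hψc : HasCompactSupport ψ) (s : ℝ)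
    (k : ℕ) : ∀ {F : Type} [NormedAddCommGroup F] [NormedSpace ℝ F] {v : Rn n → F},
    ContDiff ℝ k v → ContDiff ℝ k (av ψ s v) := by
  induction k with
  | zero =>
    intro F _ _ v hv
    rw [Nat.cast_zero, contDiff_zero] at hv ⊢
    exact (continuous_av hψ hψc hv).comp (by fun_prop : Continuous fun x : Rn n => (s, x))
  | succ k ih =>
    intro F _ _ v hv
    have h1 : ContDiff ℝ 1 v := hv.of_le (by simp)
    rw [Nat.cast_succ, contDiff_succ_iff_fderiv] at hv ⊢
    refine ⟨fun x => (hasFDerivAt_av hψ hψc h1 s x).differentiableAt, by simp, ?_⟩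
    rw [fderiv_av hψ hψc h1]
    exact ih hv.2.2

theorem contDiff_av {ψ : Rn n → ℝ} (hψ : Continuous ψ) (hψc : HasCompactSupport ψ) (s : ℝ)
    {F : Type} [NormedAddCommGroup F] [NormedSpace ℝ F] {v : Rn n → F}
    (hv : ContDiff ℝ ∞ v) : ContDiff ℝ ∞ (av ψ s v) :=
  contDiff_infty.2 fun k => contDiff_av_nat hψ hψc s k (contDiff_infty.1 hv k)

section Calculus

variable {F : Type*} [NormedAddCommGroup F] [NormedSpace ℝ F]

theorem av_eq_zero_of_notMem {ψ : Rn n → ℝ} {s : ℝ} {v : Rn n → F} {x : Rn n}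
    (hx : ∀ z ∈ tsupport ψ, x - s • z ∉ tsupport v) : av ψ s v x = 0 := by
  rw [av]
  refine integral_eq_zero_of_ae (Eventually.of_forall fun z => ?_)
  by_cases hz : z ∈ tsupport ψ
  · simp [image_eq_zero_of_notMem_tsupport (hx z hz)]
  · simp [image_eq_zero_of_notMem_tsupport hz]

theorem hasCompactSupport_av {ψ : Rn n → ℝ} (hψc : HasCompactSupport ψ) {v : Rn n → F}
    (hvc : HasCompactSupport v) (s : ℝ) : HasCompactSupport (av ψ s v) := by
  have hK : IsCompact ((fun p : Rn n × Rn n => p.1 + s • p.2) '' (tsupport v ×ˢ tsupport ψ)) :=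
    (hvc.prod hψc).image (by fun_prop)
  refine HasCompactSupport.intro hK fun x hx => av_eq_zero_of_notMem fun z hz hxz => hx ?_
  exact ⟨(x - s • z, z), ⟨hxz, hz⟩, by simp⟩

/-- Differentiating the kernel or the function. -/
theorem smul_av_pd {ψ : Rn n → ℝ} (hψ : ContDiff ℝ 1 ψ) (hψc : HasCompactSupport ψ)
    {v : Rn n → F} (hv : ContDiff ℝ 1 v) (s : ℝ) (i : Fin n) (x : Rn n) :
    s • av ψ s (pd i v) x = av (pd i ψ) s v x := by
  have h1 : ContDiff ℝ 1 (fun z : Rn n => v (x - s • z)) := hv.comp (by fun_prop)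
  have h2 : ∀ z, pd i (fun z : Rn n => v (x - s • z)) z = -(s • pd i v (x - s • z)) := by
    intro z
    have h3 : HasFDerivAt v (fderiv ℝ v (x - s • z)) (x - s • z) :=
      (hv.differentiable (by simp)).differentiableAt.hasFDerivAt
    have h4 := h3.comp z (((hasFDerivAt_id z).const_smul s).const_sub x)
    have h5 : fderiv ℝ (fun z : Rn n => v (x - s • z)) z = _ := h4.fderiv
    simp [pd, h5]
  have h6 := integral_smul_pd_left hψ hψc h1 i
  simp only [h2, smul_neg, integral_neg, neg_inj] at h6
  rw [av, av, ← h6, ← integral_smul]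
  simp only [smul_comm s]

/-- Duality for averages. -/
theorem integral_smul_av [CompleteSpace F] {ψ f : Rn n → ℝ} (hψ : Continuous ψ) (hψc : HasCompactSupport ψ)
    (hf : Continuous f) (hfc : HasCompactSupport f) {v : Rn n → F} (hv : LocallyIntegrable v)
    (s : ℝ) :
    ∫ x, f x • av ψ s v x = ∫ y, av (fun z => ψ (-z)) s f y • v y := by
  have hK : IsCompact ((fun p : Rn n × Rn n => p.1 - s • p.2) '' (tsupport f ×ˢ tsupport ψ)) :=
    (hfc.prod hψc).image (by fun_prop)
  set K := (fun p : Rn n × Rn n => p.1 - s • p.2) '' (tsupport f ×ˢ tsupport ψ) with hKdef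
  obtain ⟨C, hC⟩ := hf.bounded_above_of_compact_support hfc
  have hInt : Integrable (fun p : Rn n × Rn n => (ψ p.1 * f (p.2 + s • p.1)) • v p.2)
      (volume.prod volume) := by
    -- The factor `ψ z * f (y + s • z)` vanishes unless `y` lies in the compact set `K`, so only the
    -- integrable restriction of `v` to `K` matters.
    have hvK : Integrable (K.indicator v) :=
      (hv.integrableOn_isCompact hK).integrable_indicator hK.measurableSet
    have hψi : Integrable ψ := hψ.integrable_of_hasCompactSupport hψc
    have h1 : Integrable (fun p : Rn n × Rn n => ψ p.1 • K.indicator v p.2)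
      (volume.prod volume) := hψi.smul_prod hvK
    have h2 : (fun p : Rn n × Rn n => (ψ p.1 * f (p.2 + s • p.1)) • v p.2) =
        fun p => f (p.2 + s • p.1) • (ψ p.1 • K.indicator v p.2) := by
      funext p
      by_cases hp : p.2 ∈ K
      · rw [Set.indicator_of_mem hp, smul_smul, mul_comm]
      · rw [Set.indicator_of_notMem hp, smul_zero, smul_zero]
        by_cases h3 : p.1 ∈ tsupport ψ
        · by_cases h4 : p.2 + s • p.1 ∈ tsupport f
          · exact absurd ⟨(p.2 + s • p.1, p.1), ⟨h4, h3⟩, by simp⟩ hp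
          · rw [image_eq_zero_of_notMem_tsupport h4]; simp
        · rw [image_eq_zero_of_notMem_tsupport h3]; simp
    rw [h2]
    refine h1.bdd_smul C (by fun_prop) (Eventually.of_forall fun p => hC _)
  -- The shear `(z, x) ↦ (z, x - s • z)` carries integrability over to the integrand written in the
  -- variable `x`.
  have hshear : MeasurePreserving (fun p : Rn n × Rn n => (p.1, p.2 - s • p.1))
      (volume.prod volume) (volume.prod volume) :=
    (MeasurePreserving.id volume).skew_product (g := fun z x => x - s • z) (by fun_prop)
      (Eventually.of_forall fun z => map_sub_right_eq_self volume (s • z))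
  have hint2 : Integrable (fun p : Rn n × Rn n => f p.2 • (ψ p.1 • v (p.2 - s • p.1)))
      (volume.prod volume) := by
    have := hshear.integrable_comp_of_integrable hInt
    refine this.congr (Eventually.of_forall fun p => ?_)
    simp [smul_smul, mul_comm]
  calc ∫ x, f x • av ψ s v x = ∫ x, ∫ z, f x • (ψ z • v (x - s • z)) := by
        simp only [av, integral_smul]
    _ = ∫ z, ∫ x, f x • (ψ z • v (x - s • z)) := (integral_integral_swap hint2).symm
    _ = ∫ z, ∫ y, (ψ z * f (y + s • z)) • v y := by
        refine integral_congr_ae (Eventually.of_forall fun z => ?_)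
        simp only
        rw [← integral_sub_right_eq_self (fun y => (ψ z * f (y + s • z)) • v y) (s • z)]
        simp [smul_smul, mul_comm]
    _ = ∫ y, ∫ z, (ψ z * f (y + s • z)) • v y := integral_integral_swap hInt
    _ = ∫ y, av (fun z => ψ (-z)) s f y • v y := by
        refine integral_congr_ae (Eventually.of_forall fun y => ?_)
        simp only [av]
        rw [integral_smul_const, ← integral_neg_eq_self]
        simp [sub_eq_add_neg]

end Calculus

end FormSubordination

end

noncomputable section

namespace FormSubordination

open Metric Filter Topology
open scoped ENNReal

variable {n : ℕ}

/-! ### A trace inequality for densities of Morrey type -/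

theorem lintegral_comp_sub_smul (H : Rn n → ℝ≥0∞) (hH : Measurable H) (y : Rn n) {t : ℝ}
    (ht : 0 < t) :
    ∫⁻ z, H (y - t • z) = ENNReal.ofReal (t ^ n)⁻¹ * ∫⁻ w, H w := by
  have h1 : ∫⁻ z, H (y - t • z) = ∫⁻ w, H (y - w) ∂(Measure.map (fun z : Rn n => t • z) volume) := by
    rw [lintegral_map (by fun_prop) (by fun_prop)]
  rw [h1, Measure.map_addHaar_smul volume ht.ne', lintegral_smul_measure,
    lintegral_sub_left_eq_self, smul_eq_mul, finrank_euclideanSpace, Fintype.card_fin,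
    abs_of_pos (by positivity)]

theorem setLIntegral_unitBall_comp_sub_smul (W : Rn n → ℝ≥0∞) (hW : Measurable W) (y : Rn n)
    {t : ℝ} (ht : 0 < t) :
    ∫⁻ z in ball (0 : Rn n) 1, W (y - t • z) =
      ENNReal.ofReal (t ^ n)⁻¹ * ∫⁻ w in ball y t, W w := by
  rw [← lintegral_indicator measurableSet_ball, ← lintegral_indicator measurableSet_ball,
    ← lintegral_comp_sub_smul _ (hW.indicator measurableSet_ball) y ht]
  refine lintegral_congr fun z => ?_
  have : y - t • z ∈ ball y t ↔ z ∈ ball (0 : Rn n) 1 := by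
    rw [mem_ball, mem_ball, dist_zero_right, dist_eq_norm, sub_right_comm, sub_self, zero_sub, norm_neg, norm_smul, Real.norm_of_nonneg ht.le]
    constructor <;> intro h <;> nlinarith
  by_cases hz : z ∈ ball (0 : Rn n) 1
  · rw [Set.indicator_of_mem hz, Set.indicator_of_mem (this.2 hz)]
  · rw [Set.indicator_of_notMem hz, Set.indicator_of_notMem (mt this.1 hz)]

/-- By Tonelli the average over directions can be moved from `f` to `W`, where it becomes `t⁻ⁿ`
times the mass of `W` in a ball of radius `t`. -/
theorem lintegral_mul_average_le {W : Rn n → ℝ≥0∞} (hW : Measurable W) {A : ℝ≥0∞} {t : ℝ}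
    (ht : 0 < t) (hA : ∀ x, ∫⁻ y in ball x t, W y ≤ A) {f : Rn n → ℝ≥0∞} (hf : Measurable f) :
    ∫⁻ x, ∫⁻ z in ball (0 : Rn n) 1, W x * f (x + t • z) ≤
      ENNReal.ofReal (t ^ n)⁻¹ * A * ∫⁻ y, f y := by
  rw [lintegral_lintegral_swap (by fun_prop)]
  have h1 : ∀ z, ∫⁻ x, W x * f (x + t • z) = ∫⁻ y, W (y - t • z) * f y := fun z => by
    rw [← lintegral_sub_right_eq_self (fun x => W x * f (x + t • z)) (t • z)]
    simp
  simp only [h1]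
  rw [lintegral_lintegral_swap (by fun_prop)]
  calc ∫⁻ y, ∫⁻ z in ball (0 : Rn n) 1, W (y - t • z) * f y
      = ∫⁻ y, (ENNReal.ofReal (t ^ n)⁻¹ * ∫⁻ w in ball y t, W w) * f y := by
        refine lintegral_congr fun y => ?_
        rw [lintegral_mul_const _ (by fun_prop), setLIntegral_unitBall_comp_sub_smul W hW y ht]
    _ ≤ ∫⁻ y, (ENNReal.ofReal (t ^ n)⁻¹ * A) * f y := by gcongr with y; exact hA y
    _ = _ := lintegral_const_mul _ hf

/-- The fundamental theorem of calculus along the segment from `x` to `x + r • z`. Averaging over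
`z` in the unit ball will replace potential-theoretic kernels. -/
theorem enorm_le_add_lintegral_fderiv {u : Rn n → ℂ} (hu : ContDiff ℝ 1 u) (x z : Rn n)
    (hz : ‖z‖ ≤ 1) {r : ℝ} (hr : 0 < r) :
    ‖u x‖ₑ ≤ ‖u (x + r • z)‖ₑ + ∫⁻ t in Set.Ioc 0 r, ‖fderiv ℝ u (x + t • z)‖ₑ := by
  have hd : ∀ t : ℝ, HasDerivAt (fun t : ℝ => u (x + t • z)) (fderiv ℝ u (x + t • z) z) t := by
    intro t
    have h1 : HasFDerivAt u (fderiv ℝ u (x + t • z)) (x + t • z) :=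
      (hu.differentiable (by simp)).differentiableAt.hasFDerivAt
    have h2 : HasDerivAt (fun t : ℝ => x + t • z) z t := by
      simpa using ((hasDerivAt_id t).smul_const z).const_add x
    exact h1.comp_hasDerivAt t h2
  have hcont : Continuous fun t : ℝ => fderiv ℝ u (x + t • z) z :=
    ((hu.continuous_fderiv (by simp)).comp (by fun_prop)).clm_apply continuous_const
  have hF := intervalIntegral.integral_eq_sub_of_hasDerivAt (fun t _ => hd t)
    (hcont.intervalIntegrable 0 r)
  simp only [zero_smul, add_zero] at hF
  have h3 : u x = u (x + r • z) - ∫ t in (0 : ℝ)..r, fderiv ℝ u (x + t • z) z := by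
    rw [hF]; abel
  rw [h3]
  refine enorm_sub_le.trans ?_
  gcongr
  rw [intervalIntegral.integral_of_le hr.le]
  refine (enorm_integral_le_lintegral_enorm _).trans ?_
  gcongr with t
  calc ‖fderiv ℝ u (x + t • z) z‖ₑ ≤ ‖fderiv ℝ u (x + t • z)‖ₑ * ‖z‖ₑ :=
        ContinuousLinearMap.le_opENorm _ _
    _ ≤ ‖fderiv ℝ u (x + t • z)‖ₑ * 1 := by
        gcongr
        rw [← ofReal_norm]
        exact ENNReal.ofReal_le_one.2 hz
    _ = _ := mul_one _

theorem lintegral_Ioc_rpow {p r : ℝ} (hp : -1 < p) (hr : 0 < r) :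
    ∫⁻ t in Set.Ioc 0 r, ENNReal.ofReal (t ^ p) = ENNReal.ofReal (r ^ (p + 1) / (p + 1)) := by
  rw [← ofReal_integral_eq_lintegral_ofReal, ← intervalIntegral.integral_of_le hr.le,
    integral_rpow (Or.inl hp), Real.zero_rpow (by linarith), sub_zero]
  · exact (intervalIntegral.intervalIntegrable_rpow' hp).1
  · filter_upwards [ae_restrict_mem measurableSet_Ioc] with t ht
    exact Real.rpow_nonneg ht.1.le _

/-- Cauchy–Schwarz after inserting the weight `t ^ ((s - 1) / 2)`, whose square has integral `r ^ s
/ s`. The free exponent `s` leaves room to absorb a singular power of `t` later. -/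
theorem sq_lintegral_Ioc_le {g : ℝ → ℝ≥0∞} (hg : Measurable g) {s r : ℝ} (hs : 0 < s)
    (hr : 0 < r) :
    (∫⁻ t in Set.Ioc 0 r, g t) ^ 2 ≤
      ENNReal.ofReal (r ^ s / s) * ∫⁻ t in Set.Ioc 0 r, ENNReal.ofReal (t ^ (1 - s)) * g t ^ 2 := by
  have h1 : ∫⁻ t in Set.Ioc 0 r, g t = ∫⁻ t in Set.Ioc 0 r,
      ((fun t => ENNReal.ofReal (t ^ ((s - 1) / 2))) *
        fun t => ENNReal.ofReal (t ^ ((1 - s) / 2)) * g t) t := by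
    refine setLIntegral_congr_fun measurableSet_Ioc fun t ht => ?_
    simp only [Pi.mul_apply]
    rw [← mul_assoc, ← ENNReal.ofReal_mul (Real.rpow_nonneg ht.1.le _), ← Real.rpow_add ht.1]
    have : (s - 1) / 2 + (1 - s) / 2 = 0 := by ring
    rw [this, Real.rpow_zero, ENNReal.ofReal_one, one_mul]
  have h2 := ENNReal.lintegral_mul_le_Lp_mul_Lq (volume.restrict (Set.Ioc 0 r))
    Real.HolderConjugate.two_two
    (f := fun t => ENNReal.ofReal (t ^ ((s - 1) / 2)))
    (g := fun t => ENNReal.ofReal (t ^ ((1 - s) / 2)) * g t)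
    (by fun_prop) (by fun_prop)
  rw [← h1] at h2
  have e1 : ∫⁻ t in Set.Ioc 0 r, ENNReal.ofReal (t ^ ((s - 1) / 2)) ^ (2 : ℝ) =
      ENNReal.ofReal (r ^ s / s) := by
    have := lintegral_Ioc_rpow (p := s - 1) (r := r) (by linarith) hr
    rw [sub_add_cancel] at this
    rw [← this]
    refine setLIntegral_congr_fun measurableSet_Ioc fun t ht => ?_
    rw [ENNReal.ofReal_rpow_of_nonneg (Real.rpow_nonneg ht.1.le _) (by norm_num),
      ← Real.rpow_mul ht.1.le]
    congr 2; ring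
  have e2 : ∫⁻ t in Set.Ioc 0 r, (ENNReal.ofReal (t ^ ((1 - s) / 2)) * g t) ^ (2 : ℝ) =
      ∫⁻ t in Set.Ioc 0 r, ENNReal.ofReal (t ^ (1 - s)) * g t ^ 2 := by
    refine setLIntegral_congr_fun measurableSet_Ioc fun t ht => ?_
    rw [ENNReal.mul_rpow_of_nonneg _ _ (by norm_num),
      ENNReal.ofReal_rpow_of_nonneg (Real.rpow_nonneg ht.1.le _) (by norm_num),
      ← Real.rpow_mul ht.1.le, ENNReal.rpow_ofNat]
    congr 3; ring
  rw [e1, e2] at h2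
  calc (∫⁻ t in Set.Ioc 0 r, g t) ^ 2 ≤ _ := pow_le_pow_left₀ (zero_le) h2 2
    _ = _ := by
      rw [mul_pow, ← ENNReal.rpow_natCast, ← ENNReal.rpow_natCast, ← ENNReal.rpow_mul,
        ← ENNReal.rpow_mul]
      norm_num

theorem ennreal_add_sq_le (a b : ℝ≥0∞) : (a + b) ^ 2 ≤ 2 * a ^ 2 + 2 * b ^ 2 := by
  have := ENNReal.rpow_add_le_mul_rpow_add_rpow a b (p := 2) (by norm_num)
  norm_num at this
  rwa [mul_add] at this

/-- Square the segment estimate, multiply by `W x`, and average over all directions `z`. At each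
scale `t` the average costs a factor `A t ^ (-μ)`, and the remaining radial integral converges
because `μ < 2`. -/
theorem lintegral_mul_enorm_sq_le {W : Rn n → ℝ≥0∞} (hW : Measurable W) {μ A r : ℝ}
    (hμ : μ < 2) (hA0 : 0 ≤ A) (hr : 0 < r)
    (hA : ∀ x t, 0 < t → t ≤ r → ∫⁻ y in ball x t, W y ≤ ENNReal.ofReal (A * t ^ ((n : ℝ) - μ)))
    {u : Rn n → ℂ} (hu : ContDiff ℝ 1 u) :
    ENNReal.ofReal (unitVol n) * ∫⁻ x, W x * ‖u x‖ₑ ^ 2 ≤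
      ENNReal.ofReal (2 * A * r ^ (-μ)) * (∫⁻ x, ‖u x‖ₑ ^ 2) +
      ENNReal.ofReal (8 * A * (2 - μ)⁻¹ ^ 2 * r ^ (2 - μ)) * ∫⁻ x, ‖fderiv ℝ u x‖ₑ ^ 2 := by
  -- With this choice `1 - s - μ = s - 1`, so both radial integrals equal `r ^ s / s` and their
  -- product is of order `r ^ (2 - μ)`.
  set s := (2 - μ) / 2 with hs
  have hs0 : 0 < s := by rw [hs]; linarith
  have hucont := hu.continuous
  have hDcont : Continuous (fderiv ℝ u) := hu.continuous_fderiv (by simp)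
  set U : Rn n → ℝ≥0∞ := fun x => ‖u x‖ₑ ^ 2 with hU
  set G : Rn n → ℝ≥0∞ := fun x => ‖fderiv ℝ u x‖ₑ ^ 2 with hG
  have hUm : Measurable U := by fun_prop
  have hGm : Measurable G := by fun_prop
  have hscale : ∀ t, 0 < t → t ≤ r → ∀ f : Rn n → ℝ≥0∞, Measurable f →
      ∫⁻ x, ∫⁻ z in ball (0 : Rn n) 1, W x * f (x + t • z) ≤
        ENNReal.ofReal (A * t ^ (-μ)) * ∫⁻ y, f y := by
    intro t ht htr f hf
    refine (lintegral_mul_average_le hW ht (fun x => hA x t ht htr) hf).trans (le_of_eq ?_)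
    rw [← ENNReal.ofReal_mul (by positivity)]
    congr 2
    rw [sub_eq_add_neg, Real.rpow_add ht, Real.rpow_natCast]
    field_simp
  have hpt : ∀ x, ∀ z ∈ ball (0 : Rn n) 1, W x * U x ≤
      2 * (W x * U (x + r • z)) + 2 * (ENNReal.ofReal (r ^ s / s) *
        ∫⁻ t in Set.Ioc 0 r, ENNReal.ofReal (t ^ (1 - s)) * (W x * G (x + t • z))) := by
    intro x z hz
    have h1 := enorm_le_add_lintegral_fderiv hu x z (by simpa using (mem_ball.1 hz).le) hr
    have h2 : U x ≤ 2 * U (x + r • z) + 2 * (ENNReal.ofReal (r ^ s / s) *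
        ∫⁻ t in Set.Ioc 0 r, ENNReal.ofReal (t ^ (1 - s)) * G (x + t • z)) := by
      refine (pow_le_pow_left₀ zero_le h1 2).trans ((ennreal_add_sq_le _ _).trans ?_)
      gcongr
      exact sq_lintegral_Ioc_le (g := fun t => ‖fderiv ℝ u (x + t • z)‖ₑ) (by fun_prop) hs0 hr
    refine (mul_le_mul_right h2 (W x)).trans (le_of_eq ?_)
    have h3 : ∫⁻ t in Set.Ioc 0 r, ENNReal.ofReal (t ^ (1 - s)) * (W x * G (x + t • z)) =
        W x * ∫⁻ t in Set.Ioc 0 r, ENNReal.ofReal (t ^ (1 - s)) * G (x + t • z) := by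
      rw [← lintegral_const_mul _ (by fun_prop)]
      refine lintegral_congr fun t => ?_
      ring
    rw [h3]
    ring
  have hvol : ∀ a : ℝ≥0∞, ∫⁻ _ in ball (0 : Rn n) 1, a = a * ENNReal.ofReal (unitVol n) := by
    intro a
    rw [setLIntegral_const, unitVol, ofReal_measureReal measure_ball_lt_top.ne]
  calc ENNReal.ofReal (unitVol n) * ∫⁻ x, W x * U x
      = ∫⁻ x, ∫⁻ z in ball (0 : Rn n) 1, W x * U x := by
        simp only [hvol]
        rw [lintegral_mul_const _ (by fun_prop), mul_comm]
    _ ≤ ∫⁻ x, ∫⁻ z in ball (0 : Rn n) 1, (2 * (W x * U (x + r • z)) +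
          2 * (ENNReal.ofReal (r ^ s / s) *
            ∫⁻ t in Set.Ioc 0 r, ENNReal.ofReal (t ^ (1 - s)) * (W x * G (x + t • z)))) := by
        refine lintegral_mono fun x => setLIntegral_mono' measurableSet_ball fun z hz => hpt x z hz
    _ = 2 * (∫⁻ x, ∫⁻ z in ball (0 : Rn n) 1, W x * U (x + r • z)) +
          2 * (ENNReal.ofReal (r ^ s / s) * ∫⁻ t in Set.Ioc 0 r, ENNReal.ofReal (t ^ (1 - s)) *
            ∫⁻ x, ∫⁻ z in ball (0 : Rn n) 1, (W x * G (x + t • z))) := by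
        have m1 : Measurable fun p : Rn n × Rn n => W p.1 * U (p.1 + r • p.2) := by fun_prop
        have m2 : Measurable fun p : (Rn n × Rn n) × ℝ =>
            ENNReal.ofReal (p.2 ^ (1 - s)) * (W p.1.1 * G (p.1.1 + p.2 • p.1.2)) := by fun_prop
        have m3 : Measurable fun p : Rn n × Rn n => ∫⁻ t in Set.Ioc 0 r,
            ENNReal.ofReal (t ^ (1 - s)) * (W p.1 * G (p.1 + t • p.2)) :=
          m2.lintegral_prod_right'
        have e1 : ∀ x, ∫⁻ z in ball (0 : Rn n) 1, (2 * (W x * U (x + r • z)) +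
          2 * (ENNReal.ofReal (r ^ s / s) *
            ∫⁻ t in Set.Ioc 0 r, ENNReal.ofReal (t ^ (1 - s)) * (W x * G (x + t • z)))) =
            2 * (∫⁻ z in ball (0 : Rn n) 1, W x * U (x + r • z)) +
            2 * (ENNReal.ofReal (r ^ s / s) * ∫⁻ z in ball (0 : Rn n) 1,
            ∫⁻ t in Set.Ioc 0 r, ENNReal.ofReal (t ^ (1 - s)) * (W x * G (x + t • z))) := by
          intro x
          have m4 : Measurable fun z : Rn n => ∫⁻ t in Set.Ioc 0 r,
            ENNReal.ofReal (t ^ (1 - s)) * (W x * G (x + t • z)) := m3.comp measurable_prodMk_left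
          rw [lintegral_add_left (by fun_prop), lintegral_const_mul 2 (by fun_prop),
            lintegral_const_mul 2 (m4.const_mul _), lintegral_const_mul _ m4]
        simp only [e1]
        have m5 : Measurable fun x : Rn n => ∫⁻ z in ball (0 : Rn n) 1, W x * U (x + r • z) :=
          m1.lintegral_prod_right'
        have m6 : Measurable fun x : Rn n => ∫⁻ z in ball (0 : Rn n) 1, ∫⁻ t in Set.Ioc 0 r,
            ENNReal.ofReal (t ^ (1 - s)) * (W x * G (x + t • z)) := m3.lintegral_prod_right'
        rw [lintegral_add_left (by fun_prop), lintegral_const_mul 2 m5,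
          lintegral_const_mul 2 (m6.const_mul _), lintegral_const_mul _ m6]
        congr 3
        have e2 : ∀ x, ∫⁻ z in ball (0 : Rn n) 1, ∫⁻ t in Set.Ioc 0 r,
            ENNReal.ofReal (t ^ (1 - s)) * (W x * G (x + t • z)) = ∫⁻ t in Set.Ioc 0 r,
            ENNReal.ofReal (t ^ (1 - s)) * ∫⁻ z in ball (0 : Rn n) 1, (W x * G (x + t • z)) := by
          intro x
          rw [lintegral_lintegral_swap (f := fun z t => ENNReal.ofReal (t ^ (1 - s)) *
            (W x * G (x + t • z))) (by fun_prop)]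
          refine lintegral_congr fun t => lintegral_const_mul _ (by fun_prop)
        simp only [e2]
        have m7 : Measurable fun p : Rn n × ℝ => ∫⁻ z in ball (0 : Rn n) 1,
            (W p.1 * G (p.1 + p.2 • z)) := by
          refine Measurable.lintegral_prod_right' (f := fun q : (Rn n × ℝ) × Rn n =>
            W q.1.1 * G (q.1.1 + q.1.2 • q.2)) (by fun_prop)
        rw [lintegral_lintegral_swap (by fun_prop)]
        refine lintegral_congr fun t => lintegral_const_mul _ (m7.comp measurable_prodMk_right)
    _ ≤ 2 * (ENNReal.ofReal (A * r ^ (-μ)) * ∫⁻ y, U y) +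
          2 * (ENNReal.ofReal (r ^ s / s) * ∫⁻ t in Set.Ioc 0 r, ENNReal.ofReal (t ^ (1 - s)) *
            (ENNReal.ofReal (A * t ^ (-μ)) * ∫⁻ y, G y)) := by
        gcongr 2 * ?_ + 2 * (_ * ?_)
        · exact hscale r hr le_rfl U hUm
        · refine setLIntegral_mono' measurableSet_Ioc fun t ht => ?_
          gcongr
          exact hscale t ht.1 ht.2 G hGm
    _ = _ := by
        have e3 : ∫⁻ t in Set.Ioc 0 r, ENNReal.ofReal (t ^ (1 - s)) *
            (ENNReal.ofReal (A * t ^ (-μ)) * ∫⁻ y, G y) =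
            ENNReal.ofReal A * ENNReal.ofReal (r ^ (1 - s - μ + 1) / (1 - s - μ + 1)) * ∫⁻ y, G y := by
          generalize ∫⁻ y, G y = J
          rw [← lintegral_Ioc_rpow (by rw [hs]; linarith) hr, ← lintegral_const_mul _ (by fun_prop),
            ← lintegral_mul_const _ (by fun_prop)]
          refine setLIntegral_congr_fun measurableSet_Ioc fun t ht => ?_
          rw [sub_eq_add_neg (1 - s) μ, Real.rpow_add ht.1, ENNReal.ofReal_mul hA0,
            ENNReal.ofReal_mul (Real.rpow_nonneg ht.1.le _)]
          ring
        rw [e3]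
        have e4 : 1 - s - μ + 1 = s := by rw [hs]; ring
        rw [e4]
        have e5 : r ^ (2 - μ) = r ^ s * r ^ s := by
          rw [← Real.rpow_add hr]; congr 1; rw [hs]; ring
        have e6 : (8 * A * (2 - μ)⁻¹ ^ 2 * r ^ (2 - μ)) = 2 * ((r ^ s / s) * (A * (r ^ s / s))) := by
          rw [e5, hs]
          have : 2 - μ ≠ 0 := by linarith
          field_simp
          ring
        have p1 : 0 ≤ r ^ s / s := by positivity
        have q1 : ENNReal.ofReal (A * r ^ (-μ)) = ENNReal.ofReal A * ENNReal.ofReal (r ^ (-μ)) :=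
          ENNReal.ofReal_mul hA0
        have q2 : ENNReal.ofReal (2 * A * r ^ (-μ)) =
            2 * (ENNReal.ofReal A * ENNReal.ofReal (r ^ (-μ))) := by
          rw [← q1, mul_assoc, ENNReal.ofReal_mul (by norm_num), ENNReal.ofReal_ofNat]
        have q3 : ENNReal.ofReal (2 * ((r ^ s / s) * (A * (r ^ s / s)))) =
            2 * (ENNReal.ofReal (r ^ s / s) * (ENNReal.ofReal A * ENNReal.ofReal (r ^ s / s))) := by
          rw [← ENNReal.ofReal_mul hA0, ← ENNReal.ofReal_mul p1,
            ENNReal.ofReal_mul (by norm_num), ENNReal.ofReal_ofNat]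
        rw [e6, q1, q2, q3]
        ring

theorem norm_fderiv_sq_le (u : Rn n → ℂ) (x : Rn n) :
    ‖fderiv ℝ u x‖ ^ 2 ≤ ∑ i : Fin n, ‖fderiv ℝ u x (basisVec i)‖ ^ 2 := by
  have h : ‖fderiv ℝ u x‖ ≤ √(∑ i : Fin n, ‖fderiv ℝ u x (basisVec i)‖ ^ 2) := by
    refine ContinuousLinearMap.opNorm_le_bound _ (Real.sqrt_nonneg _) fun v => ?_
    have hv : v = ∑ i : Fin n, v i • (basisVec i : Rn n) := by
      have := (EuclideanSpace.basisFun (Fin n) ℝ).sum_repr v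
      simpa [basisVec] using this.symm
    calc ‖fderiv ℝ u x v‖ = ‖∑ i : Fin n, v i • fderiv ℝ u x (basisVec i)‖ := by
          conv_lhs => rw [hv]
          simp [map_sum]
      _ ≤ ∑ i : Fin n, ‖fderiv ℝ u x (basisVec i)‖ * ‖v i‖ := by
          refine (norm_sum_le _ _).trans (Finset.sum_le_sum fun i _ => ?_)
          rw [norm_smul, mul_comm]
      _ ≤ √(∑ i : Fin n, ‖fderiv ℝ u x (basisVec i)‖ ^ 2) * √(∑ i : Fin n, ‖v i‖ ^ 2) :=
          Real.sum_mul_le_sqrt_mul_sqrt _ _ _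
      _ = _ := by rw [EuclideanSpace.norm_eq v]
  calc ‖fderiv ℝ u x‖ ^ 2 ≤ _ := pow_le_pow_left₀ (norm_nonneg _) h 2
    _ = _ := Real.sq_sqrt (by positivity)

theorem hasCompactSupport_norm_sq {E : Type*} [NormedAddCommGroup E] {f : Rn n → E}
    (hf : HasCompactSupport f) : HasCompactSupport fun x => ‖f x‖ ^ 2 :=
  hf.mono fun x hx => by
    rw [Function.mem_support] at hx ⊢
    exact fun h => hx (by rw [h]; simp)

theorem lintegral_enorm_sq_eq {E : Type*} [NormedAddCommGroup E] {f : Rn n → E}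
    (hf : Continuous f) (hfc : HasCompactSupport f) :
    ∫⁻ x, ‖f x‖ₑ ^ 2 = ENNReal.ofReal (∫ x, ‖f x‖ ^ 2) := by
  rw [ofReal_integral_eq_lintegral_ofReal]
  · refine lintegral_congr fun x => ?_
    rw [ENNReal.ofReal_pow (norm_nonneg _), ofReal_norm]
  · exact (hf.norm.pow 2).integrable_of_hasCompactSupport
      (hasCompactSupport_norm_sq hfc)
  · exact Eventually.of_forall fun _ => by positivity

/-- Trace inequality: a density with `∫_{B_t(x)} V ≤ A t^{n-μ}`, `t ≤ r`, `μ < 2`, is form bounded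
with constants of the order `A r^{2-μ}` and `A r^{-μ}`. -/
theorem exists_integral_mul_norm_sq_le (n : ℕ) {μ : ℝ} (hμ : μ < 2) :
    ∃ C > 0, ∀ (V : Rn n → ℝ), LocallyIntegrable V → (∀ x, 0 ≤ V x) → ∀ A r : ℝ, 0 ≤ A → 0 < r →
      (∀ x t, 0 < t → t ≤ r → ∫ y in ball x t, V y ≤ A * t ^ ((n : ℝ) - μ)) →
      ∀ u : Test n, ∫ x, V x * ‖u x‖ ^ 2 ≤
        C * A * (r ^ (2 - μ) * gradNormSq u + r ^ (-μ) * normSqL2 u) := by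
  have hω := unitVol_pos n
  have h2μ : 0 < 2 - μ := by linarith
  refine ⟨(unitVol n)⁻¹ * (8 * (2 - μ)⁻¹ ^ 2 + 2), by positivity, ?_⟩
  intro V hV hV0 A r hA0 hr hA u
  have hu1 : ContDiff ℝ 1 u := u.contDiff.of_le (by simp)
  have huc := u.hasCompactSupport
  have hDcont : Continuous (fderiv ℝ u) := hu1.continuous_fderiv (by simp)
  have hDc : HasCompactSupport (fderiv ℝ u) := huc.fderiv (𝕜 := ℝ)
  -- Tonelli is applied to a Borel representative of the density.
  set V' := hV.aestronglyMeasurable.mk V with hV'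
  have hae : V =ᵐ[volume] V' := hV.aestronglyMeasurable.ae_eq_mk
  have hV'm : Measurable V' := hV.aestronglyMeasurable.stronglyMeasurable_mk.measurable
  have hWA : ∀ x t, 0 < t → t ≤ r →
      ∫⁻ y in ball x t, ENNReal.ofReal (V' y) ≤ ENNReal.ofReal (A * t ^ ((n : ℝ) - μ)) := by
    intro x t ht htr
    refine le_trans (le_of_eq ?_) (ENNReal.ofReal_le_ofReal (hA x t ht htr))
    rw [ofReal_integral_eq_lintegral_ofReal]
    · exact lintegral_congr_ae (ae_restrict_of_ae (hae.mono fun y hy => by simp only [hy]))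
    · exact (hV.integrableOn_isCompact (isCompact_closedBall x t)).mono_set ball_subset_closedBall
    · exact Eventually.of_forall fun _ => hV0 _
  have key := lintegral_mul_enorm_sq_le hV'm.ennreal_ofReal hμ hA0 hr hWA hu1
  have hInt : Integrable fun x => V x * ‖u x‖ ^ 2 := by
    have : Integrable fun x => (‖u x‖ ^ 2) • V x :=
      hV.integrable_smul_left_of_hasCompactSupport (u.continuous.norm.pow 2)
        (hasCompactSupport_norm_sq huc)
    simpa only [smul_eq_mul, mul_comm] using this
  have e1 : ∫⁻ x, ENNReal.ofReal (V' x) * ‖u x‖ₑ ^ 2 =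
      ENNReal.ofReal (∫ x, V x * ‖u x‖ ^ 2) := by
    rw [ofReal_integral_eq_lintegral_ofReal hInt
      (Eventually.of_forall fun x => mul_nonneg (hV0 x) (by positivity))]
    refine lintegral_congr_ae (hae.mono fun x hx => ?_)
    simp only
    rw [ENNReal.ofReal_mul (hV0 x), ENNReal.ofReal_pow (norm_nonneg _), ofReal_norm, hx]
  rw [e1, lintegral_enorm_sq_eq u.continuous huc, lintegral_enorm_sq_eq hDcont hDc,
    ← ENNReal.ofReal_mul hω.le, ← ENNReal.ofReal_mul (by positivity),
    ← ENNReal.ofReal_mul (by positivity), ← ENNReal.ofReal_add] at key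
  rotate_left
  · exact mul_nonneg (by positivity) (integral_nonneg fun _ => by positivity)
  · exact mul_nonneg (by positivity) (integral_nonneg fun _ => by positivity)
  have hI0 : 0 ≤ normSqL2 u := integral_nonneg fun _ => by positivity
  have hD0 : 0 ≤ ∫ x, ‖fderiv ℝ u x‖ ^ 2 := integral_nonneg fun _ => by positivity
  rw [ENNReal.ofReal_le_ofReal_iff (by
    refine add_nonneg (mul_nonneg (by positivity) ?_) (mul_nonneg (by positivity) hD0)
    exact hI0)] at key
  have hG : ∫ x, ‖fderiv ℝ u x‖ ^ 2 ≤ gradNormSq u := by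
    refine integral_mono ?_ ?_ fun x => norm_fderiv_sq_le u x
    · exact (hDcont.norm.pow 2).integrable_of_hasCompactSupport
        (hasCompactSupport_norm_sq hDc)
    · refine integrable_finsetSum _ fun i _ => ?_
      exact ((continuous_pd hu1 i).norm.pow 2).integrable_of_hasCompactSupport
        (hasCompactSupport_norm_sq (hasCompactSupport_pd huc i))
  have hG0 : 0 ≤ gradNormSq u := hD0.trans hG
  have hn : ∫ x, ‖u x‖ ^ 2 = normSqL2 u := rfl
  rw [hn] at key
  have hrp : 0 < r ^ (2 - μ) := by positivity
  have hrm : 0 < r ^ (-μ) := by positivity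
  rw [mul_assoc (unitVol n)⁻¹, mul_assoc (unitVol n)⁻¹, ← div_eq_inv_mul, le_div_iff₀ hω,
    mul_comm]
  refine key.trans ?_
  have hμ2 : 0 ≤ (2 - μ)⁻¹ ^ 2 := by positivity
  calc 2 * A * r ^ (-μ) * normSqL2 u + 8 * A * (2 - μ)⁻¹ ^ 2 * r ^ (2 - μ) * ∫ x, ‖fderiv ℝ u x‖ ^ 2
      ≤ 2 * A * r ^ (-μ) * normSqL2 u + 8 * A * (2 - μ)⁻¹ ^ 2 * r ^ (2 - μ) * gradNormSq u := by
        gcongr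
    _ ≤ 2 * A * r ^ (-μ) * normSqL2 u + 8 * A * (2 - μ)⁻¹ ^ 2 * r ^ (2 - μ) * gradNormSq u +
        (8 * A * (2 - μ)⁻¹ ^ 2 * (r ^ (-μ) * normSqL2 u) + 2 * A * (r ^ (2 - μ) * gradNormSq u)) :=
        le_add_of_nonneg_right (by positivity)
    _ = _ := by ring

end FormSubordination

end

noncomputable section

namespace FormSubordination

open Metric Filter Topology
open scoped ENNReal Convolution

variable {n : ℕ}

/-! ### Mollification and sufficiency -/

section Mollifier

variable {F : Type*} [NormedAddCommGroup F] [NormedSpace ℝ F]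

/-- The dilation `s⁻ⁿ ψ(x / s)`. -/
def dil (s : ℝ) (ψ : Rn n → ℝ) : Rn n → ℝ := fun x => (s ^ n)⁻¹ * ψ (s⁻¹ • x)

theorem av_eq_integral_dil (ψ : Rn n → ℝ) {s : ℝ} (hs : 0 < s) (v : Rn n → F) (x : Rn n) :
    av ψ s v x = ∫ t, dil s ψ t • v (x - t) := by
  have h := Measure.integral_comp_smul (volume : Measure (Rn n))
    (fun t => dil s ψ t • v (x - t)) s
  rw [finrank_euclideanSpace, Fintype.card_fin, abs_of_pos (by positivity)] at h
  have h2 : ∀ z : Rn n, dil s ψ (s • z) • v (x - s • z) = (s ^ n)⁻¹ • (ψ z • v (x - s • z)) := by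
    intro z
    rw [dil, smul_smul s⁻¹ s, inv_mul_cancel₀ hs.ne', one_smul, smul_smul]
  simp only [h2, integral_smul] at h
  exact smul_right_injective F (by positivity : (s ^ n)⁻¹ ≠ 0) h

theorem av_eq_integral_dil_sub (ψ : Rn n → ℝ) {s : ℝ} (hs : 0 < s) (v : Rn n → F) (x : Rn n) :
    av ψ s v x = ∫ w, dil s ψ (x - w) • v w := by
  rw [av_eq_integral_dil ψ hs, ← integral_sub_left_eq_self _ volume x]
  simp

theorem continuous_dil {ψ : Rn n → ℝ} (hψ : Continuous ψ) (s : ℝ) : Continuous (dil s ψ) := by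
  unfold dil; fun_prop

theorem hasCompactSupport_dil {ψ : Rn n → ℝ} (hψ : HasCompactSupport ψ) {s : ℝ} (hs : 0 < s) :
    HasCompactSupport (dil s ψ) := by
  have : HasCompactSupport fun x : Rn n => ψ (s⁻¹ • x) :=
    hψ.comp_homeomorph (Homeomorph.smulOfNeZero s⁻¹ (inv_ne_zero hs.ne'))
  exact this.mul_left

theorem continuous_av_of_locallyIntegrable {ψ : Rn n → ℝ} (hψ : Continuous ψ)
    (hψc : HasCompactSupport ψ) {v : Rn n → F} (hv : LocallyIntegrable v) {s : ℝ} (hs : 0 < s) :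
    Continuous (av ψ s v) := by
  have h : av ψ s v = (dil s ψ ⋆[ContinuousLinearMap.lsmul ℝ ℝ, volume] v) := by
    funext x
    rw [av_eq_integral_dil ψ hs]
    rfl
  rw [h]
  exact (hasCompactSupport_dil hψc hs).continuous_convolution_left _ (continuous_dil hψ s) hv

/-- Expand the nonnegative integral of `(g - mean) ^ 2`. -/
theorem sq_setIntegral_le {g : Rn n → ℝ} {x : Rn n} {r : ℝ} (hr : 0 < r)
    (hg : IntegrableOn g (ball x r)) (hg2 : IntegrableOn (fun y => g y ^ 2) (ball x r)) :
    (∫ y in ball x r, g y) ^ 2 ≤ volume.real (ball x r) * ∫ y in ball x r, g y ^ 2 := by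
  have hv := volume_real_ball_pos x hr
  set v := volume.real (ball x r)
  set I := ∫ y in ball x r, g y
  have h0 : 0 ≤ ∫ y in ball x r, (g y - I / v) ^ 2 := integral_nonneg fun _ => by positivity
  have h1 : ∫ y in ball x r, (g y - I / v) ^ 2 =
      (∫ y in ball x r, g y ^ 2) - (2 * (I / v)) * I + v * (I / v) ^ 2 := by
    have e : ∀ y, (g y - I / v) ^ 2 = g y ^ 2 - (2 * (I / v)) * g y + (I / v) ^ 2 := fun y => by ring
    simp only [e]
    have hi : IntegrableOn (fun y => g y ^ 2 - (2 * (I / v)) * g y) (ball x r) :=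
      hg2.sub (hg.const_mul _)
    rw [integral_add hi (integrableOn_const measure_ball_lt_top.ne),
      integral_sub hg2 (hg.const_mul _), integral_const_mul, setIntegral_const, smul_eq_mul]
  rw [h1] at h0
  have h2 : v * ((∫ y in ball x r, g y ^ 2) - (2 * (I / v)) * I + v * (I / v) ^ 2) =
      v * (∫ y in ball x r, g y ^ 2) - I ^ 2 := by field_simp; ring
  nlinarith [mul_nonneg hv.le h0]

/-- The dilated kernel is bounded by `r⁻ⁿ M` and lives on the ball of radius `r`; Cauchy–Schwarz
does the rest. -/
theorem norm_av_sq_le {ψ : Rn n → ℝ} (hψs : tsupport ψ ⊆ ball 0 1) {M : ℝ} (hM : ∀ z, |ψ z| ≤ M)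
    {f : Rn n → F} {y : Rn n} {r : ℝ} (hr : 0 < r) (hf : IntegrableOn f (ball y r))
    (hf2 : IntegrableOn (fun w => ‖f w‖ ^ 2) (ball y r)) :
    ‖av ψ r f y‖ ^ 2 ≤ M ^ 2 * unitVol n * (r ^ n)⁻¹ * ∫ w in ball y r, ‖f w‖ ^ 2 := by
  have hM0 : 0 ≤ M := (abs_nonneg _).trans (hM 0)
  have h1 : ‖av ψ r f y‖ ≤ (r ^ n)⁻¹ * M * ∫ w in ball y r, ‖f w‖ := by
    rw [av_eq_integral_dil_sub ψ hr,
      ← setIntegral_eq_integral_of_forall_compl_eq_zero (s := ball y r), ← integral_const_mul]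
    · refine norm_integral_le_of_norm_le (hf.norm.const_mul _) (Eventually.of_forall fun w => ?_)
      rw [norm_smul]
      gcongr
      rw [dil, norm_mul, Real.norm_of_nonneg (by positivity)]
      gcongr
      exact hM _
    · intro w hw
      have : r⁻¹ • (y - w) ∉ tsupport ψ := by
        intro h
        have := hψs h
        rw [mem_ball, dist_zero_right, norm_smul, Real.norm_of_nonneg (by positivity),
          inv_mul_lt_iff₀ hr, mul_one] at this
        exact hw (by rwa [mem_ball, dist_comm, dist_eq_norm])
      rw [dil, image_eq_zero_of_notMem_tsupport this, mul_zero, zero_smul]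
  have h2 := sq_setIntegral_le hr hf.norm hf2
  rw [volume_real_ball y hr] at h2
  calc ‖av ψ r f y‖ ^ 2 ≤ ((r ^ n)⁻¹ * M * ∫ w in ball y r, ‖f w‖) ^ 2 :=
        pow_le_pow_left₀ (norm_nonneg _) h1 2
    _ = ((r ^ n)⁻¹ * M) ^ 2 * (∫ w in ball y r, ‖f w‖) ^ 2 := by ring
    _ ≤ ((r ^ n)⁻¹ * M) ^ 2 * (r ^ n * unitVol n * ∫ w in ball y r, ‖f w‖ ^ 2) := by gcongr
    _ = _ := by field_simp

theorem integrable_av_of_locallyIntegrable {ψ : Rn n → ℝ} (hψ : Continuous ψ)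
    (hψc : HasCompactSupport ψ) {v : Rn n → F} (hv : LocallyIntegrable v) {s : ℝ} (hs : 0 < s)
    (x : Rn n) : Integrable fun z => ψ z • v (x - s • z) := by
  have h1 : Integrable fun t => dil s ψ t • v (x - t) := by
    have h2 : Integrable fun w => dil s ψ (x - w) • v w := by
      refine hv.integrable_smul_left_of_hasCompactSupport
        ((continuous_dil hψ s).comp (by fun_prop)) ?_
      exact (hasCompactSupport_dil hψc hs).comp_homeomorph (Homeomorph.subLeft x)
    have h3 := h2.comp_sub_left x
    simpa using h3
  have h2 := (integrable_comp_smul_iff (volume : Measure (Rn n))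
    (fun t => dil s ψ t • v (x - t)) hs.ne').2 h1
  have h3 : ∀ z : Rn n, dil s ψ (s • z) • v (x - s • z) = (s ^ n)⁻¹ • (ψ z • v (x - s • z)) := by
    intro z
    rw [dil, smul_smul s⁻¹ s, inv_mul_cancel₀ hs.ne', one_smul, smul_smul]
  simp only [h3] at h2
  have h4 := h2.smul (s ^ n)
  refine h4.congr (Eventually.of_forall fun z => ?_)
  simp only [Pi.smul_apply]
  rw [smul_smul, mul_inv_cancel₀ (by positivity), one_smul]

theorem av_sub_const [CompleteSpace F] {ψ : Rn n → ℝ} (hψ : Continuous ψ) (hψc : HasCompactSupport ψ)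
    {v : Rn n → F} (hv : LocallyIntegrable v) {s : ℝ} (hs : 0 < s) (x : Rn n) (m : F) :
    av ψ s (fun y => v y - m) x = av ψ s v x - (∫ z, ψ z) • m := by
  simp only [av, smul_sub]
  rw [integral_sub (integrable_av_of_locallyIntegrable hψ hψc hv hs x)
    ((hψ.integrable_of_hasCompactSupport hψc).smul_const m), integral_smul_const]

theorem integral_pd_eq_zero {ψ : Rn n → ℝ} (hψ : ContDiff ℝ 1 ψ) (hψc : HasCompactSupport ψ)
    (i : Fin n) : ∫ z, pd i ψ z = 0 := by
  have h := integral_smul_pd_right (f := fun _ => (1 : ℝ)) contDiff_const hψc hψ i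
  have h2 : ∀ x, pd i (fun _ : Rn n => (1 : ℝ)) x = 0 := fun x => by simp [pd]
  simpa [h2] using h

/-- Here `v` is only locally integrable. Duality first puts the average on `φ`, where the derivative
can be exchanged for one on the kernel, and a second use of duality returns the average to `v`. The
sign comes from reflecting the kernel. -/
theorem integral_pd_smul_av [CompleteSpace F] {ψ φ : Rn n → ℝ} (hψ : ContDiff ℝ 1 ψ)
    (hψc : HasCompactSupport ψ) (hφ : ContDiff ℝ 1 φ) (hφc : HasCompactSupport φ)
    {v : Rn n → F} (hv : LocallyIntegrable v) {s : ℝ} (hs : s ≠ 0) (i : Fin n) :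
    ∫ x, pd i φ x • av ψ s v x = -(s⁻¹ • ∫ x, φ x • av (pd i ψ) s v x) := by
  rw [integral_smul_av hψ.continuous hψc (continuous_pd hφ i) (hasCompactSupport_pd hφc i) hv,
    integral_smul_av (continuous_pd hψ i) (hasCompactSupport_pd hψc i) hφ.continuous hφc hv,
    ← integral_smul, ← integral_neg]
  refine integral_congr_ae (Eventually.of_forall fun y => ?_)
  have hneg : ContDiff ℝ 1 fun z : Rn n => ψ (-z) := hψ.comp contDiff_neg
  have hnegc : HasCompactSupport fun z : Rn n => ψ (-z) :=
    hψc.comp_homeomorph (Homeomorph.neg (Rn n))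
  have h1 := smul_av_pd hneg hnegc hφ s i y
  have h2 : pd i (fun z : Rn n => ψ (-z)) = fun z => -(pd i ψ (-z)) := by
    funext z
    have h3 : HasFDerivAt ψ (fderiv ℝ ψ (-z)) (-z) :=
      (hψ.differentiable (by simp)).differentiableAt.hasFDerivAt
    have h5 : fderiv ℝ (fun z : Rn n => ψ (-z)) z = _ := (h3.comp z (hasFDerivAt_id z).neg).fderiv
    simp [pd, h5]
  rw [h2] at h1
  have h4 : av (fun z => -(pd i ψ (-z))) s φ y = -av (fun z => pd i ψ (-z)) s φ y := by
    simp only [av, neg_smul, integral_neg]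
  rw [h4] at h1
  simp only
  rw [smul_smul, ← neg_smul, ← mul_neg, ← h1, smul_eq_mul, inv_mul_cancel_left₀ hs]

end Mollifier

/-- A fixed bump function. -/
def stdBump (n : ℕ) : ContDiffBump (0 : Rn n) := ⟨1 / 4, 1 / 2, by norm_num, by norm_num⟩

/-- The normalization of the fixed bump function. -/
def mol (n : ℕ) : Rn n → ℝ := (stdBump n).normed volume

theorem contDiff_mol (n : ℕ) : ContDiff ℝ ∞ (mol n) := (stdBump n).contDiff_normed

theorem hasCompactSupport_mol (n : ℕ) : HasCompactSupport (mol n) :=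
  (stdBump n).hasCompactSupport_normed

theorem tsupport_mol_subset (n : ℕ) : tsupport (mol n) ⊆ ball 0 1 := by
  rw [mol, ContDiffBump.tsupport_normed_eq]
  exact closedBall_subset_ball (by norm_num [stdBump])

theorem integral_mol (n : ℕ) : ∫ z, mol n z = 1 := (stdBump n).integral_normed

end FormSubordination

end

/-! ### Sufficiency: splitting the field at the scale `r`. -/

noncomputable section

namespace FormSubordination

open Metric Filter Topology
open scoped ENNReal Convolution

variable {n : ℕ}

theorem ofFun_apply {f : Rn n → ℂ} (hf : LocallyIntegrable f) (φ : RealTest n) :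
    ofFun f φ = ∫ x, φ x • f x :=
  TestFunction.integralAgainstBilinCLM_eq_integral (hf.locallyIntegrableOn _)

theorem lineDeriv_basisVec_apply (φ : RealTest n) (i : Fin n) (x : Rn n) :
    (∂_{basisVec i} φ : RealTest n) x = pd i φ x := by
  change TestFunction.lineDerivCLM ℝ (basisVec i) φ x = _
  rw [TestFunction.lineDerivCLM_apply_of_le (by simp)]
  exact (φ.contDiff.differentiable (by simp)).differentiableAt.lineDeriv_eq_fderiv

theorem IsL2Loc.locallyIntegrable_apply {Γ : Rn n → Cn n} (h : IsL2Loc Γ) (i : Fin n) :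
    LocallyIntegrable fun x => Γ x i := by
  rw [locallyIntegrable_iff]
  intro K hK
  exact (EuclideanSpace.proj i : Cn n →L[ℂ] ℂ).integrable_comp
    (h.locallyIntegrable.integrableOn_isCompact hK)

theorem divergence_apply {Γ : Rn n → Cn n} (hΓ : ∀ i, LocallyIntegrable fun x => Γ x i)
    (φ : RealTest n) :
    divergence Γ φ = -∑ i : Fin n, ∫ x, pd i φ x • Γ x i := by
  rw [divergence, sum_apply, ← Finset.sum_neg_distrib]
  refine Finset.sum_congr rfl fun i _ => ?_
  rw [Distribution.lineDerivOp_apply_apply, map_neg, ofFun_apply (hΓ i)]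
  simp only [lineDeriv_basisVec_apply]

/-- Compare `Γ` with its mean over `ball x t`, that mean with the mean over `ball x (2 * r)`, and
the latter with the mollification, which averages `Γ - m₂` over `ball y r ⊆ ball x (2 * r)`.
Lowering the exponent to `α'` makes one Morrey bound cover all signs of `α`. -/
theorem OscLE.integral_sub_av_le {α α' δ₀ c M : ℝ} (hc : 0 ≤ c) (hα' : α' < 0) (hα : α' ≤ α)
    {ψ : Rn n → ℝ} (hψ : Continuous ψ) (hψc : HasCompactSupport ψ) (hψs : tsupport ψ ⊆ ball 0 1)
    (hM : ∀ z, |ψ z| ≤ M) (hψ1 : ∫ z, ψ z = 1)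
    {Γ : Rn n → Cn n} (h : IsL2Loc Γ) (ho : OscLE α δ₀ c Γ) (x : Rn n) {t r : ℝ} (ht : 0 < t)
    (htr : t ≤ r) (hr : 2 * r < δ₀) :
    ∫ y in ball x t, ‖Γ y - av ψ r Γ y‖ ^ 2 ≤
      3 * (c + unitVol n * ((√(c * 2 ^ n / unitVol n) * (1 + ((1 / 2 : ℝ) ^ α' - 1)⁻¹)) *
        2 ^ (α - α')) ^ 2 + unitVol n * (M ^ 2 * unitVol n * c * 2 ^ n * (2 ^ α) ^ 2)) *
        r ^ (2 * α - 2 * α') * t ^ ((n : ℝ) - (-2 * α')) := by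
  have hr0 : 0 < r := ht.trans_le htr
  have hω := unitVol_pos n
  set K := √(c * 2 ^ n / unitVol n) * (1 + ((1 / 2 : ℝ) ^ α' - 1)⁻¹) with hK
  -- The common size of the three differences: it dominates both `r ^ α` and `t ^ α` because `t ≤
  -- r`, `α' < 0` and `α' ≤ α`.
  set ϱ := r ^ α * (t / r) ^ α' with hϱ
  have htr1 : t / r ≤ 1 := (div_le_one hr0).2 htr
  have htr0 : 0 < t / r := by positivity
  have hone : 1 ≤ (t / r) ^ α' := Real.one_le_rpow_of_pos_of_le_one_of_nonpos htr0 htr1 hα'.le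
  have hrϱ : r ^ α ≤ ϱ := le_mul_of_one_le_right (by positivity) hone
  have htϱ : t ^ α ≤ ϱ := by
    have : t ^ α = r ^ α * (t / r) ^ α := by
      rw [← Real.mul_rpow hr0.le htr0.le]; congr 1; field_simp
    rw [this, hϱ]
    gcongr ?_ * ?_
    exact Real.rpow_le_rpow_of_exponent_ge htr0 htr1 hα
  have hfin : ϱ ^ 2 * t ^ n = r ^ (2 * α - 2 * α') * t ^ ((n : ℝ) - (-2 * α')) := by
    rw [hϱ, mul_pow, Real.div_rpow ht.le hr0.le, div_pow, Real.rpow_sub hr0, Real.rpow_sub ht,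
      Real.rpow_natCast, mul_comm 2 α, mul_comm 2 α', Real.rpow_mul hr0.le, Real.rpow_mul hr0.le,
      neg_mul, Real.rpow_neg ht.le, mul_comm 2 α', Real.rpow_mul ht.le]
    norm_num
    field_simp
  set m₁ := ⨍ z in ball x t, Γ z with hm₁
  set m₂ := ⨍ z in ball x (2 * r), Γ z with hm₂
  have h2 : ‖m₁ - m₂‖ ≤ K * 2 ^ (α - α') * ϱ := by
    have := ho.average_sub_average_le hc h hα' hα x ht (by linarith : t ≤ 2 * r) hr
    rw [← hK] at this
    refine this.trans (le_of_eq ?_)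
    rw [Real.mul_rpow (by norm_num) hr0.le, hϱ, Real.rpow_sub (by norm_num), Real.div_rpow ht.le
      (by positivity), Real.div_rpow ht.le hr0.le, Real.mul_rpow (by norm_num) hr0.le]
    field_simp
  have h3 : ∀ y ∈ ball x t, ‖m₂ - av ψ r Γ y‖ ^ 2 ≤
      M ^ 2 * unitVol n * c * 2 ^ n * (2 ^ α) ^ 2 * ϱ ^ 2 := by
    intro y hy
    have e : av ψ r (fun y => Γ y - m₂) y = av ψ r Γ y - m₂ := by
      rw [av_sub_const hψ hψc h.locallyIntegrable hr0, hψ1, one_smul]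
    have h4 := norm_av_sq_le hψs hM (f := fun y => Γ y - m₂) (y := y) hr0
      ((h.integrableOn_ball y r).sub (integrableOn_const measure_ball_lt_top.ne))
      (h.integrableOn_norm_sub_sq y r m₂)
    rw [e] at h4
    rw [norm_sub_rev]
    refine h4.trans ?_
    have hsub : ball y r ⊆ ball x (2 * r) := by
      refine ball_subset_ball' ?_
      rw [mem_ball] at hy
      linarith
    have h5 : ∫ w in ball y r, ‖Γ w - m₂‖ ^ 2 ≤ c * ((2 * r) ^ n * ((2 * r) ^ α) ^ 2) := by
      rw [← rpow_add_two_mul (by positivity)]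
      refine le_trans ?_ (ho x (2 * r) (by positivity) hr)
      exact setIntegral_mono_set (h.integrableOn_norm_sub_sq x (2 * r) _)
        (Eventually.of_forall fun _ => by positivity) hsub.eventuallyLE
    calc _ ≤ M ^ 2 * unitVol n * (r ^ n)⁻¹ * (c * ((2 * r) ^ n * ((2 * r) ^ α) ^ 2)) := by gcongr
      _ = M ^ 2 * unitVol n * c * 2 ^ n * (2 ^ α) ^ 2 * (r ^ α) ^ 2 := by
        rw [Real.mul_rpow (by norm_num) hr0.le, mul_pow 2 r n]
        field_simp
      _ ≤ _ := by gcongr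
  have h1 : ∫ y in ball x t, ‖Γ y - m₁‖ ^ 2 ≤ c * (t ^ n * ϱ ^ 2) := by
    refine (ho x t ht (by linarith)).trans ?_
    rw [rpow_add_two_mul ht]
    gcongr
  have hb : ∫ y in ball x t, ‖Γ y - av ψ r Γ y‖ ^ 2 ≤ ∫ y in ball x t, (3 * ‖Γ y - m₁‖ ^ 2 +
      (3 * (K * 2 ^ (α - α') * ϱ) ^ 2 +
        3 * (M ^ 2 * unitVol n * c * 2 ^ n * (2 ^ α) ^ 2 * ϱ ^ 2))) := by
    refine integral_mono_of_nonneg (Eventually.of_forall fun _ => by positivity) ?_ ?_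
    · exact ((h.integrableOn_norm_sub_sq x t _).const_mul 3).add
        (integrableOn_const measure_ball_lt_top.ne)
    · filter_upwards [ae_restrict_mem measurableSet_ball] with y hy
      have t1 : ‖Γ y - av ψ r Γ y‖ ≤ ‖Γ y - m₁‖ + ‖m₁ - m₂‖ + ‖m₂ - av ψ r Γ y‖ := by
        refine le_trans (le_of_eq ?_) (norm_add₃_le)
        congr 1; abel
      have t2 : ‖m₁ - m₂‖ ^ 2 ≤ (K * 2 ^ (α - α') * ϱ) ^ 2 := pow_le_pow_left₀ (norm_nonneg _) h2 2
      have t3 := h3 y hy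
      have t4 : ‖Γ y - av ψ r Γ y‖ ^ 2 ≤
          3 * (‖Γ y - m₁‖ ^ 2 + ‖m₁ - m₂‖ ^ 2 + ‖m₂ - av ψ r Γ y‖ ^ 2) := by
        refine (pow_le_pow_left₀ (norm_nonneg _) t1 2).trans ?_
        nlinarith [sq_nonneg (‖Γ y - m₁‖ - ‖m₁ - m₂‖), sq_nonneg (‖Γ y - m₁‖ - ‖m₂ - av ψ r Γ y‖),
          sq_nonneg (‖m₁ - m₂‖ - ‖m₂ - av ψ r Γ y‖)]
      linarith
  refine hb.trans ?_
  rw [integral_add ((h.integrableOn_norm_sub_sq x t _).const_mul 3)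
    (integrableOn_const measure_ball_lt_top.ne), integral_const_mul, setIntegral_const,
    smul_eq_mul, volume_real_ball x ht, mul_assoc _ (r ^ _), ← hfin]
  have htn : 0 < t ^ n := by positivity
  nlinarith [h1]

theorem norm_pd_normSq_le (u : Test n) (i : Fin n) (x : Rn n) :
    |pd i (normSqTest u) x| ≤ 2 * ‖u x‖ * ‖fderiv ℝ u x (basisVec i)‖ := by
  have hu : HasFDerivAt u (fderiv ℝ u x) x :=
    (u.contDiff.differentiable (by simp)).differentiableAt.hasFDerivAt
  have h1 := hu.norm_sq
  have h2 : pd i (normSqTest u) x = 2 * inner ℝ (u x) (fderiv ℝ u x (basisVec i)) := by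
    have h3 : fderiv ℝ (normSqTest u) x = _ := h1.fderiv
    rw [pd, h3]
    simp
    ring
  rw [h2, abs_mul, abs_two, mul_assoc]
  gcongr
  exact abs_real_inner_le_norm _ _

theorem av_apply {ψ : Rn n → ℝ} (hψ : Continuous ψ) (hψc : HasCompactSupport ψ)
    {Γ : Rn n → Cn n} (hΓ : LocallyIntegrable Γ) {s : ℝ} (hs : 0 < s) (x : Rn n) (i : Fin n) :
    av ψ s Γ x i = av ψ s (fun y => Γ y i) x := by
  have h := ((EuclideanSpace.proj i : Cn n →L[ℂ] ℂ).restrictScalars ℝ).integral_comp_comm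
    (integrable_av_of_locallyIntegrable hψ hψc hΓ hs x)
  exact h.symm

theorem IsL2Loc.locallyIntegrable_norm_sub_sq {Γ f : Rn n → Cn n} (h : IsL2Loc Γ)
    (hf : Continuous f) : LocallyIntegrable fun x => ‖Γ x - f x‖ ^ 2 := by
  rw [locallyIntegrable_iff]
  intro K hK
  have hfin : IsFiniteMeasure (volume.restrict K) := ⟨by simpa using hK.measure_lt_top⟩
  obtain ⟨C, hC⟩ := hK.exists_bound_of_continuousOn hf.continuousOn
  have hfL : MemLp f 2 (volume.restrict K) :=
    MemLp.of_bound hf.aestronglyMeasurable C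
      ((ae_restrict_mem hK.measurableSet).mono fun x hx => hC x hx)
  exact ((h K hK).sub hfL).integrable_norm_pow (by norm_num)

/-- The trace inequality with `μ = 2β/(β+1)`, for which `2 - μ = 2/(β+1)`. -/
theorem norm_integral_smul_le_of_massBound {β δ₀ c : ℝ} (hβ : 0 < β) (hc : 0 ≤ c)
    {γ : Rn n → ℂ} (hγ : LocallyIntegrable γ) (hm : MassBound β δ₀ c γ) :
    ∃ C > 0, ∀ r : ℝ, 0 < r → r < δ₀ → ∀ u : Test n, ‖∫ x, normSqTest u x • γ x‖ ≤
      C * (r ^ (2 / (β + 1)) * gradNormSq u + r ^ (2 / (β + 1) - 2) * normSqL2 u) := by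
  have hb : β + 1 ≠ 0 := by positivity
  have hμ : 2 * β / (β + 1) < 2 := by
    rw [div_lt_iff₀ (by positivity)]; linarith
  obtain ⟨C, hC, hC'⟩ := exists_integral_mul_norm_sq_le n hμ
  refine ⟨C * (c + 1), by positivity, fun r hr hrδ u => ?_⟩
  have h1 := hC' (fun x => ‖γ x‖)
    (locallyIntegrable_iff.2 fun K hK => (hγ.integrableOn_isCompact hK).norm) (fun x => norm_nonneg _) (c + 1) r (by positivity) hr
    (fun x t ht htr => (hm x t ht (htr.trans_lt hrδ)).trans (by gcongr; linarith)) u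
  have e1 : 2 - 2 * β / (β + 1) = 2 / (β + 1) := by field_simp; ring
  have e2 : -(2 * β / (β + 1)) = 2 / (β + 1) - 2 := by field_simp; ring
  rw [e1, e2] at h1
  refine le_trans ?_ h1
  refine (norm_integral_le_integral_norm _).trans (le_of_eq ?_)
  refine integral_congr_ae (Eventually.of_forall fun x => ?_)
  simp only
  rw [norm_smul, mul_comm]
  congr 1
  exact Real.norm_of_nonneg (by change 0 ≤ ‖u x‖ ^ 2; positivity)

theorem exists_abs_le_of_compact {ψ : Rn n → ℝ} (hψ : Continuous ψ) (hψc : HasCompactSupport ψ) :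
    ∃ M > 0, ∀ z, |ψ z| ≤ M := by
  obtain ⟨C, hC⟩ := hψ.bounded_above_of_compact_support hψc
  exact ⟨|C| + 1, by positivity, fun z => (hC z).trans (by linarith [le_abs_self C])⟩

/-- Integrating by parts moves the derivative to the kernel at the price `r⁻¹`. The differentiated
kernel has integral zero, so a mean of `Γ` may be subtracted and the oscillation bound gives `r ^
α`. -/
theorem norm_sum_integral_pd_av_le {α δ₀ c : ℝ} (hc : 0 < c) {Γ : Rn n → Cn n} (h : IsL2Loc Γ)
    (ho : OscLE α δ₀ c Γ) :
    ∃ C > 0, ∀ r : ℝ, 0 < r → r < δ₀ → ∀ u : Test n,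
      ‖∑ i : Fin n, ∫ x, pd i (normSqTest u) x • av (mol n) r (fun y => Γ y i) x‖ ≤
        C * r ^ (α - 1) * normSqL2 u := by
  have hψ := contDiff_mol n
  have hψ1 : ContDiff ℝ 1 (mol n) := hψ.of_le (by simp)
  have hψc := hasCompactSupport_mol n
  choose M hM hM' using fun i => exists_abs_le_of_compact (continuous_pd hψ1 i)
    (hasCompactSupport_pd hψc i)
  have hω := unitVol_pos n
  refine ⟨∑ i, √(M i ^ 2 * unitVol n * c) + 1, by positivity, fun r hr hrδ u => ?_⟩
  have hφ : ContDiff ℝ 1 (normSqTest u) := (normSqTest u).contDiff.of_le (by simp)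
  have hφc := (normSqTest u).hasCompactSupport
  have hI0 : 0 ≤ normSqL2 u := integral_nonneg fun _ => by positivity
  have hpt : ∀ i x, ‖av (pd i (mol n)) r (fun y => Γ y i) x‖ ≤
      √(M i ^ 2 * unitVol n * c) * r ^ α := by
    intro i x
    have hs : tsupport (pd i (mol n)) ⊆ ball 0 1 :=
      (tsupport_fderiv_apply_subset ℝ _).trans (tsupport_mol_subset n)
    set m := ⨍ z in ball x r, Γ z
    have e : av (pd i (mol n)) r (fun y => Γ y - m) x = av (pd i (mol n)) r Γ x := by
      rw [av_sub_const (continuous_pd hψ1 i) (hasCompactSupport_pd hψc i) h.locallyIntegrable hr,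
        integral_pd_eq_zero hψ1 hψc, zero_smul, sub_zero]
    have h4 := norm_av_sq_le hs (hM' i) (f := fun y => Γ y - m) (y := x) hr
      ((h.integrableOn_ball x r).sub (integrableOn_const measure_ball_lt_top.ne))
      (h.integrableOn_norm_sub_sq x r m)
    rw [e] at h4
    have h5 := ho x r hr hrδ
    rw [rpow_add_two_mul hr] at h5
    have h6 : ‖av (pd i (mol n)) r Γ x‖ ≤ √(M i ^ 2 * unitVol n * c) * r ^ α := by
      refine abs_le_of_sq_le_sq' ?_ (by positivity) |>.2
      rw [mul_pow, Real.sq_sqrt (by positivity)]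
      refine h4.trans ?_
      calc _ ≤ M i ^ 2 * unitVol n * (r ^ n)⁻¹ * (c * (r ^ n * (r ^ α) ^ 2)) := by gcongr
        _ = _ := by field_simp
    rw [← av_apply (continuous_pd hψ1 i) (hasCompactSupport_pd hψc i) h.locallyIntegrable hr]
    exact (PiLp.norm_apply_le _ i).trans h6
  have hterm : ∀ i, ‖∫ x, pd i (normSqTest u) x • av (mol n) r (fun y => Γ y i) x‖ ≤
      √(M i ^ 2 * unitVol n * c) * (r ^ (α - 1) * normSqL2 u) := by
    intro i
    rw [integral_pd_smul_av hψ1 hψc hφ hφc (h.locallyIntegrable_apply i) hr.ne', norm_neg,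
      norm_smul, Real.norm_of_nonneg (by positivity)]
    have h7 : ‖∫ x, normSqTest u x • av (pd i (mol n)) r (fun y => Γ y i) x‖ ≤
        ∫ x, ‖u x‖ ^ 2 * (√(M i ^ 2 * unitVol n * c) * r ^ α) := by
      refine norm_integral_le_of_norm_le ?_ (Eventually.of_forall fun x => ?_)
      · exact ((u.continuous.norm.pow 2).integrable_of_hasCompactSupport
          (hasCompactSupport_norm_sq u.hasCompactSupport)).mul_const _
      · rw [norm_smul, Real.norm_of_nonneg (by change 0 ≤ ‖u x‖ ^ 2; positivity)]
        exact mul_le_mul_of_nonneg_left (hpt i x) (by change 0 ≤ ‖u x‖ ^ 2; positivity)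
    rw [integral_mul_const] at h7
    calc _ ≤ r⁻¹ * (normSqL2 u * (√(M i ^ 2 * unitVol n * c) * r ^ α)) := by
          gcongr; exact h7
      _ = _ := by rw [Real.rpow_sub_one hr.ne']; field_simp
  calc _ ≤ ∑ i, √(M i ^ 2 * unitVol n * c) * (r ^ (α - 1) * normSqL2 u) :=
        (norm_sum_le _ _).trans (Finset.sum_le_sum fun i _ => hterm i)
    _ = (∑ i, √(M i ^ 2 * unitVol n * c)) * (r ^ (α - 1) * normSqL2 u) := by rw [Finset.sum_mul]
    _ ≤ (∑ i, √(M i ^ 2 * unitVol n * c) + 1) * (r ^ (α - 1) * normSqL2 u) := by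
        gcongr; linarith
    _ = _ := by ring

/-- Use `|∇|u|²| ≤ 2 |u| |∇u|` and Young's inequality; then apply the trace inequality to the
density `|Γ - Γ_r|²`. -/
theorem norm_sum_integral_pd_sub_av_le {α δ₀ c : ℝ} (hc : 0 < c) (hα1 : -1 < α)
    {Γ : Rn n → Cn n} (h : IsL2Loc Γ) (ho : OscLE α δ₀ c Γ) :
    ∃ C > 0, ∀ r : ℝ, 0 < r → 2 * r < δ₀ → ∀ ε > 0, ∀ u : Test n,
      ‖∑ i : Fin n, ∫ x, pd i (normSqTest u) x • (Γ x i - av (mol n) r (fun y => Γ y i) x)‖ ≤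
        ε * gradNormSq u + ε⁻¹ * (C * (r ^ (2 + 2 * α) * gradNormSq u +
          r ^ (2 * α) * normSqL2 u)) := by
  have hψ := contDiff_mol n
  have hψc := hasCompactSupport_mol n
  obtain ⟨M, hM, hM'⟩ := exists_abs_le_of_compact hψ.continuous hψc
  have hω := unitVol_pos n
  -- The exponent must be negative for the comparison of averages and larger than `-1` so that `μ =
  -- -2 * α'` is below `2`.
  set α' := min α (-1 / 2) with hα'
  have hα'0 : α' < 0 := (min_le_right _ _).trans_lt (by norm_num)
  have hα'1 : -1 < α' := lt_min hα1 (by norm_num)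
  have hα'α : α' ≤ α := min_le_left _ _
  obtain ⟨C, hC, hC'⟩ := exists_integral_mul_norm_sq_le n (μ := -2 * α') (by linarith)
  set D := 3 * (c + unitVol n * ((√(c * 2 ^ n / unitVol n) * (1 + ((1 / 2 : ℝ) ^ α' - 1)⁻¹)) *
        2 ^ (α - α')) ^ 2 + unitVol n * (M ^ 2 * unitVol n * c * 2 ^ n * (2 ^ α) ^ 2)) with hD
  have hD0 : 0 < D := by positivity
  refine ⟨C * D, by positivity, fun r hr hrδ ε hε u => ?_⟩
  have hcont : Continuous (av (mol n) r Γ) :=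
    continuous_av_of_locallyIntegrable hψ.continuous hψc h.locallyIntegrable hr
  set V : Rn n → ℝ := fun x => ‖Γ x - av (mol n) r Γ x‖ ^ 2 with hV
  have hVi : LocallyIntegrable V := h.locallyIntegrable_norm_sub_sq hcont
  have h1 := hC' V hVi (fun x => by positivity) (D * r ^ (2 * α - 2 * α')) r (by positivity) hr
    (fun x t ht htr => ho.integral_sub_av_le hc.le hα'0 hα'α hψ.continuous hψc
      (tsupport_mol_subset n) hM' (integral_mol n) h x ht htr hrδ) u
  have e1 : r ^ (2 * α - 2 * α') * r ^ (2 - -2 * α') = r ^ (2 + 2 * α) := by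
    rw [← Real.rpow_add hr]; congr 1; ring
  have e2 : r ^ (2 * α - 2 * α') * r ^ (-(-2 * α')) = r ^ (2 * α) := by
    rw [← Real.rpow_add hr]; congr 1; ring
  have h2 : ∫ x, V x * ‖u x‖ ^ 2 ≤ C * D * (r ^ (2 + 2 * α) * gradNormSq u +
      r ^ (2 * α) * normSqL2 u) := by
    rw [← e1, ← e2]
    refine h1.trans (le_of_eq ?_)
    ring
  have hu1 : ContDiff ℝ 1 u := u.contDiff.of_le (by simp)
  have huc := u.hasCompactSupport
  have hVint : Integrable fun x => V x * ‖u x‖ ^ 2 := by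
    have : Integrable fun x => (‖u x‖ ^ 2) • V x :=
      hVi.integrable_smul_left_of_hasCompactSupport (u.continuous.norm.pow 2)
        (hasCompactSupport_norm_sq huc)
    simpa only [smul_eq_mul, mul_comm] using this
  have hGint : ∀ i, Integrable fun x => ‖fderiv ℝ u x (basisVec i)‖ ^ 2 := fun i =>
    ((continuous_pd hu1 i).norm.pow 2).integrable_of_hasCompactSupport
      (hasCompactSupport_norm_sq (hasCompactSupport_pd huc i))
  have hterm : ∀ i, Integrable fun x =>
      pd i (normSqTest u) x • (Γ x i - av (mol n) r (fun y => Γ y i) x) := by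
    intro i
    have hli : LocallyIntegrable fun x => Γ x i - av (mol n) r (fun y => Γ y i) x :=
      (h.locallyIntegrable_apply i).sub (continuous_av_of_locallyIntegrable hψ.continuous hψc
        (h.locallyIntegrable_apply i) hr).locallyIntegrable
    exact hli.integrable_smul_left_of_hasCompactSupport
      (continuous_pd ((normSqTest u).contDiff.of_le (by simp)) i)
      (hasCompactSupport_pd (normSqTest u).hasCompactSupport i)
  rw [← integral_finsetSum _ fun i _ => hterm i]
  have h3 : ‖∫ x, ∑ i : Fin n, pd i (normSqTest u) x • (Γ x i - av (mol n) r (fun y => Γ y i) x)‖ ≤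
      ∫ x, (ε * (∑ i : Fin n, ‖fderiv ℝ u x (basisVec i)‖ ^ 2) + ε⁻¹ * (V x * ‖u x‖ ^ 2)) := by
    refine norm_integral_le_of_norm_le (((integrable_finsetSum _ fun i _ => hGint i).const_mul
      ε).add (hVint.const_mul _)) (Eventually.of_forall fun x => ?_)
    have hVx : V x = ∑ i : Fin n, ‖Γ x i - av (mol n) r (fun y => Γ y i) x‖ ^ 2 := by
      rw [hV]
      simp only
      rw [EuclideanSpace.norm_eq, Real.sq_sqrt (by positivity)]
      refine Finset.sum_congr rfl fun i _ => ?_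
      rw [PiLp.sub_apply, av_apply hψ.continuous hψc h.locallyIntegrable hr]
    rw [hVx, Finset.sum_mul, Finset.mul_sum, Finset.mul_sum, ← Finset.sum_add_distrib]
    refine (norm_sum_le _ _).trans (Finset.sum_le_sum fun i _ => ?_)
    rw [norm_smul, Real.norm_eq_abs]
    set a := ‖fderiv ℝ u x (basisVec i)‖
    set b := ‖Γ x i - av (mol n) r (fun y => Γ y i) x‖
    have h4 := norm_pd_normSq_le u i x
    have hb : 0 ≤ b := norm_nonneg _
    calc _ ≤ 2 * ‖u x‖ * a * b := by gcongr
      _ = 2 * (a * (‖u x‖ * b)) := by ring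
      _ ≤ ε * a ^ 2 + ε⁻¹ * (b ^ 2 * ‖u x‖ ^ 2) := by
        have h5 : 0 ≤ ε⁻¹ * (ε * a - ‖u x‖ * b) ^ 2 := by positivity
        have h6 : ε⁻¹ * (ε * a - ‖u x‖ * b) ^ 2 =
          ε * a ^ 2 + ε⁻¹ * (b ^ 2 * ‖u x‖ ^ 2) - 2 * (a * (‖u x‖ * b)) := by
          field_simp; ring
        linarith
  rw [integral_add ((integrable_finsetSum _ fun i _ => hGint i).const_mul ε) (hVint.const_mul _),
    integral_const_mul, integral_const_mul] at h3
  refine h3.trans ?_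
  gcongr
  exact le_rfl

theorem trudingerSubordinate_of_bounds {β : ℝ} (hβ : 0 < β) {Q : Distr n} {Γ : Rn n → Cn n}
    {γ : Rn n → ℂ} (hΓ : IsL2Loc Γ) (hγ : LocallyIntegrable γ) (hQ : Q = divergence Γ + ofFun γ)
    {δ₀ c : ℝ} (hδ₀ : 0 < δ₀) (hc : 0 < c) (ho : OscillationBound β δ₀ c Γ)
    (hm : MassBound β δ₀ c γ) : TrudingerSubordinate Q β := by
  rw [oscillationBound_iff hβ] at ho
  set α := (1 - β) / (1 + β) with hα
  have hb : β + 1 ≠ 0 := by positivity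
  have hb' : 1 + β ≠ 0 := by positivity
  have hα1 : -1 < α := by
    rw [hα, lt_div_iff₀ (by positivity)]; linarith
  obtain ⟨C₁, hC₁, h₁⟩ := norm_integral_smul_le_of_massBound hβ hc.le hγ hm
  obtain ⟨C₂, hC₂, h₂⟩ := norm_sum_integral_pd_av_le hc hΓ ho
  obtain ⟨C₃, hC₃, h₃⟩ := norm_sum_integral_pd_sub_av_le hc hα1 hΓ ho
  set C := C₁ + C₂ + 1 + C₃ with hC
  have hC0 : 0 < C := by positivity
  have hψ := contDiff_mol n
  have hψc := hasCompactSupport_mol n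
  have main : ∀ ε : ℝ, 0 < ε → ε < (δ₀ / 2) ^ (2 / (β + 1)) → ∀ u : Test n,
      ‖Q (normSqTest u)‖ ≤ C * (ε * gradNormSq u + ε ^ (-β) * normSqL2 u) := by
    intro ε hε hεδ u
    -- This choice turns every power of `r` in the three estimates into the matching power of `ε`;
    -- in particular `r ^ (α - 1) = ε ^ (-β)` and `ε⁻¹ * r ^ (2 + 2 * α) = ε`.
    set r := ε ^ ((β + 1) / 2) with hr
    have hr0 : 0 < r := by positivity
    have hrδ : 2 * r < δ₀ := by
      have h1 : r < ((δ₀ / 2) ^ (2 / (β + 1))) ^ ((β + 1) / 2) :=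
        Real.rpow_lt_rpow hε.le hεδ (by positivity)
      rw [← Real.rpow_mul (by positivity)] at h1
      have e : 2 / (β + 1) * ((β + 1) / 2) = 1 := by field_simp
      rw [e, Real.rpow_one] at h1
      linarith
    have p1 : r ^ (2 / (β + 1)) = ε := by
      rw [hr, ← Real.rpow_mul hε.le]
      have e : (β + 1) / 2 * (2 / (β + 1)) = 1 := by field_simp
      rw [e, Real.rpow_one]
    have p2 : r ^ (2 / (β + 1) - 2) = ε ^ (-β) := by
      rw [hr, ← Real.rpow_mul hε.le]
      congr 1; field_simp; ring
    have p3 : r ^ (α - 1) = ε ^ (-β) := by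
      rw [hr, ← Real.rpow_mul hε.le]
      congr 1; rw [hα]; field_simp; ring
    have p4 : r ^ (2 + 2 * α) = ε * ε := by
      have : ε * ε = ε ^ (2 : ℝ) := by rw [Real.rpow_two]; ring
      rw [this, hr, ← Real.rpow_mul hε.le]
      congr 1; rw [hα]; field_simp; ring
    have p5 : r ^ (2 * α) = ε * ε ^ (-β) := by
      have : ε * ε ^ (-β) = ε ^ (1 + -β) := by rw [Real.rpow_add hε, Real.rpow_one]
      rw [this, hr, ← Real.rpow_mul hε.le]
      congr 1; rw [hα]; field_simp; ring
    have b1 := h₁ r hr0 (by linarith) u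
    have b2 := h₂ r hr0 (by linarith) u
    have b3 := h₃ r hr0 hrδ ε hε u
    rw [p1, p2] at b1
    rw [p3] at b2
    rw [p4, p5] at b3
    have hI0 : 0 ≤ normSqL2 u := integral_nonneg fun _ => by positivity
    have hG0 : 0 ≤ gradNormSq u := integral_nonneg fun _ => by positivity
    have hsplit : ∑ i : Fin n, ∫ x, pd i (normSqTest u) x • Γ x i =
        (∑ i : Fin n, ∫ x, pd i (normSqTest u) x • (Γ x i - av (mol n) r (fun y => Γ y i) x)) +
        ∑ i : Fin n, ∫ x, pd i (normSqTest u) x • av (mol n) r (fun y => Γ y i) x := by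
      rw [← Finset.sum_add_distrib]
      refine Finset.sum_congr rfl fun i _ => ?_
      have hφ' := continuous_pd ((normSqTest u).contDiff.of_le (by simp) : ContDiff ℝ 1 _) i
      have hφc' := hasCompactSupport_pd (normSqTest u).hasCompactSupport i
      have hac := continuous_av_of_locallyIntegrable hψ.continuous hψc
        (hΓ.locallyIntegrable_apply i) hr0
      rw [← integral_add]
      · refine integral_congr_ae (Eventually.of_forall fun x => ?_)
        simp only
        rw [← smul_add, sub_add_cancel]
      · exact ((hΓ.locallyIntegrable_apply i).sub
          hac.locallyIntegrable).integrable_smul_left_of_hasCompactSupport hφ' hφc'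
      · exact hac.locallyIntegrable.integrable_smul_left_of_hasCompactSupport hφ' hφc'
    have hQu : Q (normSqTest u) = -(∑ i : Fin n, ∫ x, pd i (normSqTest u) x • Γ x i) +
        ∫ x, normSqTest u x • γ x := by
      rw [hQ, add_apply, divergence_apply hΓ.locallyIntegrable_apply,
        ofFun_apply hγ]
    rw [hQu, hsplit]
    refine (norm_add_le _ _).trans ?_
    rw [norm_neg]
    refine (add_le_add (norm_add_le _ _) le_rfl).trans ?_
    have e : ε⁻¹ * (C₃ * (ε * ε * gradNormSq u + ε * ε ^ (-β) * normSqL2 u)) =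
        C₃ * (ε * gradNormSq u + ε ^ (-β) * normSqL2 u) := by field_simp
    rw [e] at b3
    have hεb : 0 < ε ^ (-β) := by positivity
    calc _ ≤ (ε * gradNormSq u + C₃ * (ε * gradNormSq u + ε ^ (-β) * normSqL2 u) +
          C₂ * ε ^ (-β) * normSqL2 u) + C₁ * (ε * gradNormSq u + ε ^ (-β) * normSqL2 u) :=
          add_le_add (add_le_add b3 b2) b1
      _ ≤ _ := by
        have q1 : 0 ≤ ε * gradNormSq u := by positivity
        have q2 : 0 ≤ ε ^ (-β) * normSqL2 u := by positivity
        rw [hC]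
        nlinarith [mul_nonneg hC₂.le q1]
  -- Applying `main` to `ε / C` makes the gradient coefficient exactly `ε`; the other constant
  -- becomes `C * C ^ β`.
  refine ⟨C * (δ₀ / 2) ^ (2 / (β + 1)), by positivity, C * C ^ β, by positivity,
    fun ε hε hεδ u => ?_⟩
  have h1 := main (ε / C) (by positivity) (by rwa [div_lt_iff₀' hC0]) u
  refine h1.trans (le_of_eq ?_)
  rw [Real.div_rpow hε.le hC0.le, Real.rpow_neg hC0.le]
  field_simp

end FormSubordination

end

noncomputable section

namespace FormSubordination

open Metric Filter Topology
open scoped ENNReal Convolution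

variable {n : ℕ}

/-! ### A pair of kernels solving a heat type equation -/

section Kernels

variable {F : Type*} [NormedAddCommGroup F] [NormedSpace ℝ F]

/-- The Laplacian as the sum of the second partial derivatives. -/
def lap (v : Rn n → F) : Rn n → F := fun x => ∑ i : Fin n, pd i (pd i v) x

theorem contDiff_lap {v : Rn n → F} (hv : ContDiff ℝ ∞ v) : ContDiff ℝ ∞ (lap v) :=
  ContDiff.sum fun i _ => contDiff_pd (contDiff_pd hv i) i

theorem hasCompactSupport_lap {v : Rn n → F} (hv : HasCompactSupport v) :
    HasCompactSupport (lap v) := by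
  refine HasCompactSupport.intro hv fun x hx => ?_
  refine Finset.sum_eq_zero fun i _ => ?_
  refine image_eq_zero_of_notMem_tsupport fun h => hx ?_
  exact tsupport_fderiv_apply_subset ℝ _ (tsupport_fderiv_apply_subset ℝ _ h)

/-- Smooth compactly supported real functions. -/
def IsTest (f : Rn n → ℝ) : Prop := ContDiff ℝ ∞ f ∧ HasCompactSupport f

theorem IsTest.pd {f : Rn n → ℝ} (hf : IsTest f) (i : Fin n) : IsTest (pd i f) :=
  ⟨contDiff_pd hf.1 i, hasCompactSupport_pd hf.2 i⟩

theorem IsTest.lap {f : Rn n → ℝ} (hf : IsTest f) : IsTest (lap f) :=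
  ⟨contDiff_lap hf.1, hasCompactSupport_lap hf.2⟩

theorem IsTest.contDiff_one {f : Rn n → ℝ} (hf : IsTest f) : ContDiff ℝ 1 f :=
  hf.1.of_le (by simp)

theorem IsTest.continuous {f : Rn n → ℝ} (hf : IsTest f) : Continuous f := hf.1.continuous

/-- A normalized kernel `ρ` together with a kernel `σ` such that `∇σ = -xρ`. -/
structure KernelPair (ρ σ : Rn n → ℝ) : Prop where
  testρ : IsTest ρ
  testσ : IsTest σ
  evenρ : ∀ z, ρ (-z) = ρ z
  evenσ : ∀ z, σ (-z) = σ z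
  integralρ : ∫ z, ρ z = 1
  pdσ : ∀ i z, pd i σ z = -(z i * ρ z)

/-- Take `σ = T(1 - |x|²)` with `T` the smooth transition. Its gradient is `-2x T'(1 - |x|²)`, so `ρ
= 2 T'(1 - |x|²)`, which is nonnegative as `T` is monotone. Both are then divided by the mass of
`ρ`. -/
theorem exists_kernelPair (hn : 0 < n) : ∃ ρ σ : Rn n → ℝ, KernelPair ρ σ := by
  set T := Real.smoothTransition with hT
  have hTs : ContDiff ℝ ∞ T := Real.smoothTransition.contDiff
  have hT's : ContDiff ℝ ∞ (deriv T) := (contDiff_infty_iff_deriv.1 hTs).2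
  have hsq : ContDiff ℝ ∞ fun x : Rn n => 1 - ‖x‖ ^ 2 := contDiff_const.sub (contDiff_norm_sq ℝ)
  set ρ₀ : Rn n → ℝ := fun x => 2 * deriv T (1 - ‖x‖ ^ 2) with hρ₀
  set σ₀ : Rn n → ℝ := fun x => T (1 - ‖x‖ ^ 2) with hσ₀
  have hout : ∀ x : Rn n, x ∉ closedBall (0 : Rn n) 1 → 1 - ‖x‖ ^ 2 < 0 := by
    intro x hx
    rw [mem_closedBall, dist_zero_right, not_le] at hx
    nlinarith
  have hTn : ∀ t : ℝ, t < 0 → T =ᶠ[𝓝 t] fun _ => 0 := fun t ht => by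
    filter_upwards [Iio_mem_nhds ht] with y hy
    exact Real.smoothTransition.zero_of_nonpos (le_of_lt hy)
  have hρt : IsTest ρ₀ := by
    refine ⟨contDiff_const.mul (hT's.comp hsq), HasCompactSupport.intro
      (isCompact_closedBall (0 : Rn n) 1) fun x hx => ?_⟩
    simp only [hρ₀]
    rw [(hTn _ (hout x hx)).deriv_eq]
    simp
  have hσt : IsTest σ₀ := by
    refine ⟨hTs.comp hsq, HasCompactSupport.intro
      (isCompact_closedBall (0 : Rn n) 1) fun x hx => ?_⟩
    exact (hTn _ (hout x hx)).self_of_nhds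
  have hmono : Monotone T := Real.smoothTransition.monotone
  have hρ0 : ∀ x, 0 ≤ ρ₀ x := fun x => mul_nonneg (by norm_num) hmono.deriv_nonneg
  -- Since `T` rises from `0` to `1`, its derivative equals `1` at some `t`; hence `ρ₀` is positive
  -- at a point of norm `√(1 - t)` and has positive mass.
  obtain ⟨t, ht, hdt⟩ := exists_deriv_eq_slope T (zero_lt_one' ℝ)
    (hTs.continuous.continuousOn) ((hTs.differentiable (by simp)).differentiableOn)
  have hpos : 0 < ∫ x, ρ₀ x := by
    refine hρt.continuous.integral_pos_of_hasCompactSupport_nonneg_nonzero hρt.2 hρ0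
      (x := (√(1 - t)) • (basisVec ⟨0, hn⟩ : Rn n)) ?_
    simp only [hρ₀, norm_smul, norm_basisVec, mul_one, Real.norm_eq_abs, sq_abs]
    rw [Real.sq_sqrt (by linarith [ht.2]), sub_sub_cancel, hdt]
    simp [hT, Real.smoothTransition.one, Real.smoothTransition.zero]
  set N := ∫ x, ρ₀ x with hN
  refine ⟨fun x => N⁻¹ * ρ₀ x, fun x => N⁻¹ * σ₀ x, ⟨contDiff_const.mul hρt.1, hρt.2.mul_left⟩,
    ⟨contDiff_const.mul hσt.1, hσt.2.mul_left⟩, fun z => by simp [hρ₀], fun z => by simp [hσ₀],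
    ?_, fun i z => ?_⟩
  · rw [integral_const_mul, ← hN, inv_mul_cancel₀ hpos.ne']
  · have h1 : HasFDerivAt (fun x : Rn n => ‖x‖ ^ 2) (2 • (innerSL ℝ z)) z :=
      (hasStrictFDerivAt_norm_sq z).hasFDerivAt
    have h2 : HasDerivAt T (deriv T (1 - ‖z‖ ^ 2)) (1 - ‖z‖ ^ 2) :=
      (hTs.differentiable (by simp)).differentiableAt.hasDerivAt
    have h3 := (h2.comp_hasFDerivAt z (h1.const_sub 1)).const_mul N⁻¹
    have h4 : fderiv ℝ (fun x => N⁻¹ * σ₀ x) z = _ := h3.fderiv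
    rw [pd, h4]
    have h5 : inner ℝ z (basisVec i : Rn n) = z i := by
      simp [basisVec, EuclideanSpace.inner_single_right]
    simp [hρ₀, h5]
    ring

/-- Differentiating in `s` produces `-z ρ(z) · ∇v(x - s z)`, which is `∇σ(z) · ∇v(x - s z)`.
Integration by parts in `z` yields the Laplacian and one factor `s`. -/
theorem KernelPair.hasDerivAt_av [CompleteSpace F] {ρ σ : Rn n → ℝ} (hk : KernelPair ρ σ)
    {v : Rn n → F} (hv : ContDiff ℝ ∞ v) (x : Rn n) (s : ℝ) :
    HasDerivAt (fun s => av ρ s v x) (s • av σ s (lap v) x) s := by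
  have hv1 : ContDiff ℝ 1 v := hv.of_le (by simp)
  have hv' : Continuous (fderiv ℝ v) := hv1.continuous_fderiv (by simp)
  have hρ := hk.testρ.continuous
  have hρc := hk.testρ.2
  obtain ⟨C, hC⟩ : ∃ C, ∀ p ∈ (closedBall s 1) ×ˢ tsupport ρ,
      ‖fderiv ℝ v (x - p.1 • p.2) p.2‖ ≤ C :=
    ((isCompact_closedBall s 1).prod hρc).exists_bound_of_continuousOn
      (f := fun p : ℝ × Rn n => fderiv ℝ v (x - p.1 • p.2) p.2) (by fun_prop)
  have hd := hasDerivAt_integral_of_dominated_loc_of_deriv_le (μ := (volume : Measure (Rn n)))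
    (F := fun s z => ρ z • v (x - s • z)) (F' := fun s z => ρ z • -(fderiv ℝ v (x - s • z) z))
    (x₀ := s) (bound := fun z => ‖ρ z‖ * C) (s := ball s 1) (ball_mem_nhds s one_pos)
    (Eventually.of_forall fun y => (integrable_av hρ hρc hv.continuous y x).1)
    (integrable_av hρ hρc hv.continuous s x)
    (by fun_prop)
    (by
      refine Eventually.of_forall fun z y hy => ?_
      rw [norm_smul, norm_neg]
      by_cases hz : z ∈ tsupport ρ
      · exact mul_le_mul_of_nonneg_left (hC (y, z) ⟨ball_subset_closedBall hy, hz⟩) (norm_nonneg _)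
      · simp [image_eq_zero_of_notMem_tsupport hz])
    ((hρ.norm.integrable_of_hasCompactSupport hρc.norm).mul_const C)
    (by
      refine Eventually.of_forall fun z y _ => ?_
      have h1 : HasFDerivAt v (fderiv ℝ v (x - y • z)) (x - y • z) :=
        (hv1.differentiable (by simp)).differentiableAt.hasFDerivAt
      have h2 : HasDerivAt (fun t : ℝ => x - t • z) (-z) y := by
        simpa using ((hasDerivAt_id y).smul_const z).const_sub x
      have h3 : HasDerivAt (fun t : ℝ => ρ z • v (x - t • z))
          (ρ z • fderiv ℝ v (x - y • z) (-z)) y := (h1.comp_hasDerivAt y h2).const_smul (ρ z)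
      rwa [map_neg] at h3)
  refine hd.2.congr_deriv ?_
  have e1 : ∀ z : Rn n, ρ z • -(fderiv ℝ v (x - s • z) z) =
      ∑ i : Fin n, pd i σ z • pd i v (x - s • z) := by
    intro z
    have hz : z = ∑ i : Fin n, z i • (basisVec i : Rn n) := by
      have := (EuclideanSpace.basisFun (Fin n) ℝ).sum_repr z
      simpa [basisVec] using this.symm
    have h1 : fderiv ℝ v (x - s • z) z = ∑ i : Fin n, z i • pd i v (x - s • z) := by
      conv_lhs => arg 2; rw [hz]
      simp [map_sum, pd]
    rw [h1, smul_neg, Finset.smul_sum, ← Finset.sum_neg_distrib]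
    refine Finset.sum_congr rfl fun i _ => ?_
    rw [hk.pdσ, neg_smul, smul_smul, mul_comm]
  simp only [e1]
  have hpσ : ∀ i : Fin n, Continuous (pd i σ) := fun i => continuous_pd hk.testσ.contDiff_one i
  have hpσc : ∀ i : Fin n, HasCompactSupport (pd i σ) := fun i => hasCompactSupport_pd hk.testσ.2 i
  rw [integral_finsetSum _ fun i _ =>
    integrable_av (hpσ i) (hpσc i) (continuous_pd hv1 i) s x]
  have e2 : av σ s (lap v) x = ∑ i : Fin n, av σ s (pd i (pd i v)) x := by
    simp only [av, lap, Finset.smul_sum]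
    exact integral_finsetSum _ fun i _ => integrable_av hk.testσ.continuous hk.testσ.2
      (contDiff_pd (contDiff_pd hv i) i).continuous s x
  rw [e2, Finset.smul_sum]
  refine Finset.sum_congr rfl fun i _ => ?_
  rw [smul_av_pd hk.testσ.contDiff_one hk.testσ.2 ((contDiff_pd hv i).of_le (by simp))]
  rfl

theorem KernelPair.av_sub_av [CompleteSpace F] {ρ σ : Rn n → ℝ} (hk : KernelPair ρ σ)
    {v : Rn n → F} (hv : ContDiff ℝ ∞ v) (x : Rn n) (a b : ℝ) :
    av ρ b v x - av ρ a v x = ∫ s in a..b, s • av σ s (lap v) x := by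
  refine (intervalIntegral.integral_eq_sub_of_hasDerivAt (fun s _ => hk.hasDerivAt_av hv x s)
    (Continuous.intervalIntegrable ?_ a b)).symm
  refine continuous_id.smul ?_
  exact (continuous_av hk.testσ.continuous hk.testσ.2 (contDiff_lap hv).continuous).comp
    (by fun_prop : Continuous fun s : ℝ => (s, x))

theorem KernelPair.av_zero [CompleteSpace F] {ρ σ : Rn n → ℝ} (hk : KernelPair ρ σ)
    (v : Rn n → F) (x : Rn n) : av ρ 0 v x = v x := by
  simp [av, integral_smul_const, hk.integralρ]

end Kernels

/-! ### Form bounded functionals -/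

/-- `∫ |∇u|²` for a real function. -/
def dirichlet (u : Rn n → ℝ) : ℝ := ∫ x, ∑ i : Fin n, pd i u x ^ 2

/-- A functional on test functions satisfying the subordination inequality. -/
structure FormBdd (β ε₀ c : ℝ) (L : (Rn n → ℝ) → ℂ) : Prop where
  map_add : ∀ f g, IsTest f → IsTest g → L (fun x => f x + g x) = L f + L g
  map_mul : ∀ (a : ℝ) (f), IsTest f → L (fun x => a * f x) = a * L f
  bound : ∀ ε, 0 < ε → ε < ε₀ → ∀ u, IsTest u →
    ‖L (fun x => u x ^ 2)‖ ≤ ε * dirichlet u + c * ε ^ (-β) * ∫ x, u x ^ 2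

theorem IsTest.add {f g : Rn n → ℝ} (hf : IsTest f) (hg : IsTest g) :
    IsTest fun x => f x + g x := ⟨hf.1.add hg.1, hf.2.add hg.2⟩

theorem IsTest.const_mul {f : Rn n → ℝ} (hf : IsTest f) (a : ℝ) :
    IsTest fun x => a * f x := ⟨contDiff_const.mul hf.1, hf.2.mul_left⟩

theorem IsTest.mul {f g : Rn n → ℝ} (hf : IsTest f) (hg : ContDiff ℝ ∞ g) :
    IsTest fun x => f x * g x := ⟨hf.1.mul hg, hf.2.mul_right⟩

theorem IsTest.integrable {f : Rn n → ℝ} (hf : IsTest f) : Integrable f :=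
  hf.continuous.integrable_of_hasCompactSupport hf.2

theorem IsTest.sq {f : Rn n → ℝ} (hf : IsTest f) : IsTest fun x => f x ^ 2 := by
  simpa only [pow_two] using hf.mul hf.1

theorem pd_add {f g : Rn n → ℝ} (hf : ContDiff ℝ 1 f) (hg : ContDiff ℝ 1 g) (i : Fin n)
    (x : Rn n) : pd i (fun x => f x + g x) x = pd i f x + pd i g x := by
  have := fderiv_fun_add (hf.differentiable (by simp)).differentiableAt
    (hg.differentiable (by simp)).differentiableAt (x := x) (𝕜 := ℝ)
  simp [pd, this]

theorem pd_const_mul {f : Rn n → ℝ} (hf : ContDiff ℝ 1 f) (a : ℝ) (i : Fin n)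
    (x : Rn n) : pd i (fun x => a * f x) x = a * pd i f x := by
  have := fderiv_const_mul (hf.differentiable (by simp)).differentiableAt (x := x) (𝕜 := ℝ) a
  simp [pd, this]

theorem IsTest.integrable_sum_sq {u : Rn n → ℝ} (hu : IsTest u) :
    Integrable fun x => ∑ i : Fin n, FormSubordination.pd i u x ^ 2 :=
  integrable_finsetSum _ fun i _ => (hu.pd i).sq.integrable

/-- Polarisation, `4uv = (u + v)² - (u - v)²`, together with the parallelogram identity for the
Dirichlet integral and for the `L²` norm. -/
theorem FormBdd.polar {β ε₀ c : ℝ} {L : (Rn n → ℝ) → ℂ} (hL : FormBdd β ε₀ c L) {ε : ℝ}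
    (hε : 0 < ε) (hε₀ : ε < ε₀) {u v : Rn n → ℝ} (hu : IsTest u) (hv : IsTest v) :
    ‖L (fun x => u x * v x)‖ ≤ (1 / 2) * ((ε * dirichlet u + c * ε ^ (-β) * ∫ x, u x ^ 2) +
      (ε * dirichlet v + c * ε ^ (-β) * ∫ x, v x ^ 2)) := by
  have hm : IsTest fun x => -1 * v x := hv.const_mul (-1)
  have h1 := hL.bound ε hε hε₀ _ (hu.add hv)
  have h2 := hL.bound ε hε hε₀ _ (hu.add hm)
  have huv : IsTest fun x => u x * v x := hu.mul hv.1
  have e1 : L (fun x => (u x + v x) ^ 2) = L (fun x => (u x + -1 * v x) ^ 2) +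
      (4 : ℝ) * L (fun x => u x * v x) := by
    rw [← hL.map_mul 4 _ huv, ← hL.map_add _ _ (hu.add hm).sq (huv.const_mul 4)]
    congr 1
    funext x
    ring
  have e2 : L (fun x => u x * v x) =
      (1 / 4) * (L (fun x => (u x + v x) ^ 2) - L (fun x => (u x + -1 * v x) ^ 2)) := by
    rw [e1]; push_cast; ring
  have d1 : dirichlet (fun x => u x + v x) + dirichlet (fun x => u x + -1 * v x) =
      2 * dirichlet u + 2 * dirichlet v := by
    unfold dirichlet
    rw [← integral_add (hu.add hv).integrable_sum_sq (hu.add hm).integrable_sum_sq,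
      ← integral_const_mul, ← integral_const_mul, ← integral_add
      (hu.integrable_sum_sq.const_mul 2) (hv.integrable_sum_sq.const_mul 2)]
    refine integral_congr_ae (Eventually.of_forall fun x => ?_)
    simp only
    rw [Finset.mul_sum, Finset.mul_sum, ← Finset.sum_add_distrib, ← Finset.sum_add_distrib]
    refine Finset.sum_congr rfl fun i _ => ?_
    rw [pd_add hu.contDiff_one hv.contDiff_one, pd_add hu.contDiff_one hm.contDiff_one,
      pd_const_mul hv.contDiff_one]
    ring
  have d2 : (∫ x, (u x + v x) ^ 2) + ∫ x, (u x + -1 * v x) ^ 2 =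
      2 * (∫ x, u x ^ 2) + 2 * ∫ x, v x ^ 2 := by
    rw [← integral_add (hu.add hv).sq.integrable (hu.add hm).sq.integrable,
      ← integral_const_mul, ← integral_const_mul, ← integral_add
      (hu.sq.integrable.const_mul 2) (hv.sq.integrable.const_mul 2)]
    refine integral_congr_ae (Eventually.of_forall fun x => ?_)
    simp only
    ring
  rw [e2, norm_mul]
  have h3 := norm_sub_le (L (fun x => (u x + v x) ^ 2)) (L (fun x => (u x + -1 * v x) ^ 2))
  have h4 : ‖(1 / 4 : ℂ)‖ = 1 / 4 := by norm_num
  rw [h4]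
  have h5 : (ε * dirichlet (fun x => u x + v x) + c * ε ^ (-β) * ∫ x, (u x + v x) ^ 2) +
      (ε * dirichlet (fun x => u x + -1 * v x) + c * ε ^ (-β) * ∫ x, (u x + -1 * v x) ^ 2) =
      ε * (2 * dirichlet u + 2 * dirichlet v) +
        c * ε ^ (-β) * (2 * (∫ x, u x ^ 2) + 2 * ∫ x, v x ^ 2) := by
    rw [← d1, ← d2]; ring
  linarith

theorem dirichlet_const_mul {u : Rn n → ℝ} (hu : ContDiff ℝ 1 u) (a : ℝ) :
    dirichlet (fun x => a * u x) = a ^ 2 * dirichlet u := by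
  unfold dirichlet
  rw [← integral_const_mul]
  refine integral_congr_ae (Eventually.of_forall fun x => ?_)
  simp only [pd_const_mul hu, mul_pow, Finset.mul_sum]

/-- Replace `u`, `v` by `√k u`, `v / √k`, which leaves the product unchanged. -/
theorem FormBdd.polar_weighted {β ε₀ c : ℝ} {L : (Rn n → ℝ) → ℂ} (hL : FormBdd β ε₀ c L) {ε : ℝ}
    (hε : 0 < ε) (hε₀ : ε < ε₀) {u v : Rn n → ℝ} (hu : IsTest u) (hv : IsTest v) {k : ℝ}
    (hk : 0 < k) :
    ‖L (fun x => u x * v x)‖ ≤ (1 / 2) * (k * (ε * dirichlet u + c * ε ^ (-β) * ∫ x, u x ^ 2) +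
      k⁻¹ * (ε * dirichlet v + c * ε ^ (-β) * ∫ x, v x ^ 2)) := by
  have h := hL.polar hε hε₀ (hu.const_mul √k) (hv.const_mul (√k)⁻¹)
  have hs : √k ≠ 0 := (Real.sqrt_pos.2 hk).ne'
  have e : (fun x => √k * u x * ((√k)⁻¹ * v x)) = fun x => u x * v x := by
    funext x; field_simp
  rw [e, dirichlet_const_mul hu.contDiff_one, dirichlet_const_mul hv.contDiff_one] at h
  simp only [mul_pow, integral_const_mul, inv_pow, Real.sq_sqrt hk.le] at h
  refine h.trans (le_of_eq ?_)
  ring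

end FormSubordination

end

noncomputable section

namespace FormSubordination

open Metric Filter Topology
open scoped ENNReal Convolution

variable {n : ℕ}

/-! ### Scaling -/

theorem IsTest.comp_scale {ψ : Rn n → ℝ} (hψ : IsTest ψ) {s : ℝ} (hs : 0 < s) (x : Rn n) :
    IsTest fun y => ψ (s⁻¹ • (x - y)) := by
  refine ⟨hψ.1.comp (by fun_prop), ?_⟩
  have h := hψ.2.comp_homeomorph
    ((Homeomorph.subLeft x).trans (Homeomorph.smulOfNeZero s⁻¹ (inv_ne_zero hs.ne')))
  exact h

theorem IsTest.dil_sub {ψ : Rn n → ℝ} (hψ : IsTest ψ) {s : ℝ} (hs : 0 < s) (x : Rn n) :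
    IsTest fun y => dil s ψ (x - y) := (hψ.comp_scale hs x).const_mul _

theorem pd_comp_scale {ψ : Rn n → ℝ} (hψ : ContDiff ℝ 1 ψ) (s : ℝ) (x y : Rn n)
    (i : Fin n) : pd i (fun y => ψ (s⁻¹ • (x - y))) y = -(s⁻¹ * pd i ψ (s⁻¹ • (x - y))) := by
  have h1 : HasFDerivAt ψ (fderiv ℝ ψ (s⁻¹ • (x - y))) (s⁻¹ • (x - y)) :=
    (hψ.differentiable (by simp)).differentiableAt.hasFDerivAt
  have h2 : HasFDerivAt (fun y : Rn n => s⁻¹ • (x - y)) (s⁻¹ • (-ContinuousLinearMap.id ℝ (Rn n))) y :=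
    ((hasFDerivAt_id y).const_sub x).const_smul s⁻¹
  have h3 := (h1.comp y h2).fderiv
  rw [pd, show (fun y => ψ (s⁻¹ • (x - y))) = ψ ∘ fun y : Rn n => s⁻¹ • (x - y) from rfl, h3]
  simp [pd]

theorem integral_comp_scale (f : Rn n → ℝ) {s : ℝ} (hs : 0 < s) (x : Rn n) :
    ∫ y, f (s⁻¹ • (x - y)) = s ^ n * ∫ y, f y := by
  rw [integral_sub_left_eq_self (fun y => f (s⁻¹ • y)) volume x,
    Measure.integral_comp_inv_smul, finrank_euclideanSpace, Fintype.card_fin,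
    abs_of_pos (by positivity), smul_eq_mul]

theorem dirichlet_comp_scale {ψ : Rn n → ℝ} (hψ : ContDiff ℝ 1 ψ) {s : ℝ} (hs : 0 < s)
    (x : Rn n) : dirichlet (fun y => ψ (s⁻¹ • (x - y))) = s ^ n * (s⁻¹ ^ 2 * dirichlet ψ) := by
  unfold dirichlet
  rw [← integral_const_mul, ← integral_comp_scale _ hs x]
  refine integral_congr_ae (Eventually.of_forall fun y => ?_)
  simp only [pd_comp_scale hψ, Finset.mul_sum]
  refine Finset.sum_congr rfl fun i _ => ?_
  ring

theorem dirichlet_nonneg (u : Rn n → ℝ) : 0 ≤ dirichlet u :=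
  integral_nonneg fun _ => Finset.sum_nonneg fun _ _ => sq_nonneg _

/-- Writing `ψ = ψ χ` as a product of test functions lets the polarised form inequality bound the
linear functional on `ψ` itself. -/
theorem IsTest.exists_cutoff {ψ : Rn n → ℝ} (hψ : IsTest ψ) :
    ∃ χ : Rn n → ℝ, IsTest χ ∧ ∀ x, ψ x * χ x = ψ x := by
  obtain ⟨R, hR⟩ := hψ.2.isBounded.subset_closedBall (0 : Rn n)
  let b : ContDiffBump (0 : Rn n) := ⟨max R 1, max R 1 + 1, by positivity, by linarith⟩
  refine ⟨b, ⟨b.contDiff, b.hasCompactSupport⟩, fun x => ?_⟩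
  by_cases hx : x ∈ tsupport ψ
  · rw [b.one_of_mem_closedBall (closedBall_subset_closedBall (le_max_left _ _) (hR hx)), mul_one]
  · rw [image_eq_zero_of_notMem_tsupport hx, zero_mul]

/-- The choice of the parameter in the subordination inequality at scale `s`. -/
theorem exists_scale_parameter {β ε₀ : ℝ} (hβ : 0 < β) (hε₀ : 0 < ε₀) :
    ∃ κ > 0, ∀ s : ℝ, 0 < s → s ≤ 1 → 0 < κ * s ^ (2 / (β + 1)) ∧ κ * s ^ (2 / (β + 1)) < ε₀ := by
  refine ⟨ε₀ / 2, by positivity, fun s hs hs1 => ⟨by positivity, ?_⟩⟩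
  have : s ^ (2 / (β + 1)) ≤ 1 := Real.rpow_le_one hs.le hs1 (by positivity)
  nlinarith

/-- For `ε = κ s^(2/(β+1))` the gradient term, which scales like `ε s⁻²`, and the term `ε^(-β)` have
the same order `s^(-2β/(β+1))`. The constant does not depend on `L`, so it survives mollification.
-/
theorem exists_scaling_bound {β ε₀ : ℝ} (hβ : 0 < β) (hε₀ : 0 < ε₀) {c : ℝ} (hc : 0 < c)
    {ψ : Rn n → ℝ} (hψ : IsTest ψ) : ∃ C, 0 ≤ C ∧ ∀ L, FormBdd β ε₀ c L → ∀ (x : Rn n) (s : ℝ),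
      0 < s → s ≤ 1 → ‖L (fun y => dil s ψ (x - y))‖ ≤ C * s ^ (-(2 * β / (β + 1))) := by
  obtain ⟨χ, hχ, hψχ⟩ := hψ.exists_cutoff
  obtain ⟨κ, hκ, hκs⟩ := exists_scale_parameter hβ hε₀
  refine ⟨(1 / 2) * ((κ * dirichlet ψ + c * κ ^ (-β) * ∫ x, ψ x ^ 2) +
      (κ * dirichlet χ + c * κ ^ (-β) * ∫ x, χ x ^ 2)), ?_, fun L hL x s hs hs1 => ?_⟩
  · have h1 := dirichlet_nonneg ψ
    have h2 := dirichlet_nonneg χ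
    have h3 : 0 ≤ ∫ x, ψ x ^ 2 := integral_nonneg fun _ => sq_nonneg _
    have h4 : 0 ≤ ∫ x, χ x ^ 2 := integral_nonneg fun _ => sq_nonneg _
    positivity
  · have h := hL.polar (hκs s hs hs1).1 (hκs s hs hs1).2 (hψ.comp_scale hs x) (hχ.comp_scale hs x)
    rw [dirichlet_comp_scale hψ.contDiff_one hs, dirichlet_comp_scale hχ.contDiff_one hs,
      integral_comp_scale (fun y => ψ y ^ 2) hs, integral_comp_scale (fun y => χ y ^ 2) hs] at h
    simp only [hψχ] at h
    have e : L (fun y => dil s ψ (x - y)) =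
        ((s ^ n)⁻¹ : ℝ) * L (fun y => ψ (s⁻¹ • (x - y))) := by
      rw [← hL.map_mul _ _ (hψ.comp_scale hs x)]; rfl
    rw [e, norm_mul, Complex.norm_real, Real.norm_of_nonneg (by positivity)]
    refine (mul_le_mul_of_nonneg_left h (by positivity)).trans (le_of_eq ?_)
    have e1 : s ^ (2 / (β + 1)) * s⁻¹ ^ 2 = s ^ (-(2 * β / (β + 1))) := by
      have : s⁻¹ ^ 2 = s ^ (-2 : ℝ) := by
        rw [Real.rpow_neg hs.le, inv_pow]; norm_cast
      rw [this, ← Real.rpow_add hs]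
      congr 1
      field_simp
      ring
    have e2 : (κ * s ^ (2 / (β + 1))) ^ (-β) = κ ^ (-β) * s ^ (-(2 * β / (β + 1))) := by
      rw [Real.mul_rpow hκ.le (by positivity), ← Real.rpow_mul hs.le]
      congr 2
      field_simp
    rw [e2, ← e1]
    field_simp

/-! ### A priori estimates -/

/-- The functional `f ↦ ∫ q f`. -/
def pairing (q : Rn n → ℝ) (f : Rn n → ℝ) : ℂ := ((∫ x, q x * f x : ℝ) : ℂ)

theorem pairing_dil (q ψ : Rn n → ℝ) (x : Rn n) {s : ℝ} (hs : 0 < s) :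
    pairing q (fun y => dil s ψ (x - y)) = (av ψ s q x : ℝ) := by
  rw [pairing, av_eq_integral_dil_sub ψ hs]
  simp only [smul_eq_mul, mul_comm]

theorem abs_av_le {ψ : Rn n → ℝ} (hψ : IsTest ψ) {v : Rn n → ℝ} {M : ℝ}
    (hM : ∀ x, |v x| ≤ M) (s : ℝ) (x : Rn n) : |av ψ s v x| ≤ (∫ z, |ψ z|) * M := by
  rw [← integral_mul_const, ← Real.norm_eq_abs, av]
  refine norm_integral_le_of_norm_le (hψ.integrable.abs.mul_const M)
    (Eventually.of_forall fun z => ?_)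
  rw [smul_eq_mul, norm_mul]
  exact mul_le_mul_of_nonneg_left (hM _) (norm_nonneg _)

theorem pd_comm {f : Rn n → ℝ} (hf : ContDiff ℝ ∞ f) (i j : Fin n) :
    pd i (pd j f) = pd j (pd i f) := by
  have key : ∀ (i j : Fin n) (x : Rn n),
      pd i (pd j f) x = fderiv ℝ (fderiv ℝ f) x (basisVec i) (basisVec j) := by
    intro i j x
    have hd : DifferentiableAt ℝ (fderiv ℝ f) x :=
      ((hf.fderiv_right (m := ∞) (by simp)).differentiable (by simp)).differentiableAt
    have := hd.hasFDerivAt.clm_apply (hasFDerivAt_const (basisVec j : Rn n) x)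
    rw [pd, show pd j f = fun y => fderiv ℝ f y (basisVec j) from rfl, this.fderiv]
    simp
  funext x
  rw [key, key]
  exact (hf.contDiffAt (x := x)).isSymmSndFDerivAt
    (by simpa using (WithTop.coe_le_coe.2 le_top : ((2 : ℕ∞) : WithTop ℕ∞) ≤ (∞ : WithTop ℕ∞))) _ _

theorem pd_sum {ι : Type*} (t : Finset ι) {f : ι → Rn n → ℝ} (hf : ∀ k ∈ t, ContDiff ℝ 1 (f k))
    (i : Fin n) : pd i (fun x => ∑ k ∈ t, f k x) = fun x => ∑ k ∈ t, pd i (f k) x := by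
  funext x
  rw [pd, fderiv_fun_sum fun k hk => ((hf k hk).differentiable (by simp)).differentiableAt]
  simp [pd]

theorem lap_pd {f : Rn n → ℝ} (hf : ContDiff ℝ ∞ f) (i : Fin n) : lap (pd i f) = pd i (lap f) := by
  unfold lap
  rw [pd_sum _ fun k _ => (contDiff_pd (contDiff_pd hf k) k).of_le (by simp)]
  funext x
  refine Finset.sum_congr rfl fun k _ => ?_
  rw [pd_comm (contDiff_pd hf k) i k, pd_comm hf i k]

/-- A bounded smooth function `v` for which the form of `v - Δv` is bounded. -/
structure Admissible (β ε₀ c M : ℝ) (v : Rn n → ℝ) : Prop where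
  contDiff : ContDiff ℝ ∞ v
  bound : ∀ x, |v x| ≤ M
  form : FormBdd β ε₀ c (pairing fun x => v x - lap v x)

section Apriori

variable {β ε₀ c M : ℝ}

/-- Write `Δv = v - (v - Δv)`: the second part is controlled by the scaling bound, and the first is
bounded, hence harmless for `s ≤ 1`. -/
theorem exists_av_lap_bound (hβ : 0 < β) (hε₀ : 0 < ε₀) (hc : 0 < c) (hM : 0 ≤ M)
    {ψ : Rn n → ℝ} (hψ : IsTest ψ) : ∃ C, 0 ≤ C ∧ ∀ v, Admissible β ε₀ c M v →
      ∀ (x : Rn n) (s : ℝ), 0 < s → s ≤ 1 →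
        |av ψ s (lap v) x| ≤ C * s ^ (-(2 * β / (β + 1))) := by
  obtain ⟨C, hC, h⟩ := exists_scaling_bound hβ hε₀ hc hψ
  have hI : 0 ≤ ∫ z, |ψ z| := integral_nonneg fun _ => abs_nonneg _
  refine ⟨C + (∫ z, |ψ z|) * M, by positivity, fun v hv x s hs hs1 => ?_⟩
  have h1 := h _ hv.form x s hs hs1
  rw [pairing_dil _ _ _ hs, Complex.norm_real, Real.norm_eq_abs] at h1
  have h2 := abs_av_le hψ hv.bound s x
  have h3 : av ψ s (fun x => v x - lap v x) x = av ψ s v x - av ψ s (lap v) x := by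
    simp only [av, smul_sub]
    exact integral_sub (integrable_av hψ.continuous hψ.2 hv.contDiff.continuous s x)
      (integrable_av hψ.continuous hψ.2 (contDiff_lap hv.contDiff).continuous s x)
  have h4 : 1 ≤ s ^ (-(2 * β / (β + 1))) :=
    Real.one_le_rpow_of_pos_of_le_one_of_nonpos hs hs1 (by
      have : 0 ≤ 2 * β / (β + 1) := by positivity
      linarith)
  have h5 : (∫ z, |ψ z|) * M ≤ (∫ z, |ψ z|) * M * s ^ (-(2 * β / (β + 1))) :=
    le_mul_of_one_le_right (by positivity) h4
  rw [h3] at h1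
  have h6 := abs_sub_abs_le_abs_sub (av ψ s (lap v) x) (av ψ s v x)
  rw [abs_sub_comm] at h6
  rw [add_mul]
  linarith

variable {ρ σ : Rn n → ℝ}

/-- Integrate the flow from `0` to `r`. The integrand is `O(s ^ (1 - μ))` with `μ = 2β/(β+1) < 2`.
-/
theorem KernelPair.exists_sub_av_bound (hk : KernelPair ρ σ) (hβ : 0 < β) (hε₀ : 0 < ε₀)
    (hc : 0 < c) (hM : 0 ≤ M) : ∃ C, 0 ≤ C ∧ ∀ v, Admissible β ε₀ c M v →
      ∀ (x : Rn n) (r : ℝ), 0 < r → r ≤ 1 → |v x - av ρ r v x| ≤ C * r ^ (2 / (β + 1)) := by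
  obtain ⟨C, hC, h⟩ := exists_av_lap_bound hβ hε₀ hc hM hk.testσ
  set μ := 2 * β / (β + 1) with hμ
  have hμ2 : 2 - μ = 2 / (β + 1) := by rw [hμ]; field_simp; ring
  have hpos : 0 < 2 / (β + 1) := by positivity
  refine ⟨C / (2 / (β + 1)), by positivity, fun v hv x r hr hr1 => ?_⟩
  have h1 := hk.av_sub_av hv.contDiff x 0 r
  rw [hk.av_zero] at h1
  rw [abs_sub_comm, h1]
  have h2 : ∀ s ∈ Set.Ioc 0 r, ‖s • av σ s (lap v) x‖ ≤ C * s ^ (1 - μ) := by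
    intro s hs
    have h3 := h v hv x s hs.1 (hs.2.trans hr1)
    rw [smul_eq_mul, norm_mul, Real.norm_of_nonneg hs.1.le, Real.norm_eq_abs]
    refine (mul_le_mul_of_nonneg_left h3 hs.1.le).trans (le_of_eq ?_)
    rw [sub_eq_add_neg, Real.rpow_add hs.1, Real.rpow_one]
    ring
  have h3 := intervalIntegral.norm_integral_le_of_norm_le hr.le
    (Eventually.of_forall h2) (g := fun s => C * s ^ (1 - μ))
    ((intervalIntegral.intervalIntegrable_rpow' (by linarith)).const_mul C)
  rw [Real.norm_eq_abs, intervalIntegral.integral_const_mul,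
    integral_rpow (Or.inl (by linarith))] at h3
  refine h3.trans (le_of_eq ?_)
  have e : 1 - μ + 1 = 2 / (β + 1) := by linarith
  rw [e, Real.zero_rpow hpos.ne', sub_zero]
  ring

/-- Integrate the flow for the second derivatives from `r` to `1`. Moving both derivatives to the
kernel costs `s⁻²`, so the integrand is `O(s ^ (-1 - μ))` and the integral `O(r ^ (-μ))`; at scale
`1` the bound on `v` is enough. -/
theorem KernelPair.exists_hessian_bound (hk : KernelPair ρ σ) (hβ : 0 < β) (hε₀ : 0 < ε₀)
    (hc : 0 < c) (hM : 0 ≤ M) (i j : Fin n) : ∃ C, 0 ≤ C ∧ ∀ v, Admissible β ε₀ c M v →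
      ∀ (x : Rn n) (r : ℝ), 0 < r → r ≤ 1 →
        |av ρ r (pd i (pd j v)) x| ≤ C * r ^ (-(2 * β / (β + 1))) := by
  obtain ⟨C, hC, h⟩ := exists_av_lap_bound hβ hε₀ hc hM ((hk.testσ.pd i).pd j)
  set μ := 2 * β / (β + 1) with hμ
  have hμ0 : 0 < μ := by positivity
  set I := ∫ z, |pd j (pd i ρ) z| with hI
  have hI0 : 0 ≤ I := integral_nonneg fun _ => abs_nonneg _
  -- Two derivatives are traded between the function and the kernel at the price `s²`.
  have two : ∀ {ψ w : Rn n → ℝ}, IsTest ψ → ContDiff ℝ ∞ w → ∀ (s : ℝ) (x : Rn n),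
      s * (s * av ψ s (pd i (pd j w)) x) = av (pd j (pd i ψ)) s w x := by
    intro ψ w hψ hw s x
    have h1 := smul_av_pd hψ.contDiff_one hψ.2 ((contDiff_pd hw j).of_le (by simp)) s i x
    have h2 := smul_av_pd (hψ.pd i).contDiff_one (hψ.pd i).2 (hw.of_le (by simp)) s j x
    simp only [smul_eq_mul] at h1 h2
    rw [h1, h2]
  refine ⟨I * M + C / μ, by positivity, fun v hv x r hr hr1 => ?_⟩
  have hvij : ContDiff ℝ ∞ (pd i (pd j v)) := contDiff_pd (contDiff_pd hv.contDiff j) i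
  have h1 := hk.av_sub_av hvij x r 1
  have h2 : |av ρ 1 (pd i (pd j v)) x| ≤ I * M := by
    have := two hk.testρ hv.contDiff 1 x
    rw [one_mul, one_mul] at this
    rw [this]
    exact abs_av_le ((hk.testρ.pd i).pd j) hv.bound 1 x
  have hlap : lap (pd i (pd j v)) = pd i (pd j (lap v)) := by
    rw [lap_pd (contDiff_pd hv.contDiff j), lap_pd hv.contDiff]
  have h3 : ∀ s ∈ Set.Ioc r 1, ‖s • av σ s (lap (pd i (pd j v))) x‖ ≤ C * s ^ (-1 - μ) := by
    intro s hs
    have hs0 : 0 < s := hr.trans hs.1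
    have h4 := h v hv x s hs0 hs.2
    rw [← two hk.testσ (contDiff_lap hv.contDiff), ← hlap, abs_mul, abs_of_pos hs0] at h4
    rw [smul_eq_mul, Real.norm_eq_abs]
    rw [sub_eq_add_neg, Real.rpow_add hs0, Real.rpow_neg_one]
    calc |s * av σ s (lap (pd i (pd j v))) x|
        = s⁻¹ * (s * |s * av σ s (lap (pd i (pd j v))) x|) := by field_simp
      _ ≤ s⁻¹ * (C * s ^ (-μ)) := mul_le_mul_of_nonneg_left h4 (by positivity)
      _ = _ := by ring
  have hz : (0 : ℝ) ∉ Set.uIcc r 1 := by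
    rw [Set.uIcc_of_le hr1]; exact fun h => absurd h.1 (not_le.2 hr)
  have h5 := intervalIntegral.norm_integral_le_of_norm_le hr1
    (Eventually.of_forall h3) (g := fun s => C * s ^ (-1 - μ))
    ((intervalIntegral.intervalIntegrable_rpow (μ := volume) (Or.inr hz)).const_mul C)
  rw [← h1, Real.norm_eq_abs, intervalIntegral.integral_const_mul,
    integral_rpow (Or.inr ⟨by linarith, hz⟩)] at h5
  have e : -1 - μ + 1 = -μ := by ring
  rw [e, Real.one_rpow] at h5
  have h6 : 1 ≤ r ^ (-μ) :=
    Real.one_le_rpow_of_pos_of_le_one_of_nonpos hr hr1 (by linarith)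
  have h7 : C * ((1 - r ^ (-μ)) / -μ) ≤ C / μ * r ^ (-μ) := by
    have : C * ((1 - r ^ (-μ)) / -μ) = C / μ * r ^ (-μ) - C / μ := by field_simp; ring
    rw [this]
    have : 0 ≤ C / μ := by positivity
    linarith
  have h8 : I * M ≤ I * M * r ^ (-μ) := le_mul_of_one_le_right (by positivity) h6
  have h9 := abs_sub_abs_le_abs_sub (av ρ r (pd i (pd j v)) x) (av ρ 1 (pd i (pd j v)) x)
  rw [abs_sub_comm] at h9
  rw [add_mul]
  linarith

end Apriori

end FormSubordination

end

noncomputable section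

namespace FormSubordination

open Metric Filter Topology
open scoped ENNReal Convolution

variable {n : ℕ}

/-! ### Taylor approximation and the Caccioppoli inequality -/

theorem norm_clm_le_sum (A : Rn n →L[ℝ] ℝ) : ‖A‖ ≤ ∑ i : Fin n, |A (basisVec i)| := by
  refine ContinuousLinearMap.opNorm_le_bound _ (Finset.sum_nonneg fun _ _ => abs_nonneg _)
    fun v => ?_
  have hv : v = ∑ i : Fin n, v i • (basisVec i : Rn n) := by
    have := (EuclideanSpace.basisFun (Fin n) ℝ).sum_repr v
    simpa [basisVec] using this.symm
  have h1 : A v = ∑ i : Fin n, v i * A (basisVec i) := by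
    conv_lhs => rw [hv]
    simp [map_sum]
  rw [h1, Finset.sum_mul]
  refine (norm_sum_le _ _).trans (Finset.sum_le_sum fun i _ => ?_)
  rw [norm_mul, mul_comm]
  exact mul_le_mul_of_nonneg_left (PiLp.norm_apply_le v i) (abs_nonneg _)

theorem abs_sub_taylor_le {w : Rn n → ℝ} (hw : ContDiff ℝ ∞ w) {H : ℝ}
    (hH : ∀ i j x, |pd i (pd j w) x| ≤ H) (x y : Rn n) :
    |w y - w x - fderiv ℝ w x (y - x)| ≤ n * (n * H) * ‖y - x‖ ^ 2 := by
  have h1 : ∀ j (z : Rn n), |pd j w z - pd j w x| ≤ n * H * ‖z - x‖ := by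
    intro j z
    have hd : Differentiable ℝ (pd j w) := (contDiff_pd hw j).differentiable (by simp)
    refine Convex.norm_image_sub_le_of_norm_fderiv_le (𝕜 := ℝ) (s := Set.univ)
      (fun p _ => hd p) (fun p _ => ?_) convex_univ (Set.mem_univ _) (Set.mem_univ _)
    refine (norm_clm_le_sum _).trans ?_
    refine (Finset.sum_le_sum fun i _ => hH i j p).trans (le_of_eq ?_)
    simp
  have h2 : ∀ z : Rn n, ‖fderiv ℝ w z - fderiv ℝ w x‖ ≤ n * (n * H) * ‖z - x‖ := by
    intro z
    refine (norm_clm_le_sum _).trans ?_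
    refine (Finset.sum_le_sum fun j _ => h1 j z).trans (le_of_eq ?_)
    simp
    ring
  have hH0 : 0 ≤ (n : ℝ) * (n * H) := by
    rcases Nat.eq_zero_or_pos n with hn | hn
    · simp [hn]
    · have := (abs_nonneg _).trans (hH ⟨0, hn⟩ ⟨0, hn⟩ x)
      positivity
  have h3 := Convex.norm_image_sub_le_of_norm_fderiv_le' (𝕜 := ℝ) (f := w) (φ := fderiv ℝ w x)
    (s := closedBall x ‖y - x‖) (C := n * (n * H) * ‖y - x‖) (x := x) (y := y)
    (fun p _ => (hw.differentiable (by simp)).differentiableAt)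
    (fun p hp => (h2 p).trans (mul_le_mul_of_nonneg_left
      (by rwa [mem_closedBall, dist_eq_norm] at hp) hH0))
    (convex_closedBall _ _) (by simp) (by simp [dist_eq_norm])
  rw [Real.norm_eq_abs] at h3
  refine h3.trans (le_of_eq (by ring))

theorem pd_mul {f g : Rn n → ℝ} (hf : ContDiff ℝ 1 f) (hg : ContDiff ℝ 1 g) (i : Fin n)
    (x : Rn n) : pd i (fun x => f x * g x) x = pd i f x * g x + f x * pd i g x := by
  have := fderiv_fun_mul (hf.differentiable (by simp)).differentiableAt
    (hg.differentiable (by simp)).differentiableAt (x := x) (𝕜 := ℝ)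
  simp [pd, this]
  ring

/-- Pointwise `|∇(ηh)|² = |∇η|² h² + ∇(η² h) · ∇h`; the last term is integrated by parts. -/
theorem dirichlet_mul {h η : Rn n → ℝ} (hh : ContDiff ℝ ∞ h) (hη : IsTest η) :
    dirichlet (fun x => η x * h x) =
      (∫ x, ∑ i : Fin n, pd i η x ^ 2 * h x ^ 2) - ∫ x, η x * h x * η x * lap h x := by
  have hh1 : ContDiff ℝ 1 h := hh.of_le (by simp)
  have ht : IsTest fun x => η x * h x * η x := (hη.mul hh).mul hη.1
  have hti : ∀ i : Fin n, ∀ x, pd i (fun x => η x * h x * η x) x =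
      (pd i η x * h x + η x * pd i h x) * η x + η x * h x * pd i η x := fun i x => by
    rw [pd_mul (hη.mul hh).contDiff_one hη.contDiff_one, pd_mul hη.contDiff_one hh1]
  have i1 : ∀ i : Fin n, Integrable fun x => pd i η x ^ 2 * h x ^ 2 := fun i =>
    ((hη.pd i).sq.mul (hh.pow 2)).integrable
  have i2 : ∀ i : Fin n, Integrable fun x => pd i (fun x => η x * h x * η x) x * pd i h x :=
    fun i => ((ht.pd i).mul (contDiff_pd hh i)).integrable
  have i3 : ∀ i : Fin n, Integrable fun x => η x * h x * η x * pd i (pd i h) x :=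
    fun i => (ht.mul (contDiff_pd (contDiff_pd hh i) i)).integrable
  have e1 : ∫ x, η x * h x * η x * lap h x =
      -∫ x, ∑ i : Fin n, pd i (fun x => η x * h x * η x) x * pd i h x := by
    simp only [lap, Finset.mul_sum]
    rw [integral_finsetSum _ fun i _ => i3 i, integral_finsetSum _ fun i _ => i2 i,
      ← Finset.sum_neg_distrib]
    exact Finset.sum_congr rfl fun i _ =>
      integral_smul_pd_left ht.contDiff_one ht.2 ((contDiff_pd hh i).of_le (by simp)) i
  rw [e1, sub_neg_eq_add, ← integral_add (integrable_finsetSum _ fun i _ => i1 i)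
    (integrable_finsetSum _ fun i _ => i2 i), dirichlet]
  refine integral_congr_ae (Eventually.of_forall fun x => ?_)
  simp only
  rw [← Finset.sum_add_distrib]
  refine Finset.sum_congr rfl fun i _ => ?_
  rw [hti, pd_mul hη.contDiff_one hh1]
  ring

section Apriori

variable {β ε₀ c M : ℝ}

/-- A Caccioppoli inequality. In the identity for the Dirichlet integral of `ηh`, the term `∫ η² h
Δv` is a value of the form on the product `(ηh) · η`, up to the bounded contribution of `v`. -/
theorem Admissible.dirichlet_mul_le {v h η : Rn n → ℝ} (hc : 0 < c) (hv : Admissible β ε₀ c M v)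
    (hh : ContDiff ℝ ∞ h) (hlap : lap h = lap v) (hη : IsTest η) {A : ℝ}
    (hA : ∀ x ∈ tsupport η, |h x| ≤ A) {ε : ℝ} (hε : 0 < ε) (hε₀ : ε < ε₀) :
    dirichlet (fun x => η x * h x) ≤ 2 * A ^ 2 * dirichlet η +
      c * (ε⁻¹ * ε ^ (-β)) * A ^ 2 * (∫ x, η x ^ 2) + ε ^ 2 * dirichlet η +
      c * (ε * ε ^ (-β)) * (∫ x, η x ^ 2) + 2 * M * A * ∫ x, η x ^ 2 := by
  have hηh : IsTest fun x => η x * h x := hη.mul hh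
  -- The weight `ε⁻¹` makes the Dirichlet integral of `ηh` appear with coefficient `1 / 2`, so that
  -- it can be absorbed on the left.
  have h1 := hv.form.polar_weighted hε hε₀ hηh hη (inv_pos.2 hε)
  rw [pairing, Complex.norm_real, Real.norm_eq_abs, inv_inv] at h1
  have hsq : ∀ x ∈ tsupport η, h x ^ 2 ≤ A ^ 2 := fun x hx => by
    rw [← sq_abs]; exact pow_le_pow_left₀ (abs_nonneg _) (hA x hx) 2
  have hN : ∫ x, (η x * h x) ^ 2 ≤ A ^ 2 * ∫ x, η x ^ 2 := by
    rw [← integral_const_mul]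
    refine integral_mono hηh.sq.integrable (hη.sq.integrable.const_mul _) fun x => ?_
    by_cases hx : x ∈ tsupport η
    · simp only [mul_pow]
      rw [mul_comm]
      exact mul_le_mul_of_nonneg_right (hsq x hx) (sq_nonneg _)
    · simp [image_eq_zero_of_notMem_tsupport hx]
  have hG : (∫ x, ∑ i : Fin n, pd i η x ^ 2 * h x ^ 2) ≤ A ^ 2 * dirichlet η := by
    rw [dirichlet, ← integral_const_mul]
    refine integral_mono (integrable_finsetSum _ fun i _ =>
      ((hη.pd i).sq.mul (hh.pow 2)).integrable) (hη.integrable_sum_sq.const_mul _) fun x => ?_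
    simp only [Finset.mul_sum]
    refine Finset.sum_le_sum fun i _ => ?_
    by_cases hx : x ∈ tsupport η
    · rw [mul_comm]
      exact mul_le_mul_of_nonneg_right (hsq x hx) (sq_nonneg _)
    · have : pd i η x = 0 := image_eq_zero_of_notMem_tsupport
        fun hh => hx (tsupport_fderiv_apply_subset ℝ _ hh)
      simp [this]
  have hV : |∫ x, η x * h x * η x * v x| ≤ M * A * ∫ x, η x ^ 2 := by
    rw [← integral_const_mul, ← Real.norm_eq_abs]
    refine norm_integral_le_of_norm_le (hη.sq.integrable.const_mul _)
      (Eventually.of_forall fun x => ?_)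
    by_cases hx : x ∈ tsupport η
    · have e : ‖η x * h x * η x * v x‖ = |v x| * |h x| * η x ^ 2 := by
        rw [Real.norm_eq_abs, abs_mul, abs_mul, abs_mul, ← sq_abs (η x)]; ring
      rw [e]
      exact mul_le_mul_of_nonneg_right (mul_le_mul (hv.bound x) (hA x hx) (abs_nonneg _)
        ((abs_nonneg _).trans (hv.bound x))) (sq_nonneg _)
    · simp [image_eq_zero_of_notMem_tsupport hx]
  have ht : IsTest fun x => η x * h x * η x := hηh.mul hη.1
  have hsplit : ∫ x, (v x - lap v x) * (η x * h x * η x) =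
      (∫ x, η x * h x * η x * v x) - ∫ x, η x * h x * η x * lap h x := by
    rw [← integral_sub (ht.mul hv.contDiff).integrable (ht.mul (contDiff_lap hh)).integrable, hlap]
    refine integral_congr_ae (Eventually.of_forall fun x => ?_)
    simp only
    ring
  have hD := dirichlet_mul hh hη
  rw [hsplit] at h1
  set D := dirichlet fun x => η x * h x
  set N := ∫ x, η x ^ 2
  have e1 : ε⁻¹ * (ε * D + c * ε ^ (-β) * ∫ x, (η x * h x) ^ 2) ≤
      D + c * (ε⁻¹ * ε ^ (-β)) * (A ^ 2 * N) := by
    rw [mul_add, ← mul_assoc, inv_mul_cancel₀ hε.ne', one_mul]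
    have : ε⁻¹ * (c * ε ^ (-β) * ∫ x, (η x * h x) ^ 2) =
      c * (ε⁻¹ * ε ^ (-β)) * ∫ x, (η x * h x) ^ 2 := by ring
    rw [this]
    exact add_le_add le_rfl (mul_le_mul_of_nonneg_left hN (by positivity))
  have h2 := (abs_le.1 h1).2
  have h3 := (abs_le.1 hV).1
  have e3 : ε * (ε * dirichlet η + c * ε ^ (-β) * N) =
    ε ^ 2 * dirichlet η + c * (ε * ε ^ (-β)) * N := by ring
  rw [e3] at h2
  linarith

/-- The energy of `h` on a ball is controlled by its supremum on a larger ball. -/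
theorem exists_energy_bound (hβ : 0 < β) (hε₀ : 0 < ε₀) (hc : 0 < c) (hM : 0 ≤ M) {K : ℝ}
    (hK : 0 ≤ K) :
    ∃ C, 0 ≤ C ∧ ∀ v, Admissible β ε₀ c M v → ∀ h : Rn n → ℝ, ContDiff ℝ ∞ h → lap h = lap v →
      ∀ (x₀ : Rn n) (δ : ℝ), 0 < δ → δ ≤ 1 →
        (∀ x ∈ closedBall x₀ (2 * δ), |h x| ≤ K * δ ^ (2 / (β + 1))) →
        ∫ x in ball x₀ δ, ∑ i : Fin n, pd i h x ^ 2 ≤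
          C * δ ^ ((n : ℝ) + 2 * ((1 - β) / (1 + β))) := by
  let b : ContDiffBump (0 : Rn n) := ⟨1, 2, by norm_num, by norm_num⟩
  have hb : IsTest (b : Rn n → ℝ) := ⟨b.contDiff, b.hasCompactSupport⟩
  obtain ⟨κ, hκ, hκs⟩ := exists_scale_parameter hβ hε₀
  have hD0 := dirichlet_nonneg (b : Rn n → ℝ)
  have hN0 : 0 ≤ ∫ x, (b : Rn n → ℝ) x ^ 2 := integral_nonneg fun _ => sq_nonneg _
  set D₀ := dirichlet (b : Rn n → ℝ)
  set N₀ := ∫ x, (b : Rn n → ℝ) x ^ 2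
  refine ⟨2 * K ^ 2 * D₀ + c * (κ⁻¹ * κ ^ (-β)) * K ^ 2 * N₀ + κ ^ 2 * D₀ +
    c * (κ * κ ^ (-β)) * N₀ + 2 * M * K * N₀, by positivity,
    fun v hv h hh hlap x₀ δ hδ hδ1 hA => ?_⟩
  have hη := hb.comp_scale hδ x₀
  have hδ' : 0 < δ⁻¹ := inv_pos.2 hδ
  have hsupp : tsupport (fun y => (b : Rn n → ℝ) (δ⁻¹ • (x₀ - y))) ⊆ closedBall x₀ (2 * δ) := by
    refine closure_minimal (fun y hy => ?_) isClosed_closedBall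
    have h1 : δ⁻¹ • (x₀ - y) ∈ ball (0 : Rn n) 2 := by
      have : δ⁻¹ • (x₀ - y) ∈ Function.support (b : Rn n → ℝ) := hy
      rwa [b.support_eq] at this
    rw [mem_ball_zero_iff, norm_smul, Real.norm_of_nonneg hδ'.le, inv_mul_lt_iff₀ hδ] at h1
    rw [mem_closedBall, dist_comm, dist_eq_norm]
    linarith
  have hone : ∀ y ∈ ball x₀ δ, (fun y => (b : Rn n → ℝ) (δ⁻¹ • (x₀ - y)) * h y) =ᶠ[𝓝 y] h := by
    intro y hy
    filter_upwards [isOpen_ball.mem_nhds hy] with z hz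
    have : (b : Rn n → ℝ) (δ⁻¹ • (x₀ - z)) = 1 := by
      refine b.one_of_mem_closedBall ?_
      rw [mem_closedBall_zero_iff, norm_smul, Real.norm_of_nonneg hδ'.le, inv_mul_le_iff₀ hδ]
      rw [mem_ball, dist_comm, dist_eq_norm] at hz
      show ‖x₀ - z‖ ≤ δ * 1
      linarith
    rw [this, one_mul]
  have hle : ∫ x in ball x₀ δ, ∑ i : Fin n, pd i h x ^ 2 ≤
      dirichlet fun y => (b : Rn n → ℝ) (δ⁻¹ • (x₀ - y)) * h y := by
    rw [dirichlet, setIntegral_congr_fun (g := fun x => ∑ i : Fin n,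
      pd i (fun y => (b : Rn n → ℝ) (δ⁻¹ • (x₀ - y)) * h y) x ^ 2) measurableSet_ball]
    · exact setIntegral_le_integral (hη.mul hh).integrable_sum_sq
        (Eventually.of_forall fun x => Finset.sum_nonneg fun _ _ => sq_nonneg _)
    · intro y hy
      refine Finset.sum_congr rfl fun i _ => ?_
      rw [pd, pd, (hone y hy).fderiv_eq]
  have key := hv.dirichlet_mul_le hc hh hlap hη (fun x hx => hA x (hsupp hx))
    (hκs δ hδ hδ1).1 (hκs δ hδ hδ1).2
  rw [dirichlet_comp_scale hb.contDiff_one hδ, integral_comp_scale (fun y => b y ^ 2) hδ] at key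
  refine (hle.trans key).trans ?_
  -- Both the supremum bound `K * θ` and the parameter `κ * θ` have size `θ`, so all terms are
  -- multiples of `δ^(n-2) θ²`. The exception is the zeroth order term `δ^n θ`, which is smaller
  -- because `δ⁻² θ ≥ 1`.
  set θ := δ ^ (2 / (β + 1)) with hθ
  have hθ0 : 0 < θ := by positivity
  have hb1 : β + 1 ≠ 0 := by positivity
  have hpow : δ ^ ((n : ℝ) + 2 * ((1 - β) / (1 + β))) = δ ^ n * (δ⁻¹ ^ 2 * θ ^ 2) := by
    have h1 : δ⁻¹ ^ 2 = δ ^ (-2 : ℝ) := by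
      rw [Real.rpow_neg hδ.le, inv_pow]; norm_cast
    have h2 : θ ^ 2 = δ ^ (2 / (β + 1) * 2) := by
      rw [hθ, Real.rpow_mul hδ.le]; norm_cast
    rw [h1, h2, ← Real.rpow_natCast, ← Real.rpow_add hδ, ← Real.rpow_add hδ]
    congr 1
    field_simp
    ring
  have hθβ : (κ * θ) ^ (-β) = κ ^ (-β) * (θ * δ⁻¹ ^ 2) := by
    have h1 : δ⁻¹ ^ 2 = δ ^ (-2 : ℝ) := by
      rw [Real.rpow_neg hδ.le, inv_pow]; norm_cast
    rw [Real.mul_rpow hκ.le hθ0.le, h1, hθ, ← Real.rpow_mul hδ.le, ← Real.rpow_add hδ]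
    congr 2
    field_simp
    ring
  have hlast : θ ≤ δ⁻¹ ^ 2 * θ ^ 2 := by
    have h1 : 1 ≤ δ⁻¹ ^ 2 * θ := by
      have h2 : δ⁻¹ ^ 2 * θ = δ ^ (-(2 * β / (β + 1))) := by
        have h1 : δ⁻¹ ^ 2 = δ ^ (-2 : ℝ) := by
          rw [Real.rpow_neg hδ.le, inv_pow]; norm_cast
        rw [h1, hθ, ← Real.rpow_add hδ]
        congr 1
        field_simp
        ring
      rw [h2]
      refine Real.one_le_rpow_of_pos_of_le_one_of_nonpos hδ hδ1 ?_
      have : 0 ≤ 2 * β / (β + 1) := by positivity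
      linarith
    nlinarith
  rw [hpow, hθβ]
  have e : ∀ X : ℝ, X = δ ^ n * (δ⁻¹ ^ 2 * θ ^ 2) →
      2 * (K * θ) ^ 2 * (δ ^ n * (δ⁻¹ ^ 2 * D₀)) +
      c * ((κ * θ)⁻¹ * (κ ^ (-β) * (θ * δ⁻¹ ^ 2))) * (K * θ) ^ 2 * (δ ^ n * N₀) +
      (κ * θ) ^ 2 * (δ ^ n * (δ⁻¹ ^ 2 * D₀)) +
      c * (κ * θ * (κ ^ (-β) * (θ * δ⁻¹ ^ 2))) * (δ ^ n * N₀) + 2 * M * (K * θ) * (δ ^ n * N₀) =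
      (2 * K ^ 2 * D₀ + c * (κ⁻¹ * κ ^ (-β)) * K ^ 2 * N₀ + κ ^ 2 * D₀ +
      c * (κ * κ ^ (-β)) * N₀) * X + 2 * M * K * N₀ * (δ ^ n * θ) := by
    intro X hX
    rw [hX, mul_inv]
    field_simp
  rw [e _ rfl]
  have hf : 2 * M * K * N₀ * (δ ^ n * θ) ≤ 2 * M * K * N₀ * (δ ^ n * (δ⁻¹ ^ 2 * θ ^ 2)) :=
    mul_le_mul_of_nonneg_left (mul_le_mul_of_nonneg_left hlast (by positivity)) (by positivity)
  linarith

variable {ρ σ : Rn n → ℝ}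

theorem lap_eq_of_sub_affine {v : Rn n → ℝ} (hv : ContDiff ℝ ∞ v) (a : ℝ) (A : Rn n →L[ℝ] ℝ)
    (x₀ : Rn n) : (∀ i x, pd i (fun x => v x - a - A (x - x₀)) x = pd i v x - A (basisVec i)) ∧
      lap (fun x => v x - a - A (x - x₀)) = lap v := by
  have h1 : ∀ i x, pd i (fun x => v x - a - A (x - x₀)) x = pd i v x - A (basisVec i) := by
    intro i x
    have hd : HasFDerivAt v (fderiv ℝ v x) x :=
      (hv.differentiable (by simp)).differentiableAt.hasFDerivAt
    have hA : HasFDerivAt (fun x => A (x - x₀)) A x :=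
      A.hasFDerivAt.comp x ((hasFDerivAt_id x).sub_const x₀)
    have hs : HasFDerivAt (fun x => v x - a - A (x - x₀)) (fderiv ℝ v x - A) x :=
      (hd.sub_const a).sub hA
    rw [pd, hs.fderiv]
    simp [pd]
  refine ⟨h1, ?_⟩
  funext x
  refine Finset.sum_congr rfl fun i _ => ?_
  have h2 : pd i (fun x => v x - a - A (x - x₀)) = fun x => pd i v x - A (basisVec i) :=
    funext (h1 i)
  rw [h2, pd, fderiv_sub_const]
  rfl

/-- Let `w = ρ_δ * v`. The error `v - w` and the Hessian bound for `w` show that `v` minus the first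
order Taylor polynomial of `w` at `x₀` is `O(δ^(2/(β+1)))` on the doubled ball; the energy bound
then applies with `b = ∇w(x₀)`. The crude bound on `b` serves to extract a limit later. -/
theorem KernelPair.exists_gradient_oscillation (hk : KernelPair ρ σ) (hβ : 0 < β) (hε₀ : 0 < ε₀)
    (hc : 0 < c) (hM : 0 ≤ M) : ∃ C, 0 ≤ C ∧ ∀ v, Admissible β ε₀ c M v →
      ∀ (x₀ : Rn n) (δ : ℝ), 0 < δ → δ ≤ 1 → ∃ b : Fin n → ℝ, (∀ i, |b i| ≤ C * δ⁻¹) ∧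
        ∫ x in ball x₀ δ, ∑ i : Fin n, (pd i v x - b i) ^ 2 ≤
          C * δ ^ ((n : ℝ) + 2 * ((1 - β) / (1 + β))) := by
  obtain ⟨C₁, hC₁, h₁⟩ := hk.exists_sub_av_bound hβ hε₀ hc hM
  choose C₂ hC₂ h₂ using fun i j => hk.exists_hessian_bound hβ hε₀ hc hM i j
  set H := ∑ i, ∑ j, C₂ i j with hH
  have hH0 : 0 ≤ H := Finset.sum_nonneg fun i _ => Finset.sum_nonneg fun j _ => hC₂ i j
  have hHij : ∀ i j, C₂ i j ≤ H := fun i j =>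
    (Finset.single_le_sum (fun j _ => hC₂ i j) (Finset.mem_univ j)).trans
      (Finset.single_le_sum (f := fun i => ∑ j, C₂ i j)
        (fun i _ => Finset.sum_nonneg fun j _ => hC₂ i j) (Finset.mem_univ i))
  -- `C₁` bounds `v - w`; the factor `4` is `(2δ)² / δ²` in the Taylor remainder.
  set K := C₁ + n * (n * H) * 4 with hK
  have hK0 : 0 ≤ K := by positivity
  obtain ⟨C₃, hC₃, h₃⟩ := exists_energy_bound (n := n) hβ hε₀ hc hM hK0
  set C₄ := ∑ i, (∫ z, |pd i ρ z|) * M with hC₄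
  have hC₄i : ∀ i, 0 ≤ (∫ z, |pd i ρ z|) * M := fun i =>
    mul_nonneg (integral_nonneg fun _ => abs_nonneg _) hM
  have hC₄0 : 0 ≤ C₄ := Finset.sum_nonneg fun i _ => hC₄i i
  refine ⟨C₃ + C₄, by positivity, fun v hv x₀ δ hδ hδ1 => ?_⟩
  have hv1 : ContDiff ℝ 1 v := hv.contDiff.of_le (by simp)
  have hρ := hk.testρ.continuous
  have hρc := hk.testρ.2
  set w := av ρ δ v with hw
  have hwc : ContDiff ℝ ∞ w := contDiff_av hρ hρc δ hv.contDiff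
  have hpw : ∀ i, pd i w = av ρ δ (pd i v) := fun i => pd_av hρ hρc hv1 δ i
  set A := fderiv ℝ w x₀ with hA
  refine ⟨fun i => pd i w x₀, fun i => ?_, ?_⟩
  · have h4 := smul_av_pd hk.testρ.contDiff_one hρc hv1 δ i x₀
    have h5 : pd i w x₀ = δ⁻¹ * av (pd i ρ) δ v x₀ := by
      rw [← h4, hpw, smul_eq_mul, inv_mul_cancel_left₀ hδ.ne']
    show |pd i w x₀| ≤ _
    rw [h5, abs_mul, abs_of_pos (inv_pos.2 hδ), mul_comm]
    refine mul_le_mul_of_nonneg_right ?_ (inv_pos.2 hδ).le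
    refine (abs_av_le (hk.testρ.pd i) hv.bound δ x₀).trans ?_
    refine (Finset.single_le_sum (fun i _ => hC₄i i) (Finset.mem_univ i)).trans ?_
    linarith
  · obtain ⟨hp, hl⟩ := lap_eq_of_sub_affine hv.contDiff (w x₀) A x₀
    have hh : ContDiff ℝ ∞ fun x => v x - w x₀ - A (x - x₀) :=
      (hv.contDiff.sub contDiff_const).sub (A.contDiff.comp (contDiff_id.sub contDiff_const))
    have h6 := h₃ v hv _ hh hl x₀ δ hδ hδ1 (fun x hx => ?_)
    · simp only [hp] at h6
      refine h6.trans (mul_le_mul_of_nonneg_right (by linarith) (by positivity))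
    · have h7 : ∀ i j x, |pd i (pd j w) x| ≤ H * δ ^ (-(2 * β / (β + 1))) := by
        intro i j x
        rw [hpw, pd_av hρ hρc ((contDiff_pd hv.contDiff j).of_le (by simp))]
        exact (h₂ i j v hv x δ hδ hδ1).trans
          (mul_le_mul_of_nonneg_right (hHij i j) (by positivity))
      have h8 := abs_sub_taylor_le hwc h7 x₀ x
      have h9 := h₁ v hv x δ hδ hδ1
      have h10 : ‖x - x₀‖ ^ 2 ≤ 4 * δ ^ 2 := by
        rw [mem_closedBall, dist_eq_norm] at hx
        calc ‖x - x₀‖ ^ 2 ≤ (2 * δ) ^ 2 := pow_le_pow_left₀ (norm_nonneg _) hx 2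
          _ = _ := by ring
      have h11 : δ ^ (-(2 * β / (β + 1))) * δ ^ 2 = δ ^ (2 / (β + 1)) := by
        rw [← Real.rpow_natCast δ 2, ← Real.rpow_add hδ]
        congr 1
        push_cast
        field_simp
        ring
      have h12 : n * (n * (H * δ ^ (-(2 * β / (β + 1))))) * ‖x - x₀‖ ^ 2 ≤
          n * (n * H) * 4 * δ ^ (2 / (β + 1)) := by
        rw [← h11]
        refine (mul_le_mul_of_nonneg_left h10 (by positivity)).trans (le_of_eq ?_)
        ring
      have h13 : v x - w x₀ - A (x - x₀) = (v x - w x) + (w x - w x₀ - A (x - x₀)) := by ring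
      rw [h13, hK, add_mul]
      exact (abs_add_le _ _).trans (add_le_add h9 (h8.trans h12))

theorem exists_gradient_bound (hβ : 0 < β) (hε₀ : 0 < ε₀) (hc : 0 < c) (hM : 0 ≤ M) :
    ∃ C, 0 ≤ C ∧ ∀ v, Admissible β ε₀ c M v → ∀ x₀ : Rn n,
      ∫ x in ball x₀ 1, ∑ i : Fin n, pd i v x ^ 2 ≤ C := by
  obtain ⟨C, hC, h⟩ := exists_energy_bound (n := n) hβ hε₀ hc hM hM
  refine ⟨C, hC, fun v hv x₀ => ?_⟩
  simpa using h v hv v hv.contDiff rfl x₀ 1 one_pos le_rfl fun x _ => by simpa using hv.bound x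

end Apriori

end FormSubordination

end

noncomputable section

namespace FormSubordination

open Metric Filter Topology
open scoped ENNReal Convolution

variable {n : ℕ}

/-! ### Representation of functionals on test functions -/

/-- The space of test functions. -/
def testSubmodule (n : ℕ) : Submodule ℝ (Rn n → ℝ) where
  carrier := {f | IsTest f}
  add_mem' hf hg := hf.add hg
  zero_mem' := ⟨contDiff_const, HasCompactSupport.zero⟩
  smul_mem' a _ hf := hf.const_mul a

/-- The bound makes `L` factor through the range of `D`. Hahn–Banach extends it to `H` and Riesz
represents the extension, so neither density nor closedness of the range is needed. -/
theorem exists_inner_rep {E H : Type*} [AddCommGroup E] [Module ℝ E] [NormedAddCommGroup H]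
    [InnerProductSpace ℝ H] [CompleteSpace H] (L : E →ₗ[ℝ] ℝ) (D : E →ₗ[ℝ] H) (C : ℝ)
    (hC : ∀ f, |L f| ≤ C * ‖D f‖) : ∃ F : H, ∀ f, L f = inner ℝ F (D f) := by
  obtain ⟨g, hg⟩ := D.rangeRestrict.exists_rightInverse_of_surjective
    (LinearMap.range_rangeRestrict D)
  have hgD : ∀ y : D.range, D (g y) = y := fun y => by
    have := LinearMap.congr_fun hg y
    exact congrArg Subtype.val this
  let T : StrongDual ℝ D.range := (L ∘ₗ g).mkContinuous C fun y => by
    have := hC (g y)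
    rwa [hgD] at this
  obtain ⟨T', hT', -⟩ := exists_extension_norm_eq (𝕜 := ℝ) D.range T
  refine ⟨(InnerProductSpace.toDual ℝ H).symm T', fun f => ?_⟩
  rw [InnerProductSpace.toDual_symm_apply]
  have h1 := hT' ⟨D f, LinearMap.mem_range_self D f⟩
  have h2 : T ⟨D f, LinearMap.mem_range_self D f⟩ = L (g ⟨D f, LinearMap.mem_range_self D f⟩) := rfl
  rw [h1, h2]
  -- `f` and the chosen preimage of `D f` have the same image under `D`, hence the same value under
  -- `L`.
  have h3 := hC (f - g ⟨D f, LinearMap.mem_range_self D f⟩)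
  rw [map_sub D, hgD, sub_self, norm_zero, mul_zero, map_sub] at h3
  linarith [abs_nonpos_iff.1 h3]

/-- The Riesz argument in `L²` for the vector of all `D k f`. It is used with `f` and its partial
derivatives, giving a local `H⁻¹` representation, and with one weighted copy of `f`, giving weak
derivatives. -/
theorem exists_integral_rep {ι : Type} [Fintype ι] {L : (Rn n → ℝ) → ℝ}
    (hadd : ∀ f g, IsTest f → IsTest g → L (fun x => f x + g x) = L f + L g)
    (hmul : ∀ (a : ℝ) (f), IsTest f → L (fun x => a * f x) = a * L f)
    {D : ι → (Rn n → ℝ) → Rn n → ℝ}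
    (hDadd : ∀ k f g, IsTest f → IsTest g → D k (fun x => f x + g x) = fun x => D k f x + D k g x)
    (hDmul : ∀ k (a : ℝ) f, IsTest f → D k (fun x => a * f x) = fun x => a * D k f x)
    (hDc : ∀ k f, IsTest f → Continuous (D k f) ∧ HasCompactSupport (D k f)) {C : ℝ}
    (hC : ∀ f, IsTest f → |L f| ≤ C * √(∫ x, ∑ k, D k f x ^ 2)) :
    ∃ F : ι → Rn n → ℝ, (∀ k, StronglyMeasurable (F k) ∧ MemLp (F k) 2) ∧
      ∀ f, IsTest f → L f = ∑ k, ∫ x, D k f x * F k x := by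
  let V : (Rn n → ℝ) → Rn n → EuclideanSpace ℝ ι := fun f x => WithLp.toLp 2 fun k => D k f x
  have hVc : ∀ f, IsTest f → Continuous (V f) := fun f hf =>
    (PiLp.continuous_toLp 2 _).comp (continuous_pi fun k => (hDc k f hf).1)
  have hVs : ∀ f, IsTest f → HasCompactSupport (V f) := by
    intro f hf
    refine HasCompactSupport.intro (K := ⋃ k, tsupport (D k f))
      (isCompact_iUnion fun k => (hDc k f hf).2) fun x hx => ?_
    ext k
    simp only [Set.mem_iUnion, not_exists] at hx
    exact image_eq_zero_of_notMem_tsupport (f := D k f) (hx k)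
  have hVL : ∀ f, IsTest f → MemLp (V f) 2 volume := fun f hf =>
    (hVc f hf).memLp_of_hasCompactSupport (hVs f hf)
  let DL : testSubmodule n →ₗ[ℝ] Lp (EuclideanSpace ℝ ι) 2 (volume : Measure (Rn n)) :=
    { toFun := fun f => (hVL f f.2).toLp (V f)
      map_add' := fun f g => by
        rw [← MemLp.toLp_add]
        congr 1
        funext x
        ext k
        exact congrFun (hDadd k f g f.2 g.2) x
      map_smul' := fun a f => by
        rw [RingHom.id_apply, ← MemLp.toLp_const_smul]
        congr 1
        funext x
        ext k
        exact congrFun (hDmul k a f f.2) x }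
  let LL : testSubmodule n →ₗ[ℝ] ℝ :=
    { toFun := fun f => L f
      map_add' := fun f g => hadd f g f.2 g.2
      map_smul' := fun a f => hmul a f f.2 }
  have hnorm : ∀ f : testSubmodule n, ‖DL f‖ = √(∫ x, ∑ k, D k f x ^ 2) := by
    intro f
    rw [← Real.sqrt_sq (norm_nonneg (DL f)), ← real_inner_self_eq_norm_sq, L2.inner_def]
    congr 1
    refine integral_congr_ae ?_
    filter_upwards [(hVL f f.2).coeFn_toLp] with x hx
    show inner ℝ ((hVL f f.2).toLp (V f) x) ((hVL f f.2).toLp (V f) x) = _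
    rw [hx, real_inner_self_eq_norm_sq, EuclideanSpace.norm_sq_eq]
    simp [V]
  obtain ⟨F, hF⟩ := exists_inner_rep LL DL C fun f => by rw [hnorm]; exact hC f f.2
  have hFm : StronglyMeasurable F := Lp.stronglyMeasurable F
  have hFL : MemLp F 2 volume := Lp.memLp F
  have hFk : ∀ k, StronglyMeasurable (fun x => F x k) ∧ MemLp (fun x => F x k) 2 volume := by
    intro k
    refine ⟨(EuclideanSpace.proj k : EuclideanSpace ℝ ι →L[ℝ] ℝ).continuous.comp_stronglyMeasurable hFm,
      (EuclideanSpace.proj k : EuclideanSpace ℝ ι →L[ℝ] ℝ).comp_memLp' hFL⟩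
  refine ⟨fun k x => F x k, hFk, fun f hf => ?_⟩
  have h1 := hF ⟨f, hf⟩
  rw [L2.inner_def] at h1
  have h2 : L f = LL ⟨f, hf⟩ := rfl
  rw [h2, h1, ← integral_finsetSum]
  · refine integral_congr_ae ?_
    filter_upwards [(hVL f hf).coeFn_toLp] with x hx
    show inner ℝ (F x) ((hVL f hf).toLp (V f) x) = _
    rw [hx, PiLp.inner_apply]
    simp [V]
  · intro k _
    exact MemLp.integrable_mul (p := 2) (q := 2)
      ((hDc k f hf).1.memLp_of_hasCompactSupport (hDc k f hf).2) (hFk k).2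

/-- Choose `k = 1 / d`, or let `k → ∞` when `d = 0`. This converts a quadratic bound with a free
weight into one linear in the norm `d`. -/
theorem le_of_forall_weighted_le {X C d b : ℝ} (hd : 0 ≤ d)
    (h : ∀ k > 0, X ≤ 1 / 2 * (k * (C * d ^ 2) + k⁻¹ * b)) : X ≤ 1 / 2 * (C + b) * d := by
  rcases hd.eq_or_lt with rfl | hd
  · simp only [ne_eq, OfNat.ofNat_ne_zero, not_false_eq_true, zero_pow, mul_zero, zero_add] at h ⊢
    have ht : Tendsto (fun k : ℝ => 1 / 2 * (k⁻¹ * b)) atTop (𝓝 (1 / 2 * (0 * b))) :=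
      (tendsto_inv_atTop_zero.mul_const b).const_mul _
    rw [zero_mul, mul_zero] at ht
    refine ge_of_tendsto ht ?_
    filter_upwards [eventually_gt_atTop 0] with k hk using h k hk
  · refine (h d⁻¹ (inv_pos.2 hd)).trans (le_of_eq ?_)
    field_simp

/-- Multiplying by a cutoff equal to one on the ball and using the weighted polarised form bounds
`L` by the `H¹` norm. `FormBdd` includes no continuity; this representation replaces it and
justifies measurability and the exchange of `L` with integrals. -/
theorem FormBdd.exists_local_rep {β ε₀ c : ℝ} (hε₀ : 0 < ε₀) (hc : 0 < c) {L : (Rn n → ℝ) → ℂ}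
    (hL : FormBdd β ε₀ c L) (R : ℝ) : ∃ (G₀ : Rn n → ℂ) (G : Fin n → Rn n → ℂ),
      (StronglyMeasurable G₀ ∧ LocallyIntegrable G₀) ∧
      (∀ i, StronglyMeasurable (G i) ∧ LocallyIntegrable (G i)) ∧
      ∀ f, IsTest f → tsupport f ⊆ closedBall 0 R →
        L f = (∫ x, f x • G₀ x) + ∑ i, ∫ x, pd i f x • G i x := by
  let b : ContDiffBump (0 : Rn n) := ⟨max R 1, max R 1 + 1, by positivity, by linarith⟩
  have hb : IsTest (b : Rn n → ℝ) := ⟨b.contDiff, b.hasCompactSupport⟩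
  have hb1 : ∀ f : Rn n → ℝ, tsupport f ⊆ closedBall 0 R → (fun x => f x * b x) = f := by
    intro f hf
    funext x
    by_cases hx : x ∈ tsupport f
    · rw [b.one_of_mem_closedBall (closedBall_subset_closedBall (le_max_left _ _) (hf hx)), mul_one]
    · rw [image_eq_zero_of_notMem_tsupport hx, zero_mul]
  let D : Option (Fin n) → (Rn n → ℝ) → Rn n → ℝ := fun o f => o.elim f fun i => pd i f
  have hDadd : ∀ k f g, IsTest f → IsTest g →
      D k (fun x => f x + g x) = fun x => D k f x + D k g x := by
    rintro (_ | i) f g hf hg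
    · rfl
    · exact funext fun x => pd_add hf.contDiff_one hg.contDiff_one i x
  have hDmul : ∀ k (a : ℝ) f, IsTest f → D k (fun x => a * f x) = fun x => a * D k f x := by
    rintro (_ | i) a f hf
    · rfl
    · exact funext fun x => pd_const_mul hf.contDiff_one a i x
  have hDt : ∀ k f, IsTest f → IsTest (D k f) := by
    rintro (_ | i) f hf
    · exact hf
    · exact hf.pd i
  have hε : 0 < ε₀ / 2 := by positivity
  set C₁ := ε₀ / 2 + c * (ε₀ / 2) ^ (-β) with hC₁
  set B := ε₀ / 2 * dirichlet b + c * (ε₀ / 2) ^ (-β) * ∫ x, (b : Rn n → ℝ) x ^ 2 with hB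
  have hbound : ∀ f, IsTest f → ‖L (fun x => f x * b x)‖ ≤
      1 / 2 * (C₁ + B) * √(∫ x, ∑ k, D k f x ^ 2) := by
    intro f hf
    have hsum : ∫ x, ∑ k, D k f x ^ 2 = (∫ x, f x ^ 2) + dirichlet f := by
      rw [dirichlet, ← integral_add hf.sq.integrable hf.integrable_sum_sq]
      refine integral_congr_ae (Eventually.of_forall fun x => ?_)
      simp [Fintype.sum_option, D]
    refine le_of_forall_weighted_le (Real.sqrt_nonneg _) fun k hk => ?_
    refine (hL.polar_weighted hε (by linarith) hf hb hk).trans ?_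
    have h0 : 0 ≤ ∫ x, f x ^ 2 := integral_nonneg fun _ => sq_nonneg _
    have h1 := dirichlet_nonneg f
    rw [hsum, Real.sq_sqrt (by positivity)]
    have h2 : ε₀ / 2 * dirichlet f + c * (ε₀ / 2) ^ (-β) * ∫ x, f x ^ 2 ≤
        C₁ * ((∫ x, f x ^ 2) + dirichlet f) := by
      rw [hC₁]
      have h3 : 0 ≤ ε₀ / 2 * ∫ x, f x ^ 2 := by positivity
      have h4 : 0 ≤ c * (ε₀ / 2) ^ (-β) * dirichlet f := by positivity
      linarith
    exact mul_le_mul_of_nonneg_left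
      (add_le_add (mul_le_mul_of_nonneg_left h2 hk.le) le_rfl) (by norm_num)
  have hadd : ∀ f g, IsTest f → IsTest g → L (fun x => (f x + g x) * b x) =
      L (fun x => f x * b x) + L (fun x => g x * b x) := by
    intro f g hf hg
    rw [← hL.map_add _ _ (hf.mul hb.1) (hg.mul hb.1)]
    simp only [add_mul]
  have hmul : ∀ (a : ℝ) (f), IsTest f → L (fun x => (a * f x) * b x) =
      a * L (fun x => f x * b x) := by
    intro a f hf
    rw [← hL.map_mul _ _ (hf.mul hb.1)]
    simp only [mul_assoc]
  obtain ⟨Fr, hFr, hr⟩ := exists_integral_rep (L := fun f => (L (fun x => f x * b x)).re) (D := D)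
    (fun f g hf hg => by rw [hadd f g hf hg, Complex.add_re])
    (fun a f hf => by rw [hmul a f hf, Complex.re_ofReal_mul]) hDadd hDmul
    (fun k f hf => ⟨(hDt k f hf).continuous, (hDt k f hf).2⟩)
    (fun f hf => (Complex.abs_re_le_norm _).trans (hbound f hf))
  obtain ⟨Fi, hFi, hi⟩ := exists_integral_rep (L := fun f => (L (fun x => f x * b x)).im) (D := D)
    (fun f g hf hg => by rw [hadd f g hf hg, Complex.add_im])
    (fun a f hf => by rw [hmul a f hf, Complex.im_ofReal_mul]) hDadd hDmul
    (fun k f hf => ⟨(hDt k f hf).continuous, (hDt k f hf).2⟩)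
    (fun f hf => (Complex.abs_im_le_norm _).trans (hbound f hf))
  let G : Option (Fin n) → Rn n → ℂ := fun k x => (Fr k x : ℂ) + (Fi k x : ℂ) * Complex.I
  have hli : ∀ F : Rn n → ℝ, MemLp F 2 → LocallyIntegrable F :=
    fun F hF => hF.locallyIntegrable (by norm_num)
  have hlc : ∀ F : Rn n → ℝ, LocallyIntegrable F → LocallyIntegrable fun x => (F x : ℂ) := by
    intro F hF x
    obtain ⟨U, hU, hFU⟩ := hF x
    exact ⟨U, hU, hFU.ofReal⟩
  have hG : ∀ k, StronglyMeasurable (G k) ∧ LocallyIntegrable (G k) := by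
    intro k
    refine ⟨(Complex.continuous_ofReal.comp_stronglyMeasurable (hFr k).1).add
      ((Complex.continuous_ofReal.comp_stronglyMeasurable (hFi k).1).mul_const _), ?_⟩
    refine (hlc _ (hli _ (hFr k).2)).add ?_
    intro x
    obtain ⟨U, hU, hFU⟩ := hlc _ (hli _ (hFi k).2) x
    exact ⟨U, hU, hFU.mul_const _⟩
  refine ⟨G none, fun i => G (some i), hG none, fun i => hG (some i), fun f hf hfR => ?_⟩
  have hInt : ∀ k, ∫ x, D k f x • G k x =
      ((∫ x, D k f x * Fr k x : ℝ) : ℂ) + ((∫ x, D k f x * Fi k x : ℝ) : ℂ) * Complex.I := by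
    intro k
    have i1 : Integrable fun x => D k f x * Fr k x :=
      (hli _ (hFr k).2).integrable_smul_left_of_hasCompactSupport (hDt k f hf).continuous
        (hDt k f hf).2
    have i2 : Integrable fun x => D k f x * Fi k x :=
      (hli _ (hFi k).2).integrable_smul_left_of_hasCompactSupport (hDt k f hf).continuous
        (hDt k f hf).2
    rw [← integral_complex_ofReal, ← integral_complex_ofReal, ← integral_mul_const,
      ← integral_add i1.ofReal (i2.ofReal.mul_const _)]
    refine integral_congr_ae (Eventually.of_forall fun x => ?_)
    simp only [G, Complex.real_smul]
    push_cast
    ring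
  have h1 := hr f hf
  have h2 := hi f hf
  simp only [hb1 f hfR] at h1 h2
  have h3 : L f = ∑ k, ∫ x, D k f x • G k x := by
    rw [← Complex.re_add_im (L f), h1, h2]
    simp only [hInt, Finset.sum_add_distrib, Complex.ofReal_sum, Finset.sum_mul]
  rw [h3, Fintype.sum_option]
  rfl

end FormSubordination

end

noncomputable section

namespace FormSubordination

open Metric Filter Topology
open scoped ENNReal Convolution

variable {n : ℕ}

/-! ### Smoothing of form bounded functionals -/

/-- The value at `x` of the convolution of the functional `L` with the kernel `ψ` at scale `s`. -/
def smoothing (L : (Rn n → ℝ) → ℂ) (ψ : Rn n → ℝ) (x : Rn n) (s : ℝ) : ℂ :=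
  L fun y => dil s ψ (x - y)

theorem pd_dil_sub {ψ : Rn n → ℝ} (hψ : IsTest ψ) {s : ℝ} (hs : 0 < s) (x y : Rn n) (i : Fin n) :
    pd i (fun y => dil s ψ (x - y)) y = -(s⁻¹ * dil s (pd i ψ) (x - y)) := by
  have h := pd_const_mul (hψ.comp_scale hs x).contDiff_one (s ^ n)⁻¹ i y
  rw [pd_comp_scale hψ.contDiff_one] at h
  rw [show (fun y => dil s ψ (x - y)) = fun y => (s ^ n)⁻¹ * ψ (s⁻¹ • (x - y)) from rfl, h, dil]
  ring

theorem tsupport_dil_sub_subset {ψ : Rn n → ℝ} {A R : ℝ} (hA : tsupport ψ ⊆ closedBall 0 A)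
    (hA0 : 0 ≤ A) {x : Rn n} (hx : ‖x‖ ≤ R) {s : ℝ} (hs : 0 < s) (hs1 : s ≤ 1) :
    tsupport (fun y => dil s ψ (x - y)) ⊆ closedBall 0 (R + A) := by
  refine closure_minimal (fun y hy => ?_) isClosed_closedBall
  have h1 : s⁻¹ • (x - y) ∈ tsupport ψ := by
    by_contra h
    refine hy ?_
    simp only [dil]
    rw [image_eq_zero_of_notMem_tsupport h, mul_zero]
  have h2 := hA h1
  rw [mem_closedBall_zero_iff, norm_smul, Real.norm_of_nonneg (inv_pos.2 hs).le,
    inv_mul_le_iff₀ hs] at h2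
  rw [mem_closedBall_zero_iff]
  have h3 : ‖y‖ ≤ ‖x‖ + ‖x - y‖ := by
    have := norm_sub_le x (x - y)
    rwa [sub_sub_cancel] at this
  nlinarith

theorem tsupport_av_subset {ψ f : Rn n → ℝ} {A R : ℝ} (hA : tsupport ψ ⊆ closedBall 0 A)
    (hf : tsupport f ⊆ closedBall 0 R) (hA0 : 0 ≤ A) {s : ℝ} (hs : 0 ≤ s) (hs1 : s ≤ 1) :
    tsupport (av ψ s f) ⊆ closedBall 0 (R + A) := by
  refine closure_minimal (fun x hx => ?_) isClosed_closedBall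
  by_contra hxR
  refine hx (av_eq_zero_of_notMem fun z hz hzf => hxR ?_)
  have h1 := mem_closedBall_zero_iff.1 (hA hz)
  have h2 := mem_closedBall_zero_iff.1 (hf hzf)
  rw [mem_closedBall_zero_iff]
  have h3 : ‖x‖ ≤ ‖x - s • z‖ + ‖s • z‖ := by
    have := norm_add_le (x - s • z) (s • z)
    rwa [sub_add_cancel] at this
  rw [norm_smul, Real.norm_of_nonneg hs] at h3
  nlinarith [norm_nonneg z]

theorem smoothing_eq_of_rep {L : (Rn n → ℝ) → ℂ} {G₀ : Rn n → ℂ} {G : Fin n → Rn n → ℂ} {R A : ℝ}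
    (hrep : ∀ f, IsTest f → tsupport f ⊆ closedBall 0 (R + A) →
        L f = (∫ x, f x • G₀ x) + ∑ i, ∫ x, pd i f x • G i x)
    {ψ : Rn n → ℝ} (hψ : IsTest ψ) (hA : tsupport ψ ⊆ closedBall 0 A) (hA0 : 0 ≤ A) {x : Rn n}
    (hx : ‖x‖ ≤ R) {s : ℝ} (hs : 0 < s) (hs1 : s ≤ 1) :
    smoothing L ψ x s = av ψ s G₀ x - s⁻¹ • ∑ i, av (pd i ψ) s (G i) x := by
  rw [smoothing, hrep _ (hψ.dil_sub hs x) (tsupport_dil_sub_subset hA hA0 hx hs hs1),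
    av_eq_integral_dil_sub ψ hs, sub_eq_add_neg, Finset.smul_sum, ← Finset.sum_neg_distrib]
  congr 1
  refine Finset.sum_congr rfl fun i _ => ?_
  rw [av_eq_integral_dil_sub _ hs, ← integral_smul, ← integral_neg]
  refine integral_congr_ae (Eventually.of_forall fun y => ?_)
  simp only
  rw [pd_dil_sub hψ hs, neg_smul, mul_smul]

theorem stronglyMeasurable_av {ψ : Rn n → ℝ} (hψ : Continuous ψ) {G : Rn n → ℂ}
    (hG : StronglyMeasurable G) :
    StronglyMeasurable fun p : Rn n × ℝ => av ψ p.2 G p.1 := by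
  refine StronglyMeasurable.integral_prod_right'
    (f := fun q : (Rn n × ℝ) × Rn n => ψ q.2 • G (q.1.1 - q.1.2 • q.2)) ?_
  refine (hψ.comp continuous_snd).stronglyMeasurable.smul (hG.comp_measurable ?_)
  exact (by fun_prop : Continuous fun q : (Rn n × ℝ) × Rn n => q.1.1 - q.1.2 • q.2).measurable

section

variable {β ε₀ c : ℝ} {L : (Rn n → ℝ) → ℂ}

theorem IsTest.exists_radius {ψ : Rn n → ℝ} (hψ : IsTest ψ) :
    ∃ A, 0 ≤ A ∧ tsupport ψ ⊆ closedBall 0 A := by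
  obtain ⟨A, hA⟩ := hψ.2.isBounded.subset_closedBall (0 : Rn n)
  exact ⟨max A 0, le_max_right _ _, hA.trans (closedBall_subset_closedBall (le_max_left _ _))⟩

/-- The representations on balls of growing radius give measurable functions which, at each point,
eventually equal the smoothing. -/
theorem FormBdd.stronglyMeasurable_smoothing (hε₀ : 0 < ε₀) (hc : 0 < c) (hL : FormBdd β ε₀ c L)
    {ψ : Rn n → ℝ} (hψ : IsTest ψ) :
    StronglyMeasurable ((Set.univ ×ˢ Set.Ioc 0 1).indicator
      fun p : Rn n × ℝ => smoothing L ψ p.1 p.2) := by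
  obtain ⟨A, hA0, hA⟩ := hψ.exists_radius
  choose G₀ G hG₀ hG hrep using fun k : ℕ => hL.exists_local_rep hε₀ hc ((k : ℝ) + A)
  refine stronglyMeasurable_of_tendsto atTop (f := fun k : ℕ =>
    (Set.univ ×ˢ Set.Ioc 0 1).indicator fun p : Rn n × ℝ =>
      av ψ p.2 (G₀ k) p.1 - p.2⁻¹ • ∑ i, av (pd i ψ) p.2 (G k i) p.1) (fun k => ?_) ?_
  · refine StronglyMeasurable.indicator ?_ (MeasurableSet.univ.prod measurableSet_Ioc)
    refine (stronglyMeasurable_av hψ.continuous (hG₀ k).1).sub ?_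
    refine measurable_snd.inv.stronglyMeasurable.smul ?_
    exact Finset.stronglyMeasurable_fun_sum _ fun i _ =>
      stronglyMeasurable_av (hψ.pd i).continuous (hG k i).1
  · rw [tendsto_pi_nhds]
    intro p
    refine tendsto_const_nhds.congr' ?_
    obtain ⟨k₀, hk₀⟩ := exists_nat_ge ‖p.1‖
    filter_upwards [eventually_ge_atTop k₀] with k hk
    by_cases hp : p ∈ (Set.univ : Set (Rn n)) ×ˢ Set.Ioc (0 : ℝ) 1
    · rw [Set.indicator_of_mem hp, Set.indicator_of_mem hp]
      exact smoothing_eq_of_rep (hrep k) hψ hA hA0 (hk₀.trans (Nat.cast_le.2 hk)) hp.2.1 hp.2.2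
    · rw [Set.indicator_of_notMem hp, Set.indicator_of_notMem hp]

theorem pd_neg_of_even {ψ : Rn n → ℝ} (heven : ∀ z, ψ (-z) = ψ z) (i : Fin n) (z : Rn n) :
    pd i ψ (-z) = -pd i ψ z := by
  have h : (fun z => ψ (-z)) = ψ := funext heven
  have h2 := fderiv_comp_smul (𝕜 := ℝ) (f := ψ) (x := z) (-1 : ℝ)
  simp only [neg_smul, one_smul] at h2
  rw [h] at h2
  rw [pd, pd, h2]
  simp

/-- Transposing an average reflects its kernel, so evenness of `ψ` returns the same average. Through
the local representation the claim reduces to duality for functions. -/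
theorem FormBdd.integral_smul_smoothing (hε₀ : 0 < ε₀) (hc : 0 < c) (hL : FormBdd β ε₀ c L)
    {ψ : Rn n → ℝ} (hψ : IsTest ψ) (heven : ∀ z, ψ (-z) = ψ z) {f : Rn n → ℝ} (hf : IsTest f)
    {s : ℝ} (hs : 0 < s) (hs1 : s ≤ 1) :
    ∫ x, f x • smoothing L ψ x s = L (av ψ s f) := by
  obtain ⟨A, hA0, hA⟩ := hψ.exists_radius
  obtain ⟨R, hR0, hR⟩ := hf.exists_radius
  obtain ⟨G₀, G, hG₀, hG, hrep⟩ := hL.exists_local_rep hε₀ hc (R + A)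
  have hav : IsTest (av ψ s f) :=
    ⟨contDiff_av hψ.continuous hψ.2 s hf.1, hasCompactSupport_av hψ.2 hf.2 s⟩
  rw [hrep _ hav (tsupport_av_subset hA hR hA0 hs.le hs1)]
  have e1 : ∀ x, f x • smoothing L ψ x s =
      f x • av ψ s G₀ x - ∑ i, s⁻¹ • f x • av (pd i ψ) s (G i) x := by
    intro x
    by_cases hx : x ∈ tsupport f
    · rw [smoothing_eq_of_rep hrep hψ hA hA0 (mem_closedBall_zero_iff.1 (hR hx)) hs hs1, smul_sub,
        Finset.smul_sum, Finset.smul_sum]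
      congr 1
      exact Finset.sum_congr rfl fun i _ => smul_comm _ _ _
    · simp [image_eq_zero_of_notMem_tsupport hx]
  have i0 : ∀ {ψ : Rn n → ℝ} {g : Rn n → ℂ}, IsTest ψ → LocallyIntegrable g →
      Integrable fun x => f x • av ψ s g x := fun hψ hg =>
    (hf.continuous.smul (continuous_av_of_locallyIntegrable hψ.continuous hψ.2 hg hs)
      ).integrable_of_hasCompactSupport hf.2.smul_right
  have i1 : ∀ i, Integrable fun x => s⁻¹ • f x • av (pd i ψ) s (G i) x :=
    fun i => (i0 (hψ.pd i) (hG i).2).smul s⁻¹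
  simp only [e1]
  rw [integral_sub (i0 hψ hG₀.2) (integrable_finsetSum _ fun i _ => i1 i),
      integral_finsetSum _ fun i _ => i1 i, sub_eq_add_neg, ← Finset.sum_neg_distrib,
      integral_smul_av hψ.continuous hψ.2 hf.continuous hf.2 hG₀.2]
  congr 1
  · simp only [heven]
  · refine Finset.sum_congr rfl fun i _ => ?_
    rw [integral_smul, integral_smul_av (hψ.pd i).continuous (hψ.pd i).2 hf.continuous hf.2
      (hG i).2, ← integral_smul, ← integral_neg]
    refine integral_congr_ae (Eventually.of_forall fun y => ?_)
    simp only [pd_neg_of_even heven]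
    have h1 : av (fun z => -pd i ψ z) s f y = -av (pd i ψ) s f y := by
      simp only [av, neg_smul, integral_neg]
    rw [h1, ← smul_av_pd hψ.contDiff_one hψ.2 hf.contDiff_one, pd_av hψ.continuous hψ.2
      hf.contDiff_one, neg_smul, smul_neg, neg_neg, smul_eq_mul, mul_smul, inv_smul_smul₀ hs.ne']

theorem integral_swap_av {ψ u : Rn n → ℝ} (hψ : IsTest ψ) (hu : IsTest u) {G : Rn n → ℂ}
    (hG : LocallyIntegrable G) :
    IntervalIntegrable (fun s => s • ∫ x, av ψ s u x • G x) volume 0 1 ∧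
    ∫ x, (∫ s in (0 : ℝ)..1, s • av ψ s u x) • G x =
      ∫ s in (0 : ℝ)..1, s • ∫ x, av ψ s u x • G x := by
  obtain ⟨A, hA0, hA⟩ := hψ.exists_radius
  obtain ⟨R, hR0, hR⟩ := hu.exists_radius
  have hcont : Continuous fun p : Rn n × ℝ => p.2 • av ψ p.2 u p.1 :=
    continuous_snd.smul ((continuous_av hψ.continuous hψ.2 hu.continuous).comp continuous_swap)
  obtain ⟨C, hC⟩ := ((isCompact_closedBall (0 : Rn n) (R + A)).prod
    (isCompact_Icc (a := (0 : ℝ)) (b := 1))).exists_bound_of_continuousOn hcont.continuousOn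
  have hInt : Integrable (Function.uncurry fun (x : Rn n) (s : ℝ) => (s • av ψ s u x) • G x)
      (volume.prod (volume.restrict (Set.Ioc (0 : ℝ) 1))) := by
    have hGi : Integrable ((closedBall (0 : Rn n) (R + A)).indicator G) :=
      (hG.integrableOn_isCompact (isCompact_closedBall _ _)).integrable_indicator
        measurableSet_closedBall
    have h1 := (hGi.norm.const_mul C).comp_fst (volume.restrict (Set.Ioc (0 : ℝ) 1))
    refine h1.mono' ?_ ?_
    · exact hcont.aestronglyMeasurable.smul hG.aestronglyMeasurable.comp_fst
    · have h2 : ∀ᵐ p : Rn n × ℝ ∂(volume.prod (volume.restrict (Set.Ioc (0 : ℝ) 1))),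
          p.2 ∈ Set.Ioc (0 : ℝ) 1 :=
        Measure.quasiMeasurePreserving_snd.ae (ae_restrict_mem measurableSet_Ioc)
      filter_upwards [h2] with p hp
      simp only [Function.uncurry]
      rw [norm_smul]
      by_cases hx : p.1 ∈ closedBall (0 : Rn n) (R + A)
      · rw [Set.indicator_of_mem hx]
        exact mul_le_mul_of_nonneg_right (hC p ⟨hx, Set.Ioc_subset_Icc_self hp⟩) (norm_nonneg _)
      · rw [Set.indicator_of_notMem hx]
        have : av ψ p.2 u p.1 = 0 := by
          by_contra h
          exact hx (tsupport_av_subset hA hR hA0 hp.1.le hp.2 (subset_tsupport _ h))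
        simp [this]
  have e : ∀ s : ℝ, ∫ x, (s • av ψ s u x) • G x = s • ∫ x, av ψ s u x • G x := by
    intro s
    rw [← integral_smul]
    simp only [smul_eq_mul, mul_smul]
  constructor
  · rw [intervalIntegrable_iff_integrableOn_Ioc_of_le zero_le_one]
    have := hInt.integral_prod_right
    simp only [Function.uncurry, e] at this
    exact this
  · have h := integral_integral_swap hInt
    simp only [intervalIntegral.integral_of_le zero_le_one, e] at h ⊢
    rw [← h]
    refine integral_congr_ae (Eventually.of_forall fun x => ?_)
    simp only
    rw [integral_smul_const]

/-- The averaging identity transported to a form bounded functional. -/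
theorem FormBdd.av_sub {ρ σ : Rn n → ℝ} (hk : KernelPair ρ σ) (hε₀ : 0 < ε₀) (hc : 0 < c)
    (hL : FormBdd β ε₀ c L) {f : Rn n → ℝ} (hf : IsTest f) :
    L (av ρ 1 f) - L f = ∫ s in (0 : ℝ)..1, s • L (av σ s (lap f)) := by
  obtain ⟨A, hA0, hA⟩ := hk.testρ.exists_radius
  obtain ⟨A', hA'0, hA'⟩ := hk.testσ.exists_radius
  obtain ⟨R, hR0, hR⟩ := hf.exists_radius
  obtain ⟨G₀, G, hG₀, hG, hrep⟩ := hL.exists_local_rep hε₀ hc (R + max A A')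
  have hρ := hk.testρ.continuous
  have hρc := hk.testρ.2
  have hσ := hk.testσ.continuous
  have hσc := hk.testσ.2
  have hsub : ∀ {a : ℝ}, a ≤ max A A' →
      closedBall (0 : Rn n) (R + a) ⊆ closedBall 0 (R + max A A') :=
    fun h => closedBall_subset_closedBall (by linarith)
  have hRm : closedBall (0 : Rn n) R ⊆ closedBall 0 (R + max A A') :=
    closedBall_subset_closedBall (by linarith [le_max_left A A'])
  have hlR : tsupport (lap f) ⊆ closedBall 0 R := by
    refine closure_minimal (fun x hx => ?_) isClosed_closedBall
    by_contra h
    refine hx (Finset.sum_eq_zero fun i _ => image_eq_zero_of_notMem_tsupport fun hh => h (hR ?_))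
    exact tsupport_fderiv_apply_subset ℝ _ (tsupport_fderiv_apply_subset ℝ _ hh)
  have havt : ∀ {ψ g : Rn n → ℝ}, IsTest ψ → IsTest g → ∀ s, IsTest (av ψ s g) :=
    fun hψ hg s => ⟨contDiff_av hψ.continuous hψ.2 s hg.1, hasCompactSupport_av hψ.2 hg.2 s⟩
  have hsm : ∀ {g : Rn n → ℝ} {K : Rn n → ℂ}, IsTest g → LocallyIntegrable K →
      Integrable fun x => g x • K x := fun hg hK =>
    hK.integrable_smul_left_of_hasCompactSupport hg.continuous hg.2
  have key : ∀ {g : Rn n → ℝ} {K : Rn n → ℂ}, IsTest g → LocallyIntegrable K →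
      (∫ x, av ρ 1 g x • K x) - ∫ x, g x • K x =
        ∫ s in (0 : ℝ)..1, s • ∫ x, av σ s (lap g) x • K x := by
    intro g K hg hK
    rw [← (integral_swap_av hk.testσ hg.lap hK).2,
      ← integral_sub (hsm (havt hk.testρ hg 1) hK) (hsm hg hK)]
    refine integral_congr_ae (Eventually.of_forall fun x => ?_)
    simp only
    rw [← hk.av_sub_av hg.1, hk.av_zero, sub_smul]
  rw [hrep _ (havt hk.testρ hf 1) ((tsupport_av_subset hA hR hA0 zero_le_one le_rfl).trans
    (hsub (le_max_left _ _))), hrep f hf (hR.trans hRm), add_sub_add_comm, key hf hG₀.2,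
    ← Finset.sum_sub_distrib]
  have h1 : ∀ i, (∫ x, pd i (av ρ 1 f) x • G i x) - ∫ x, pd i f x • G i x =
      ∫ s in (0 : ℝ)..1, s • ∫ x, av σ s (lap (pd i f)) x • G i x := fun i => by
    rw [pd_av hρ hρc hf.contDiff_one, key (hf.pd i) (hG i).2]
  have hsum : IntervalIntegrable
      (fun s => ∑ i, s • ∫ x, av σ s (lap (pd i f)) x • G i x) volume 0 1 := by
    have := IntervalIntegrable.sum Finset.univ fun i _ =>
      (integral_swap_av hk.testσ (hf.pd i).lap (hG i).2).1
    simpa only [Finset.sum_fn] using this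
  simp only [h1]
  rw [← intervalIntegral.integral_finsetSum fun i _ =>
      (integral_swap_av hk.testσ (hf.pd i).lap (hG i).2).1,
    ← intervalIntegral.integral_add (integral_swap_av hk.testσ hf.lap hG₀.2).1
      hsum]
  refine intervalIntegral.integral_congr fun s hs => ?_
  rw [Set.uIcc_of_le zero_le_one] at hs
  rw [hrep _ (havt hk.testσ hf.lap s) ((tsupport_av_subset hA' hlR hA'0 hs.1 hs.2).trans
    (hsub (le_max_right _ _))), smul_add, Finset.smul_sum]
  congr 1
  refine Finset.sum_congr rfl fun i _ => ?_
  rw [pd_av hσ hσc hf.lap.contDiff_one, lap_pd hf.1]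

end

end FormSubordination

end

/-! ### Bounded potentials from the averaging identity. -/

noncomputable section

namespace FormSubordination

open Metric Filter Topology
open scoped ENNReal Convolution

variable {n : ℕ}

/-- A form bounded functional is `q - ΔF` with bounded functions `F` and `q`. -/
theorem FormBdd.exists_decomposition {β ε₀ c : ℝ} {L : (Rn n → ℝ) → ℂ} (hn : 0 < n) (hβ : 0 < β)
    (hε₀ : 0 < ε₀) (hc : 0 < c) (hL : FormBdd β ε₀ c L) : ∃ (F q : Rn n → ℂ) (M : ℝ),
      StronglyMeasurable F ∧ StronglyMeasurable q ∧ (∀ x, ‖F x‖ ≤ M) ∧ (∀ x, ‖q x‖ ≤ M) ∧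
      ∀ f, IsTest f → L f = (∫ x, f x • q x) - ∫ x, lap f x • F x := by
  obtain ⟨ρ, σ, hk⟩ := exists_kernelPair hn
  obtain ⟨C₁, hC₁, h₁⟩ := exists_scaling_bound hβ hε₀ hc hk.testσ
  obtain ⟨C₂, hC₂, h₂⟩ := exists_scaling_bound hβ hε₀ hc hk.testρ
  set μ := 2 * β / (β + 1) with hμ
  have hμ2 : -1 < 1 - μ := by
    have : 2 - μ = 2 / (β + 1) := by rw [hμ]; field_simp; ring
    have : 0 < 2 / (β + 1) := by positivity
    linarith
  have hmσ := hL.stronglyMeasurable_smoothing hε₀ hc hk.testσ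
  have hmρ := hL.stronglyMeasurable_smoothing hε₀ hc hk.testρ
  have hi : Integrable (fun s : ℝ => C₁ * s ^ (1 - μ)) (volume.restrict (Set.Ioc (0 : ℝ) 1)) :=
    (intervalIntegrable_iff_integrableOn_Ioc_of_le zero_le_one).1
      ((intervalIntegral.intervalIntegrable_rpow' hμ2).const_mul C₁)
  have hb : ∀ x, ∀ s ∈ Set.Ioc (0 : ℝ) 1, ‖s • smoothing L σ x s‖ ≤ C₁ * s ^ (1 - μ) := by
    intro x s hs
    rw [norm_smul, Real.norm_of_nonneg hs.1.le, sub_eq_add_neg, Real.rpow_add hs.1, Real.rpow_one]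
    refine (mul_le_mul_of_nonneg_left (h₁ L hL x s hs.1 hs.2) hs.1.le).trans (le_of_eq ?_)
    ring
  have hmk : StronglyMeasurable fun p : Rn n × ℝ => p.2 • (Set.univ ×ˢ Set.Ioc 0 1).indicator
      (fun p : Rn n × ℝ => smoothing L σ p.1 p.2) p := measurable_snd.stronglyMeasurable.smul hmσ
  have hind : ∀ x, ∀ s ∈ Set.Ioc (0 : ℝ) 1, (Set.univ ×ˢ Set.Ioc 0 1).indicator
      (fun p : Rn n × ℝ => smoothing L σ p.1 p.2) (x, s) = smoothing L σ x s := fun x s hs =>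
    Set.indicator_of_mem (s := (Set.univ : Set (Rn n)) ×ˢ Set.Ioc (0 : ℝ) 1) ⟨Set.mem_univ _, hs⟩ _
  -- The averaging identity reads `L = ρ₁ * L - Δ ∫₀¹ s (σ_s * L) ds`. The integral is `F`, which is
  -- bounded since `s ^ (1 - μ)` is integrable at zero, and `q` is the smoothing by `ρ` at scale
  -- one.
  set F : Rn n → ℂ := fun x => ∫ s in Set.Ioc (0 : ℝ) 1, s • smoothing L σ x s with hF
  have hFm : StronglyMeasurable F := by
    have h := hmk.integral_prod_right' (ν := volume.restrict (Set.Ioc (0 : ℝ) 1))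
    convert h using 2 with x
    exact setIntegral_congr_fun measurableSet_Ioc fun s hs => by simp only [hind x s hs]
  set B := ∫ s in Set.Ioc (0 : ℝ) 1, C₁ * s ^ (1 - μ) with hB
  have hFb : ∀ x, ‖F x‖ ≤ B := fun x =>
    norm_integral_le_of_norm_le hi ((ae_restrict_iff' measurableSet_Ioc).2
      (Eventually.of_forall fun s hs => hb x s hs))
  refine ⟨F, fun x => smoothing L ρ x 1, max B C₂, hFm, ?_, fun x => (hFb x).trans (le_max_left _ _),
    fun x => ?_, fun f hf => ?_⟩
  · have h := hmρ.comp_measurable (measurable_prodMk_right (α := Rn n) (y := (1 : ℝ)))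
    convert h using 2 with x
    have hx : (x, (1 : ℝ)) ∈ (Set.univ : Set (Rn n)) ×ˢ Set.Ioc (0 : ℝ) 1 :=
      ⟨Set.mem_univ _, by simp⟩
    exact (Set.indicator_of_mem hx fun p : Rn n × ℝ => smoothing L ρ p.1 p.2).symm
  · refine le_trans ?_ (le_max_right B C₂)
    have := h₂ L hL x 1 one_pos le_rfl
    rwa [Real.one_rpow, mul_one] at this
  · have h1 : ∫ x, f x • smoothing L ρ x 1 = L (av ρ 1 f) :=
      hL.integral_smul_smoothing hε₀ hc hk.testρ hk.evenρ hf one_pos le_rfl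
    have h2 := hL.av_sub hk hε₀ hc hf
    have hInt : Integrable (Function.uncurry fun (x : Rn n) (s : ℝ) =>
        lap f x • s • smoothing L σ x s)
        (volume.prod (volume.restrict (Set.Ioc (0 : ℝ) 1))) := by
      have hae : ∀ᵐ p : Rn n × ℝ ∂(volume.prod (volume.restrict (Set.Ioc (0 : ℝ) 1))),
          p.2 ∈ Set.Ioc (0 : ℝ) 1 :=
        Measure.quasiMeasurePreserving_snd.ae (ae_restrict_mem measurableSet_Ioc)
      refine (hf.lap.integrable.norm.mul_prod hi).mono' ?_ ?_
      · have h3 : StronglyMeasurable fun p : Rn n × ℝ => lap f p.1 • p.2 •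
            (Set.univ ×ˢ Set.Ioc 0 1).indicator (fun p : Rn n × ℝ => smoothing L σ p.1 p.2) p :=
          (hf.lap.continuous.comp continuous_fst).stronglyMeasurable.smul hmk
        refine h3.aestronglyMeasurable.congr ?_
        filter_upwards [hae] with p hp
        simp only [Function.uncurry, hind p.1 p.2 hp]
      · filter_upwards [hae] with p hp
        simp only [Function.uncurry]
        rw [norm_smul]
        exact mul_le_mul_of_nonneg_left (hb p.1 p.2 hp) (norm_nonneg _)
    have h3 := integral_integral_swap hInt
    simp only [integral_smul] at h3
    have h4 : ∫ s in (0 : ℝ)..1, s • L (av σ s (lap f)) = ∫ x, lap f x • F x := by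
      rw [h3, intervalIntegral.integral_of_le zero_le_one]
      refine setIntegral_congr_fun measurableSet_Ioc fun s hs => ?_
      rw [← hL.integral_smul_smoothing hε₀ hc hk.testσ hk.evenσ hf.lap hs.1 hs.2, ← integral_smul]
      exact integral_congr_ae (Eventually.of_forall fun x => smul_comm _ _ _)
    rw [h1, ← h4, ← h2]
    ring

/-! ### Distributions as functionals on test functions -/

/-- A test function as an element of the space of test functions. -/
def IsTest.mk {f : Rn n → ℝ} (hf : IsTest f) : RealTest n where
  toFun := f
  contDiff' := hf.1
  hasCompactSupport' := hf.2
  tsupport_subset' := fun _ _ => trivial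

open Classical in
/-- The functional on functions defined by a distribution. -/
def eval (Q : Distr n) (f : Rn n → ℝ) : ℂ := if hf : IsTest f then Q hf.mk else 0

theorem eval_eq (Q : Distr n) {f : Rn n → ℝ} (hf : IsTest f) : eval Q f = Q hf.mk := dif_pos hf

theorem isTest_coe (φ : RealTest n) : IsTest φ := ⟨φ.contDiff, φ.hasCompactSupport⟩

theorem eval_coe (Q : Distr n) (φ : RealTest n) : eval Q φ = Q φ := eval_eq Q (isTest_coe φ)

theorem TrudingerSubordinate.formBdd {Q : Distr n} {β : ℝ} (h : TrudingerSubordinate Q β) :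
    ∃ ε₀ > 0, ∃ c > 0, FormBdd β ε₀ c (eval Q) := by
  obtain ⟨ε₀, hε₀, c, hc, hQ⟩ := h
  refine ⟨ε₀, hε₀, c, hc, fun f g hf hg => ?_, fun a f hf => ?_, fun ε hε hεε₀ u hu => ?_⟩
  · rw [eval_eq _ hf, eval_eq _ hg, eval_eq _ (hf.add hg), ← map_add]
    rfl
  · rw [eval_eq _ hf, eval_eq _ (hf.const_mul a), ← Complex.real_smul, ← map_smul]
    rfl
  · let w : Test n :=
      { toFun := fun x => (u x : ℂ)
        contDiff' := Complex.ofRealCLM.contDiff.comp hu.1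
        hasCompactSupport' := hu.2.comp_left (g := fun t : ℝ => (t : ℂ)) (by simp)
        tsupport_subset' := fun _ _ => trivial }
    have h1 := hQ ε hε hεε₀ w
    have e1 : normSqTest w = hu.sq.mk := by
      refine TestFunction.ext fun x => ?_
      show ‖(u x : ℂ)‖ ^ 2 = u x ^ 2
      rw [Complex.norm_real, Real.norm_eq_abs, sq_abs]
    have e2 : gradNormSq w = dirichlet u := by
      unfold gradNormSq dirichlet
      refine integral_congr_ae (Eventually.of_forall fun x => ?_)
      refine Finset.sum_congr rfl fun i _ => ?_
      have hd : HasFDerivAt (fun x => (u x : ℂ)) (Complex.ofRealCLM.comp (fderiv ℝ u x)) x :=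
        Complex.ofRealCLM.hasFDerivAt.comp x
          (hu.1.differentiable (by simp)).differentiableAt.hasFDerivAt
      show ‖fderiv ℝ (fun x => (u x : ℂ)) x (basisVec i)‖ ^ 2 = pd i u x ^ 2
      rw [hd.fderiv]
      simp [pd]
    have e3 : normSqL2 w = ∫ x, u x ^ 2 := by
      unfold normSqL2
      refine integral_congr_ae (Eventually.of_forall fun x => ?_)
      show ‖(u x : ℂ)‖ ^ 2 = u x ^ 2
      rw [Complex.norm_real, Real.norm_eq_abs, sq_abs]
    rw [e1, e2, e3] at h1
    rwa [eval_eq _ hu.sq]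

end FormSubordination

end

noncomputable section

namespace FormSubordination

open Metric Filter Topology
open scoped ENNReal Convolution

variable {n : ℕ}

/-! ### The resolvent as convolution with a probability measure -/

/-- The exponential distribution of rate one. -/
def expLaw : Measure ℝ :=
  (volume.restrict (Set.Ioi 0)).withDensity fun s => ENNReal.ofReal (Real.exp (-s))

theorem integral_expLaw (f : ℝ → ℂ) :
    ∫ s, f s ∂expLaw = ∫ s in Set.Ioi (0 : ℝ), Real.exp (-s) • f s := by
  rw [expLaw, integral_withDensity_eq_integral_toReal_smul (by fun_prop)
    (Eventually.of_forall fun _ => ENNReal.ofReal_lt_top)]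
  refine integral_congr_ae (Eventually.of_forall fun s => ?_)
  simp only [ENNReal.toReal_ofReal (Real.exp_pos _).le]

instance : IsProbabilityMeasure expLaw := by
  refine ⟨?_⟩
  rw [expLaw, withDensity_apply _ MeasurableSet.univ, Measure.restrict_univ,
    ← ofReal_integral_eq_lintegral_ofReal (integrableOn_exp_neg_Ioi 0)
      (Eventually.of_forall fun _ => (Real.exp_pos _).le), integral_exp_neg_Ioi_zero,
    ENNReal.ofReal_one]

/-- The law of `√(2 E) Z` with `E` exponential and `Z` standard Gaussian. -/
def besselLaw (n : ℕ) : Measure (Rn n) :=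
  (expLaw.prod (ProbabilityTheory.stdGaussian (Rn n))).map fun p => √(2 * p.1) • p.2

theorem measurable_besselMap : Measurable fun p : ℝ × Rn n => √(2 * p.1) • p.2 :=
  (by fun_prop : Continuous fun p : ℝ × Rn n => √(2 * p.1) • p.2).measurable

instance : IsProbabilityMeasure (besselLaw n) :=
  Measure.isProbabilityMeasure_map measurable_besselMap.aemeasurable

/-- Conditioning on the exponential variable `s`, the Gaussian contributes `exp(-s ‖η‖²)`, and `∫₀^∞
e^(-s) e^(-s‖η‖²) ds = (1 + ‖η‖²)⁻¹`. This is the formula `(1 - Δ)⁻¹ = ∫₀^∞ e^(-s) e^(sΔ) ds` in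
probabilistic form. -/
theorem charFun_besselLaw (η : Rn n) :
    charFun (besselLaw n) η = (((1 + ‖η‖ ^ 2)⁻¹ : ℝ) : ℂ) := by
  have hm : ∀ η : Rn n, Continuous fun x : Rn n => Complex.exp ((inner ℝ x η : ℝ) * Complex.I) :=
    fun η => by fun_prop
  rw [charFun_apply, besselLaw, integral_map measurable_besselMap.aemeasurable
    (hm η).aestronglyMeasurable, integral_prod]
  · have h1 : ∀ s : ℝ, 0 < s → ∫ z, Complex.exp ((inner ℝ (√(2 * s) • z) η : ℝ) * Complex.I)
        ∂ProbabilityTheory.stdGaussian (Rn n) = ((Real.exp (-(‖η‖ ^ 2 * s)) : ℝ) : ℂ) := by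
      intro s hs
      have h := ProbabilityTheory.charFun_stdGaussian (√(2 * s) • η)
      rw [charFun_apply] at h
      simp only [inner_smul_left, inner_smul_right, RCLike.conj_to_real] at h ⊢
      rw [h, norm_smul, Complex.ofReal_exp]
      congr 1
      rw [Real.norm_of_nonneg (Real.sqrt_nonneg _), ← Complex.ofReal_pow, mul_pow,
        Real.sq_sqrt (by positivity)]
      push_cast
      ring
    rw [integral_expLaw]
    have h2 : ∫ s in Set.Ioi (0 : ℝ), Real.exp (-s) •
        ∫ z, Complex.exp ((inner ℝ (√(2 * s) • z) η : ℝ) * Complex.I)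
          ∂ProbabilityTheory.stdGaussian (Rn n) =
        ∫ s in Set.Ioi (0 : ℝ), ((Real.exp (-(1 + ‖η‖ ^ 2) * s) : ℝ) : ℂ) := by
      refine setIntegral_congr_fun measurableSet_Ioi fun s hs => ?_
      simp only
      rw [h1 s hs, Complex.real_smul, ← Complex.ofReal_mul, ← Real.exp_add]
      congr 2
      ring
    rw [h2, integral_complex_ofReal, integral_exp_mul_Ioi (by
      have := sq_nonneg ‖η‖
      linarith)]
    congr 1
    rw [mul_zero, Real.exp_zero, neg_div_neg_eq, one_div]
  · refine Integrable.of_bound (C := 1) ((hm η).comp (by fun_prop : Continuous fun p : ℝ × Rn n =>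
      √(2 * p.1) • p.2)).aestronglyMeasurable (Eventually.of_forall fun p => ?_)
    exact (Complex.norm_exp_ofReal_mul_I _).le

/-- The symbol of the resolvent. -/
def symbol (n : ℕ) (ξ : Rn n) : ℂ := (((1 + ‖(2 * Real.pi) • ξ‖ ^ 2)⁻¹ : ℝ) : ℂ)

/-- The symbol at `ξ` is the characteristic function of `besselLaw n` at `2πξ`; Fubini turns the
multiplier into a convolution. This is the action on Schwartz functions through which the multiplier
on tempered distributions is defined. -/
theorem fourier_symbol_fourierInv (φ : 𝓢(Rn n, ℂ)) (x : Rn n) :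
    (FourierTransform.fourier (SchwartzMap.smulLeftCLM ℂ (symbol n)
      (FourierTransformInv.fourierInv φ))) x = ∫ y, φ (x - y) ∂besselLaw n := by
  set g : 𝓢(Rn n, ℂ) := FourierTransformInv.fourierInv φ with hg
  have hφ : φ = FourierTransform.fourier g := by rw [hg]; simp
  have hφx : ∀ w, φ w = ∫ v, Real.fourierChar (-inner ℝ v w) • g v := fun w => by
    conv_lhs => rw [hφ]
    rw [SchwartzMap.fourier_coe, Real.fourier_eq]
  rw [SchwartzMap.fourier_coe, Real.fourier_eq]
  have hs : ∀ ξ : Rn n, symbol n ξ = ∫ y, (Real.fourierChar (inner ℝ y ξ) : ℂ) ∂besselLaw n := by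
    intro ξ
    rw [symbol, ← charFun_besselLaw, charFun_apply]
    refine integral_congr_ae (Eventually.of_forall fun y => ?_)
    simp only
    rw [Real.fourierChar_apply, inner_smul_right]
  have hInt : Integrable (Function.uncurry fun (v y : Rn n) =>
      Real.fourierChar (-inner ℝ v (x - y)) • g v) (volume.prod (besselLaw n)) := by
    have h1 : Integrable (fun p : Rn n × Rn n => g p.1) (volume.prod (besselLaw n)) :=
      g.integrable.comp_fst _
    refine h1.norm.mono' ?_ (Eventually.of_forall fun p => ?_)
    · have h2 : Continuous fun p : Rn n × Rn n =>
          Real.fourierChar (-inner ℝ p.1 (x - p.2)) • g p.1 := by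
        have := Real.continuous_fourierChar
        have := g.continuous
        fun_prop
      exact h2.aestronglyMeasurable
    · simp [Function.uncurry]
  simp only [hφx]
  rw [← integral_integral_swap hInt]
  refine integral_congr_ae (Eventually.of_forall fun v => ?_)
  simp only
  have ht : (symbol n).HasTemperateGrowth := resolvent_symbol_temperate n
  rw [SchwartzMap.smulLeftCLM_apply_apply ht, hs]
  simp only [Circle.smul_def, smul_eq_mul]
  rw [integral_mul_const, ← mul_assoc, ← integral_const_mul]
  congr 1
  refine integral_congr_ae (Eventually.of_forall fun y => ?_)
  simp only
  rw [← Circle.coe_mul, ← AddChar.map_add_eq_mul]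
  congr 2
  rw [inner_sub_right, real_inner_comm v y]
  ring

/-! ### Bounded functions as tempered distributions -/

/-- The tempered distribution defined by a bounded function. -/
def ofBounded {f : Rn n → ℂ} (hf : MemLp f ⊤ volume) : Tempered n :=
  Lp.toTemperedDistribution (hf.toLp f)

theorem ofBounded_apply {f : Rn n → ℂ} (hf : MemLp f ⊤ volume) (φ : 𝓢(Rn n, ℂ)) :
    ofBounded hf φ = ∫ x, φ x * f x := by
  rw [ofBounded, Lp.toTemperedDistribution_apply]
  refine integral_congr_ae ?_
  filter_upwards [hf.coeFn_toLp] with x hx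
  rw [hx, smul_eq_mul]

theorem resolvent_laplacian (U : Tempered n) : resolvent n (Δ U) = resolvent n U - U := by
  have h : resolvent n (Δ U) = Δ (resolvent n U) := by
    rw [TemperedDistribution.laplacian_eq_fourierMultiplierCLM,
      TemperedDistribution.laplacian_eq_fourierMultiplierCLM, resolvent,
      TemperedDistribution.fourierMultiplierCLM_fourierMultiplierCLM_apply
        (resolvent_symbol_temperate n) (by fun_prop), ← Complex.coe_smul, map_smul,
      TemperedDistribution.fourierMultiplierCLM_fourierMultiplierCLM_apply
        (by fun_prop) (resolvent_symbol_temperate n),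
      mul_comm fun x : Rn n => ((‖x‖ ^ 2 : ℝ) : ℂ)]
    rfl
  rw [h, eq_sub_iff_add_eq, add_comm]
  exact (sub_eq_iff_eq_add.1 (resolvent_sub_laplacian n U)).symm

/-- The average of a function against the translated law `besselLaw`. -/
def besselAverage (b : Rn n → ℂ) (x : Rn n) : ℂ := ∫ y, b (x + y) ∂besselLaw n

theorem stronglyMeasurable_besselAverage {b : Rn n → ℂ} (hb : StronglyMeasurable b) :
    StronglyMeasurable (besselAverage b) :=
  (hb.comp_measurable measurable_add).integral_prod_right' (ν := besselLaw n)

theorem norm_besselAverage_le {b : Rn n → ℂ} {M : ℝ} (hM : ∀ x, ‖b x‖ ≤ M) (x : Rn n) :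
    ‖besselAverage b x‖ ≤ M := by
  have h := norm_integral_le_of_norm_le_const (μ := besselLaw n)
    (Eventually.of_forall fun y => hM (x + y))
  rwa [probReal_univ, mul_one] at h

theorem resolvent_ofBounded {b : Rn n → ℂ} (hb : StronglyMeasurable b) {M : ℝ}
    (hM : ∀ x, ‖b x‖ ≤ M) (hbL : MemLp b ⊤ volume) (φ : 𝓢(Rn n, ℂ)) :
    resolvent n (ofBounded hbL) φ = ∫ x, φ x * besselAverage b x := by
  rw [resolvent, TemperedDistribution.fourierMultiplierCLM_apply_apply, ofBounded_apply]
  have h1 : ∀ x, (FourierTransform.fourier ((SchwartzMap.smulLeftCLM ℂ fun ξ : Rn n =>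
      (((1 + ‖(2 * Real.pi) • ξ‖ ^ 2)⁻¹ : ℝ) : ℂ)) (FourierTransformInv.fourierInv φ))) x =
      ∫ y, φ (x - y) ∂besselLaw n := fourier_symbol_fourierInv φ
  simp only [h1]
  have hφm : Continuous φ := φ.continuous
  have hint1 : Integrable (Function.uncurry fun (x y : Rn n) => φ (x - y) * b x)
      (volume.prod (besselLaw n)) := by
    have hm : StronglyMeasurable (Function.uncurry fun (x y : Rn n) => φ (x - y) * b x) :=
      (hφm.comp (by fun_prop : Continuous fun p : Rn n × Rn n => p.1 - p.2)).stronglyMeasurable.mul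
        (hb.comp_measurable measurable_fst)
    have hi : ∀ y, Integrable fun x => φ (x - y) * b x := fun y =>
      (φ.integrable.comp_sub_right y).mul_bdd hb.aestronglyMeasurable
        (Eventually.of_forall hM)
    refine (integrable_prod_iff' hm.aestronglyMeasurable).2 ⟨Eventually.of_forall hi, ?_⟩
    refine Integrable.of_bound (C := (∫ x, ‖φ x‖) * M) ?_ (Eventually.of_forall fun y => ?_)
    · exact (hm.norm.comp_measurable measurable_swap).integral_prod_right'.aestronglyMeasurable
    · rw [Real.norm_of_nonneg (integral_nonneg fun _ => norm_nonneg _), ← integral_mul_const,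
        ← integral_sub_right_eq_self (fun x => ‖φ x‖ * M) y]
      refine integral_mono (hi y).norm ((φ.integrable.norm.mul_const M).comp_sub_right y) fun x => ?_
      simp only [Function.uncurry, norm_mul]
      exact mul_le_mul_of_nonneg_left (hM _) (norm_nonneg _)
  have hint2 : Integrable (Function.uncurry fun (x y : Rn n) => φ x * b (x + y))
      (volume.prod (besselLaw n)) := by
    refine ((φ.integrable.norm.mul_const M).comp_fst (besselLaw n)).mono' ?_
      (Eventually.of_forall fun p => ?_)
    · exact ((hφm.comp continuous_fst).stronglyMeasurable.mul
        (hb.comp_measurable measurable_add)).aestronglyMeasurable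
    · simp only [Function.uncurry]
      rw [norm_mul]
      exact mul_le_mul_of_nonneg_left (hM _) (norm_nonneg _)
  calc ∫ x, (∫ y, φ (x - y) ∂besselLaw n) * b x
      = ∫ x, ∫ y, φ (x - y) * b x ∂besselLaw n := by simp only [integral_mul_const]
    _ = ∫ y, ∫ x, φ (x - y) * b x ∂(volume : Measure (Rn n)) ∂besselLaw n :=
        integral_integral_swap hint1
    _ = ∫ y, ∫ x, φ x * b (x + y) ∂(volume : Measure (Rn n)) ∂besselLaw n := by
        refine integral_congr_ae (Eventually.of_forall fun y => ?_)
        simp only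
        rw [← integral_add_right_eq_self _ y]
        simp
    _ = ∫ x, ∫ y, φ x * b (x + y) ∂besselLaw n := (integral_integral_swap hint2).symm
    _ = _ := by simp only [integral_const_mul, besselAverage]

theorem toSchwartz_apply (φ : RealTest n) (x : Rn n) : toSchwartz φ x = (φ x : ℂ) := rfl

theorem lineDeriv_toSchwartz (φ : RealTest n) (i : Fin n) :
    ∂_{(basisVec i : Rn n)} (toSchwartz φ) = toSchwartz ((isTest_coe φ).pd i).mk := by
  ext x
  rw [SchwartzMap.lineDerivOp_apply_eq_fderiv, toSchwartz_apply]
  have hd : HasFDerivAt (fun x => (φ x : ℂ)) (Complex.ofRealCLM.comp (fderiv ℝ φ x)) x :=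
    Complex.ofRealCLM.hasFDerivAt.comp x
      (φ.contDiff.differentiable (by simp)).differentiableAt.hasFDerivAt
  show fderiv ℝ (fun x => (φ x : ℂ)) x (basisVec i) = _
  rw [hd.fderiv]
  rfl

theorem laplacian_toSchwartz (φ : RealTest n) :
    Δ (toSchwartz φ) = toSchwartz (isTest_coe φ).lap.mk := by
  rw [SchwartzMap.laplacian_eq_sum (EuclideanSpace.basisFun (Fin n) ℝ)]
  have h : ∀ i, EuclideanSpace.basisFun (Fin n) ℝ i = (basisVec i : Rn n) := fun i => by
    simp [basisVec]
  simp only [h, lineDeriv_toSchwartz]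
  ext x
  rw [sum_apply, toSchwartz_apply]
  simp only [toSchwartz_apply]
  rw [← Complex.ofReal_sum]
  rfl

end FormSubordination

end

/-! ### Boundedness of the resolvent. -/

noncomputable section

namespace FormSubordination

open Metric Filter Topology
open scoped ENNReal Convolution

variable {n : ℕ}

theorem memLp_top_of_bounded {f : Rn n → ℂ} (hf : StronglyMeasurable f) {M : ℝ}
    (hM : ∀ x, ‖f x‖ ≤ M) : MemLp f ⊤ volume :=
  memLp_top_of_bound hf.aestronglyMeasurable M (Eventually.of_forall hM)

theorem integrable_mul_of_bounded {f : Rn n → ℂ} (hf : StronglyMeasurable f) {M : ℝ}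
    (hM : ∀ x, ‖f x‖ ≤ M) {g : Rn n → ℂ} (hg : Integrable g) : Integrable fun x => g x * f x :=
  hg.mul_bdd hf.aestronglyMeasurable (Eventually.of_forall hM)

/-- A form subordinate distribution is tempered, and its resolvent is a bounded function. -/
theorem TrudingerSubordinate.exists_bounded_resolvent {Q : Distr n} {β : ℝ} (hn : 0 < n)
    (hβ : 0 < β) (h : TrudingerSubordinate Q β) :
    ∃ (T : Tempered n) (γ : Rn n → ℂ) (M : ℝ), Agrees T Q ∧ StronglyMeasurable γ ∧
      (∀ x, ‖γ x‖ ≤ M) ∧ ∀ φ : 𝓢(Rn n, ℂ), resolvent n T φ = ∫ x, φ x * γ x := by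
  obtain ⟨ε₀, hε₀, c, hc, hL⟩ := h.formBdd
  obtain ⟨F, q, M, hF, hq, hFM, hqM, hdec⟩ := hL.exists_decomposition hn hβ hε₀ hc
  have hb : StronglyMeasurable fun x => q x - F x := hq.sub hF
  have hbM : ∀ x, ‖q x - F x‖ ≤ M + M := fun x =>
    (norm_sub_le _ _).trans (add_le_add (hqM x) (hFM x))
  have hFL := memLp_top_of_bounded hF hFM
  have hqL := memLp_top_of_bounded hq hqM
  have hbL := memLp_top_of_bounded hb hbM
  have hAm := stronglyMeasurable_besselAverage hb
  have hAM := norm_besselAverage_le hbM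
  -- The resolvent comes from `(1 - Δ)⁻¹ (q - ΔF) = F + (1 - Δ)⁻¹ (q - F)`.
  refine ⟨ofBounded hqL - Δ (ofBounded hFL), fun x => F x + besselAverage (fun x => q x - F x) x,
    M + (M + M), fun φ => ?_, hF.add hAm,
    fun x => (norm_add_le _ _).trans (add_le_add (hFM x) (hAM x)), fun φ => ?_⟩
  · rw [sub_apply, TemperedDistribution.laplacian_apply_apply, laplacian_toSchwartz,
      ofBounded_apply, ofBounded_apply, ← eval_coe, hdec _ (isTest_coe φ)]
    rfl
  · have h1 : ofBounded hqL - ofBounded hFL = ofBounded hbL := by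
      ext φ
      rw [sub_apply, ofBounded_apply, ofBounded_apply, ofBounded_apply,
        ← integral_sub (integrable_mul_of_bounded hq hqM φ.integrable)
          (integrable_mul_of_bounded hF hFM φ.integrable)]
      simp only [mul_sub]
    have h2 : resolvent n (ofBounded hqL - Δ (ofBounded hFL)) =
        ofBounded hFL + resolvent n (ofBounded hbL) := by
      rw [← h1, map_sub, map_sub, resolvent_laplacian]
      abel
    rw [h2, add_apply, resolvent_ofBounded hb hbM hbL, ofBounded_apply,
      ← integral_add (integrable_mul_of_bounded hF hFM φ.integrable)
        (integrable_mul_of_bounded hAm hAM φ.integrable)]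
    simp only [mul_add]

/-! ### Mollification of weak solutions -/

/-- The functional `f ↦ ∫ γ (f - Δf)`, i.e. `γ - Δγ` in the sense of distributions. -/
def weakPairing (γ : Rn n → ℝ) (f : Rn n → ℝ) : ℂ := ((∫ x, (f x - lap f x) * γ x : ℝ) : ℂ)

/-- A bounded function `γ` for which the form of the distribution `γ - Δγ` is bounded. -/
structure WeakAdmissible (β ε₀ c M : ℝ) (γ : Rn n → ℝ) : Prop where
  measurable : StronglyMeasurable γ
  bound : ∀ x, |γ x| ≤ M
  form : FormBdd β ε₀ c (weakPairing γ)

theorem pd_comp_sub (f : Rn n → ℝ) (z : Rn n) (i : Fin n) :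
    pd i (fun y => f (y - z)) = fun y => pd i f (y - z) := by
  funext y
  simp only [pd, sub_eq_add_neg, fderiv_comp_add_right]

theorem lap_comp_sub (f : Rn n → ℝ) (z : Rn n) :
    lap (fun y => f (y - z)) = fun y => lap f (y - z) := by
  funext y
  refine Finset.sum_congr rfl fun i _ => ?_
  rw [pd_comp_sub, pd_comp_sub]

theorem IsTest.comp_sub {f : Rn n → ℝ} (hf : IsTest f) (z : Rn n) : IsTest fun y => f (y - z) :=
  ⟨hf.1.comp (by fun_prop), hf.2.comp_homeomorph (Homeomorph.subRight z)⟩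

theorem IsTest.sub {f g : Rn n → ℝ} (hf : IsTest f) (hg : IsTest g) :
    IsTest fun x => f x - g x := by
  simpa [sub_eq_add_neg] using hf.add (hg.const_mul (-1))

theorem integral_mul_lap {f g : Rn n → ℝ} (hf : ContDiff ℝ ∞ f) (hg : IsTest g) :
    ∫ x, g x * lap f x = ∫ x, lap g x * f x := by
  have hf1 : ContDiff ℝ 1 f := hf.of_le (by simp)
  simp only [lap, Finset.mul_sum, Finset.sum_mul]
  rw [integral_finsetSum _ fun i _ => (hg.mul (contDiff_pd (contDiff_pd hf i) i)).integrable,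
    integral_finsetSum _ fun i _ => (((hg.pd i).pd i).mul hf).integrable]
  refine Finset.sum_congr rfl fun i _ => ?_
  have h1 := integral_smul_pd_left hg.contDiff_one hg.2 ((contDiff_pd hf i).of_le (by simp)) i
  have h2 := integral_smul_pd_left (hg.pd i).contDiff_one (hg.pd i).2 hf1 i
  simp only [smul_eq_mul] at h1 h2
  rw [h1, h2, neg_neg]

theorem locallyIntegrable_of_bounded {γ : Rn n → ℝ} (hγ : StronglyMeasurable γ) {M : ℝ}
    (hM : ∀ x, |γ x| ≤ M) : LocallyIntegrable γ :=
  (memLp_top_of_bound hγ.aestronglyMeasurable M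
    (Eventually.of_forall hM)).locallyIntegrable le_top

theorem av_one_eq_convolution (χ : Rn n → ℝ) (γ : Rn n → ℝ) :
    av χ 1 γ = (χ ⋆[ContinuousLinearMap.lsmul ℝ ℝ, volume] γ) := by
  funext x
  simp [av, convolution]

theorem contDiff_av_one {χ : Rn n → ℝ} (hχ : IsTest χ) {γ : Rn n → ℝ} (hγ : LocallyIntegrable γ) :
    ContDiff ℝ ∞ (av χ 1 γ) := by
  rw [av_one_eq_convolution]
  exact hχ.2.contDiff_convolution_left _ hχ.1 hγ

theorem pd_av_one {χ : Rn n → ℝ} (hχ : IsTest χ) {γ : Rn n → ℝ} (hγ : LocallyIntegrable γ)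
    (i : Fin n) : pd i (av χ 1 γ) = av (pd i χ) 1 γ := by
  funext x
  have h := hχ.2.hasFDerivAt_convolution_left (ContinuousLinearMap.lsmul ℝ ℝ)
    hχ.contDiff_one hγ x
  rw [pd, av_one_eq_convolution, h.fderiv, convolution, ContinuousLinearMap.integral_apply]
  · simp [av, pd]
  · exact HasCompactSupport.convolutionExists_left _ (hχ.2.fderiv (𝕜 := ℝ))
      (hχ.contDiff_one.continuous_fderiv (by simp)) hγ x

/-- Testing a mollification with `h` is averaging the tests of `γ` with the translates of `h`. -/
theorem WeakAdmissible.integral_mul_av {β ε₀ c M : ℝ} {γ χ h : Rn n → ℝ}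
    (hγ : WeakAdmissible β ε₀ c M γ) (hχ : IsTest χ) (hh : IsTest h) :
    ∫ x, h x * av χ 1 γ x = ∫ z, χ (-z) * ∫ y, h (y - z) * γ y := by
  have hli := locallyIntegrable_of_bounded hγ.measurable hγ.bound
  have h1 := integral_smul_av hχ.continuous hχ.2 hh.continuous hh.2 hli 1
  simp only [smul_eq_mul] at h1
  rw [h1]
  have hInt : Integrable (Function.uncurry fun (y z : Rn n) => χ (-z) * h (y - z) * γ y)
      (volume.prod volume) := by
    have h2 : Integrable (fun p : Rn n × Rn n => χ (-p.2) * h (p.1 - p.2))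
        (volume.prod volume) := by
      have hc : Continuous fun p : Rn n × Rn n => χ (-p.2) * h (p.1 - p.2) := by
        have := hχ.continuous
        have := hh.continuous
        fun_prop
      refine hc.integrable_of_hasCompactSupport ?_
      have hK : IsCompact ((fun p : Rn n × Rn n => (p.1 - p.2, -p.2)) ''
        (tsupport h ×ˢ tsupport χ)) := (hh.2.prod hχ.2).image (by fun_prop)
      refine HasCompactSupport.intro hK fun p hp => ?_
      by_contra hne
      refine hp ⟨(p.1 - p.2, -p.2), ⟨subset_tsupport _ (right_ne_zero_of_mul hne),
        subset_tsupport _ (left_ne_zero_of_mul hne)⟩, by simp⟩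
    exact h2.mul_bdd (hγ.measurable.comp_measurable measurable_fst).aestronglyMeasurable
      (Eventually.of_forall fun p => hγ.bound p.1)
  have h3 := integral_integral_swap hInt
  simp only [av, one_smul, smul_eq_mul, ← integral_mul_const, ← integral_const_mul]
  simpa only [mul_assoc] using h3

/-- Both sides of the form bound are compatible with translations, and a mollification by a
nonnegative kernel of mass one is an average of translates. Hence all constants are preserved. -/
theorem WeakAdmissible.mollify {β ε₀ c M : ℝ} {γ χ : Rn n → ℝ} (hγ : WeakAdmissible β ε₀ c M γ)
    (hχ : IsTest χ) (hχ0 : ∀ z, 0 ≤ χ z) (hχ1 : ∫ z, χ z = 1) :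
    Admissible β ε₀ c M (av χ 1 γ) := by
  have hli := locallyIntegrable_of_bounded hγ.measurable hγ.bound
  have hv := contDiff_av_one hχ hli
  set v := av χ 1 γ with hvdef
  have hq : ContDiff ℝ ∞ fun x => v x - lap v x := hv.sub (contDiff_lap hv)
  have hi : ∀ {f : Rn n → ℝ}, IsTest f → Integrable fun x => (v x - lap v x) * f x := fun hf => by
    simpa only [mul_comm] using (hf.mul hq).integrable
  refine ⟨hv, fun x => ?_, ⟨fun f g hf hg => ?_, fun a f hf => ?_, fun ε hε hεε₀ u hu => ?_⟩⟩
  · have h := abs_av_le hχ hγ.bound 1 x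
    simp only [abs_of_nonneg (hχ0 _), hχ1, one_mul] at h
    exact h
  · simp only [pairing, mul_add]
    rw [integral_add (hi hf) (hi hg), Complex.ofReal_add]
  · rw [pairing, pairing, ← Complex.ofReal_mul, ← integral_const_mul]
    congr 2
    funext x
    ring
  · have hg : IsTest fun x => u x ^ 2 := hu.sq
    set g : Rn n → ℝ := fun x => u x ^ 2 with hgdef
    have e1 : ∫ x, (v x - lap v x) * g x = ∫ x, (g x - lap g x) * v x := by
      have h1 := integral_mul_lap hv hg
      calc ∫ x, (v x - lap v x) * g x = (∫ x, g x * v x) - ∫ x, g x * lap v x := by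
            rw [← integral_sub (hg.mul hv).integrable (hg.mul (contDiff_lap hv)).integrable]
            congr 1
            funext x
            ring
        _ = (∫ x, g x * v x) - ∫ x, lap g x * v x := by rw [h1]
        _ = _ := by
            rw [← integral_sub (hg.mul hv).integrable (hg.lap.mul hv).integrable]
            simp only [sub_mul]
    rw [pairing, e1, hvdef, hγ.integral_mul_av hχ (hg.sub hg.lap), Complex.norm_real]
    set B := ε * dirichlet u + c * ε ^ (-β) * ∫ x, u x ^ 2 with hB
    have hb : ∀ z, |∫ y, (g (y - z) - lap g (y - z)) * γ y| ≤ B := by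
      intro z
      have h2 := hγ.form.bound ε hε hεε₀ _ (hu.comp_sub z)
      rw [weakPairing, Complex.norm_real, Real.norm_eq_abs] at h2
      have e2 : lap (fun y => u (y - z) ^ 2) = fun y => lap g (y - z) := lap_comp_sub g z
      have e3 : dirichlet (fun y => u (y - z)) = dirichlet u := by
        simp only [dirichlet, pd_comp_sub]
        exact integral_sub_right_eq_self (fun y => ∑ i, pd i u y ^ 2) z
      rw [e2, e3, integral_sub_right_eq_self (fun y => u y ^ 2) z] at h2
      exact h2
    have hχi : Integrable fun z => χ (-z) := hχ.integrable.comp_neg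
    have h3 : ‖∫ z, χ (-z) * ∫ y, (g (y - z) - lap g (y - z)) * γ y‖ ≤ ∫ z, χ (-z) * B := by
      refine norm_integral_le_of_norm_le (hχi.mul_const B) (Eventually.of_forall fun z => ?_)
      rw [norm_mul, Real.norm_of_nonneg (hχ0 _)]
      exact mul_le_mul_of_nonneg_left (hb z) (hχ0 _)
    rwa [integral_mul_const, integral_neg_eq_self χ, hχ1, one_mul] at h3

end FormSubordination

end

noncomputable section

namespace FormSubordination

open Metric Filter Topology
open scoped ENNReal Convolution

variable {n : ℕ}

/-! ### The weak gradient of a weak solution -/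

/-- Bump functions with radii tending to zero. -/
def shrinkingBump (n k : ℕ) : ContDiffBump (0 : Rn n) :=
  ⟨1 / ((k : ℝ) + 1) / 2, 1 / ((k : ℝ) + 1), by positivity, half_lt_self (by positivity)⟩

/-- The normalized shrinking bump functions. -/
def mollifier (n k : ℕ) : Rn n → ℝ := (shrinkingBump n k).normed volume

theorem isTest_mollifier (n k : ℕ) : IsTest (mollifier n k) :=
  ⟨(shrinkingBump n k).contDiff_normed, (shrinkingBump n k).hasCompactSupport_normed⟩

theorem tendsto_av_mollifier {g : Rn n → ℝ} (hg : LocallyIntegrable g) :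
    ∀ᵐ x, Tendsto (fun k => av (mollifier n k) 1 g x) atTop (𝓝 (g x)) := by
  simp only [av_one_eq_convolution]
  refine ContDiffBump.ae_convolution_tendsto_right_of_locallyIntegrable (K := 2)
    (φ := fun k => shrinkingBump n k) tendsto_one_div_add_atTop_nhds_zero_nat
    (Eventually.of_forall fun k => ?_) hg
  simp only [shrinkingBump]
  linarith

/-- Fatou's lemma, which also provides the integrability of the limit. -/
theorem setIntegral_le_of_tendsto {f : ℕ → Rn n → ℝ} {g : Rn n → ℝ} {s : Set (Rn n)} {C : ℝ}
    (hi : ∀ k, IntegrableOn (f k) s) (h0 : ∀ k x, 0 ≤ f k x)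
    (hlim : ∀ᵐ x ∂volume.restrict s, Tendsto (fun k => f k x) atTop (𝓝 (g x)))
    (hC : ∀ k, ∫ x in s, f k x ≤ C) : IntegrableOn g s ∧ ∫ x in s, g x ≤ C := by
  have hC0 : 0 ≤ C := (integral_nonneg fun x => h0 0 x).trans (hC 0)
  have hg0 : 0 ≤ᵐ[volume.restrict s] g := by
    filter_upwards [hlim] with x hx
    exact ge_of_tendsto' hx fun k => h0 k x
  have hgm : AEStronglyMeasurable g (volume.restrict s) :=
    aestronglyMeasurable_of_tendsto_ae atTop (fun k => (hi k).1) hlim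
  have hle : ∫⁻ x in s, ENNReal.ofReal (g x) ≤ ENNReal.ofReal C := by
    calc ∫⁻ x in s, ENNReal.ofReal (g x)
        = ∫⁻ x in s, liminf (fun k => ENNReal.ofReal (f k x)) atTop := by
          refine lintegral_congr_ae ?_
          filter_upwards [hlim] with x hx
          exact ((ENNReal.tendsto_ofReal hx).liminf_eq).symm
      _ ≤ liminf (fun k => ∫⁻ x in s, ENNReal.ofReal (f k x)) atTop :=
          lintegral_liminf_le' fun k => (hi k).1.aemeasurable.ennreal_ofReal
      _ ≤ ENNReal.ofReal C := by
          refine liminf_le_of_le (by isBoundedDefault) fun b hb => ?_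
          obtain ⟨k, hk⟩ := hb.exists
          refine hk.trans ?_
          rw [← ofReal_integral_eq_lintegral_ofReal (hi k) (Eventually.of_forall (h0 k))]
          exact ENNReal.ofReal_le_ofReal (hC k)
  have hgi : IntegrableOn g s := by
    refine ⟨hgm, ?_⟩
    rw [hasFiniteIntegral_iff_ofReal hg0]
    exact hle.trans_lt ENNReal.ofReal_lt_top
  refine ⟨hgi, ?_⟩
  rw [← ofReal_integral_eq_lintegral_ofReal hgi hg0] at hle
  exact (ENNReal.ofReal_le_ofReal_iff hC0).1 hle

/-- An integrable weight. -/
def weight (n : ℕ) (x : Rn n) : ℝ := (1 + ‖x‖) ^ (-((n : ℝ) + 1))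

theorem weight_pos (x : Rn n) : 0 < weight n x := by unfold weight; positivity

theorem continuous_weight (n : ℕ) : Continuous (weight n) := by
  unfold weight
  exact (continuous_const.add continuous_norm).rpow_const fun x =>
    Or.inl (by positivity : 0 < 1 + ‖x‖).ne'

theorem integrable_weight (n : ℕ) : Integrable (weight n) :=
  integrable_one_add_norm (by simp)

theorem weight_le {x y : Rn n} (h : x ∈ ball y 1) :
    weight n x ≤ 2 ^ ((n : ℝ) + 1) * weight n y := by
  rw [mem_ball, dist_eq_norm] at h
  have h1 : ‖y‖ ≤ ‖x‖ + ‖x - y‖ := by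
    have := norm_sub_le x (x - y)
    rwa [sub_sub_cancel] at this
  have h2 : 1 + ‖y‖ ≤ 2 * (1 + ‖x‖) := by linarith [norm_nonneg x]
  have h3 : (2 * (1 + ‖x‖)) ^ (-((n : ℝ) + 1)) ≤ (1 + ‖y‖) ^ (-((n : ℝ) + 1)) :=
    Real.rpow_le_rpow_of_nonpos (by positivity) h2 (by linarith [n.cast_nonneg (α := ℝ)])
  rw [Real.mul_rpow (by norm_num) (by positivity), Real.rpow_neg (by norm_num),
    inv_mul_le_iff₀ (by positivity)] at h3
  exact h3

/-- Apply Tonelli to pairs of points at distance less than one, where the weights are comparable.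
Uniform bounds on unit balls thus become a single global weighted bound, to which one Hilbert space
argument applies. -/
theorem integral_mul_weight_le {f : Rn n → ℝ} (hf : Continuous f) (hf0 : ∀ x, 0 ≤ f x) {C : ℝ}
    (hC : ∀ y, ∫ x in ball y 1, f x ≤ C) :
    Integrable (fun x => f x * weight n x) ∧ ∫ x, f x * weight n x ≤
      (volume.real (ball (0 : Rn n) 1))⁻¹ * (2 ^ ((n : ℝ) + 1) * C * ∫ x, weight n x) := by
  have hC0 : 0 ≤ C := (integral_nonneg hf0).trans (hC 0)
  have hv := volume_real_ball_pos (0 : Rn n) one_pos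
  set V := volume.real (ball (0 : Rn n) 1) with hV
  have hvol : ∀ x : Rn n, volume (ball x 1) = ENNReal.ofReal V := by
    intro x
    rw [Measure.addHaar_ball_center, hV, ofReal_measureReal measure_ball_lt_top.ne]
  have hw := continuous_weight n
  have hI0 : 0 ≤ ∫ x, weight n x := integral_nonneg fun x => (weight_pos x).le
  have hCl : ∀ y, ∫⁻ x in ball y 1, ENNReal.ofReal (f x) ≤ ENNReal.ofReal C := by
    intro y
    rw [← ofReal_integral_eq_lintegral_ofReal _ (Eventually.of_forall hf0)]
    · exact ENNReal.ofReal_le_ofReal (hC y)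
    · exact (hf.continuousOn.integrableOn_compact (isCompact_closedBall y 1)).mono_set
        ball_subset_closedBall
  set S : Set (Rn n × Rn n) := {p | dist p.2 p.1 < 1}
  have hS : MeasurableSet S := (isOpen_lt (by fun_prop) continuous_const).measurableSet
  set k : Rn n → Rn n → ℝ≥0∞ := fun x y =>
    S.indicator (fun p => ENNReal.ofReal (f p.1 * weight n p.1)) (x, y) with hk
  have hfw : Measurable fun x => f x * weight n x := (hf.mul hw).measurable
  have hkm : AEMeasurable (Function.uncurry k) (volume.prod volume) := by
    refine (Measurable.indicator ?_ hS).aemeasurable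
    exact (hfw.comp measurable_fst).ennreal_ofReal
  have e1 : ∀ x, ∫⁻ y, k x y = ENNReal.ofReal (f x * weight n x) * ENNReal.ofReal V := by
    intro x
    have : k x = (ball x 1).indicator fun _ => ENNReal.ofReal (f x * weight n x) := by
      funext y
      by_cases h : y ∈ ball x 1
      · rw [Set.indicator_of_mem h]
        exact Set.indicator_of_mem (show (x, y) ∈ S from h) _
      · rw [Set.indicator_of_notMem h]
        exact Set.indicator_of_notMem (show (x, y) ∉ S from h) _
    rw [this, lintegral_indicator measurableSet_ball, setLIntegral_const, hvol]
  have e2 : ∀ y, ∫⁻ x, k x y ≤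
      ENNReal.ofReal (2 ^ ((n : ℝ) + 1) * C) * ENNReal.ofReal (weight n y) := by
    intro y
    have : (fun x => k x y) = (ball y 1).indicator fun x => ENNReal.ofReal (f x * weight n x) := by
      funext x
      by_cases h : x ∈ ball y 1
      · rw [Set.indicator_of_mem h]
        exact Set.indicator_of_mem (show (x, y) ∈ S from mem_ball_comm.1 h) _
      · rw [Set.indicator_of_notMem h]
        exact Set.indicator_of_notMem (show (x, y) ∉ S from fun h' => h (mem_ball_comm.1 h')) _
    rw [this, lintegral_indicator measurableSet_ball]
    calc ∫⁻ x in ball y 1, ENNReal.ofReal (f x * weight n x)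
        ≤ ∫⁻ x in ball y 1, ENNReal.ofReal (2 ^ ((n : ℝ) + 1) * weight n y) *
            ENNReal.ofReal (f x) := by
          refine setLIntegral_mono' measurableSet_ball fun x hx => ?_
          rw [← ENNReal.ofReal_mul (mul_nonneg (by positivity) (weight_pos y).le)]
          refine ENNReal.ofReal_le_ofReal ?_
          rw [mul_comm]
          exact mul_le_mul_of_nonneg_right (weight_le hx) (hf0 x)
      _ = ENNReal.ofReal (2 ^ ((n : ℝ) + 1) * weight n y) *
            ∫⁻ x in ball y 1, ENNReal.ofReal (f x) :=
          lintegral_const_mul _ hf.measurable.ennreal_ofReal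
      _ ≤ ENNReal.ofReal (2 ^ ((n : ℝ) + 1) * weight n y) * ENNReal.ofReal C := by
          gcongr
          exact hCl y
      _ = _ := by
          rw [← ENNReal.ofReal_mul (mul_nonneg (by positivity) (weight_pos y).le),
            ← ENNReal.ofReal_mul (by positivity)]
          congr 1
          ring
  have key : (∫⁻ x, ENNReal.ofReal (f x * weight n x)) * ENNReal.ofReal V ≤
      ENNReal.ofReal (2 ^ ((n : ℝ) + 1) * C * ∫ x, weight n x) := by
    calc (∫⁻ x, ENNReal.ofReal (f x * weight n x)) * ENNReal.ofReal V
        = ∫⁻ x, ∫⁻ y, k x y := by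
          simp only [e1]
          rw [lintegral_mul_const _ hfw.ennreal_ofReal]
      _ = ∫⁻ y, ∫⁻ x, k x y := lintegral_lintegral_swap hkm
      _ ≤ ∫⁻ y, ENNReal.ofReal (2 ^ ((n : ℝ) + 1) * C) * ENNReal.ofReal (weight n y) :=
          lintegral_mono e2
      _ = _ := by
          rw [lintegral_const_mul _ hw.measurable.ennreal_ofReal,
            ← ofReal_integral_eq_lintegral_ofReal (integrable_weight n)
              (Eventually.of_forall fun x => (weight_pos x).le),
            ← ENNReal.ofReal_mul (by positivity)]
  have hfw0 : ∀ x, 0 ≤ f x * weight n x := fun x => mul_nonneg (hf0 x) (weight_pos x).le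
  have key2 : ∫⁻ x, ENNReal.ofReal (f x * weight n x) ≤
      ENNReal.ofReal (V⁻¹ * (2 ^ ((n : ℝ) + 1) * C * ∫ x, weight n x)) := by
    rw [mul_comm V⁻¹, ← div_eq_mul_inv, ENNReal.ofReal_div_of_pos hv]
    rwa [ENNReal.le_div_iff_mul_le (Or.inl (by simpa using hv)) (Or.inl ENNReal.ofReal_ne_top)]
  have hInt : Integrable fun x => f x * weight n x := by
    refine ⟨(hf.mul hw).aestronglyMeasurable, ?_⟩
    rw [hasFiniteIntegral_iff_ofReal (Eventually.of_forall hfw0)]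
    exact key2.trans_lt ENNReal.ofReal_lt_top
  refine ⟨hInt, ?_⟩
  rw [← ofReal_integral_eq_lintegral_ofReal hInt (Eventually.of_forall hfw0)] at key2
  exact (ENNReal.ofReal_le_ofReal_iff (by positivity)).1 key2

section

variable {β ε₀ c M : ℝ} {γ : Rn n → ℝ}

theorem WeakAdmissible.admissible (hγ : WeakAdmissible β ε₀ c M γ) (k : ℕ) :
    Admissible β ε₀ c M (av (mollifier n k) 1 γ) :=
  hγ.mollify (isTest_mollifier n k) (fun z => (shrinkingBump n k).nonneg_normed z)
    (shrinkingBump n k).integral_normed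

/-- The gradients of the mollifications are uniformly bounded in a weighted `L²` space. So `φ ↦ ∫
∂ᵢφ γ` is bounded in the dual weighted norm and is represented by a function. The sign is such that
`g = -∂ᵢγ`, a component of the field sought. -/
theorem WeakAdmissible.exists_weak_deriv (hβ : 0 < β) (hε₀ : 0 < ε₀) (hc : 0 < c) (hM : 0 ≤ M)
    (hγ : WeakAdmissible β ε₀ c M γ) (i : Fin n) : ∃ g : Rn n → ℝ, LocallyIntegrable g ∧
      ∀ φ, IsTest φ → ∫ x, pd i φ x * γ x = ∫ x, φ x * g x := by
  obtain ⟨C, hC, hgrad⟩ := exists_gradient_bound (n := n) hβ hε₀ hc hM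
  have hli := locallyIntegrable_of_bounded hγ.measurable hγ.bound
  set v : ℕ → Rn n → ℝ := fun k => av (mollifier n k) 1 γ with hv
  have hadm : ∀ k, Admissible β ε₀ c M (v k) := hγ.admissible
  have hv1 : ∀ k, ContDiff ℝ 1 (v k) := fun k => (hadm k).contDiff.of_le (by simp)
  set C' := (volume.real (ball (0 : Rn n) 1))⁻¹ * (2 ^ ((n : ℝ) + 1) * C * ∫ x, weight n x)
    with hC'
  have hpw : ∀ k, Integrable (fun x => pd i (v k) x ^ 2 * weight n x) ∧
      ∫ x, pd i (v k) x ^ 2 * weight n x ≤ C' := by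
    intro k
    have hcont : ∀ j, Continuous fun x => pd j (v k) x ^ 2 := fun j => (continuous_pd (hv1 k) j).pow 2
    refine integral_mul_weight_le (hcont i) (fun _ => sq_nonneg _)
      fun y => le_trans ?_ (hgrad _ (hadm k) y)
    have hInt : ∀ {f : Rn n → ℝ}, Continuous f → IntegrableOn f (ball y 1) := fun hf =>
      (hf.continuousOn.integrableOn_compact (isCompact_closedBall y 1)).mono_set
        ball_subset_closedBall
    refine integral_mono (hInt (hcont i)) (hInt (continuous_finsetSum _ fun j _ => hcont j))
      fun x => ?_
    exact Finset.single_le_sum (f := fun j => pd j (v k) x ^ 2) (fun j _ => sq_nonneg _)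
      (Finset.mem_univ i)
  -- The product `φ ∂ᵢv` is split as `(φ w)` times `∂ᵢv √weight`, and Young's inequality with
  -- parameter `t` is applied.
  set w : Rn n → ℝ := fun x => (√(weight n x))⁻¹ with hw
  have hwc : Continuous w :=
    (continuous_weight n).sqrt.inv₀ fun x => (Real.sqrt_pos.2 (weight_pos x)).ne'
  have hiφ : ∀ {φ : Rn n → ℝ}, IsTest φ → Integrable fun x => (φ x * w x) ^ 2 := by
    intro φ hφ
    refine ((hφ.continuous.mul hwc).pow 2).integrable_of_hasCompactSupport ?_
    exact HasCompactSupport.intro hφ.2 fun x hx => by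
      simp [image_eq_zero_of_notMem_tsupport hx]
  have hbound : ∀ φ, IsTest φ → |∫ x, pd i φ x * γ x| ≤
      1 / 2 * (1 + C') * √(∫ x, ∑ _j : Unit, (φ x * w x) ^ 2) := by
    intro φ hφ
    simp only [Finset.univ_unique, Finset.sum_const, Finset.card_singleton, one_smul]
    refine le_of_forall_weighted_le (Real.sqrt_nonneg _) fun t ht => ?_
    rw [Real.sq_sqrt (integral_nonneg fun _ => sq_nonneg _), one_mul]
    have hlim : Tendsto (fun k => ∫ x, pd i φ x * v k x) atTop (𝓝 (∫ x, pd i φ x * γ x)) := by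
      refine tendsto_integral_of_dominated_convergence (fun x => |pd i φ x| * M)
        (fun k => ((hφ.pd i).continuous.mul (hv1 k).continuous).aestronglyMeasurable)
        ((hφ.pd i).integrable.abs.mul_const M)
        (fun k => Eventually.of_forall fun x => ?_) ?_
      · rw [norm_mul]
        exact mul_le_mul_of_nonneg_left ((hadm k).bound x) (abs_nonneg _)
      · filter_upwards [tendsto_av_mollifier hli] with x hx
        exact hx.const_mul _
    refine le_of_tendsto' hlim.abs fun k => ?_
    have hip := integral_smul_pd_left hφ.contDiff_one hφ.2 (hv1 k) i
    simp only [smul_eq_mul] at hip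
    rw [← abs_neg, ← hip, ← Real.norm_eq_abs]
    have hdom : Integrable fun x => 1 / 2 * (t * (φ x * w x) ^ 2 +
        t⁻¹ * (pd i (v k) x ^ 2 * weight n x)) :=
      (((hiφ hφ).const_mul t).add ((hpw k).1.const_mul t⁻¹)).const_mul _
    refine (norm_integral_le_of_norm_le hdom (Eventually.of_forall fun x => ?_)).trans ?_
    · set s := √(weight n x) with hs
      have hs0 : 0 < s := Real.sqrt_pos.2 (weight_pos x)
      have hsw : weight n x = s ^ 2 := (Real.sq_sqrt (weight_pos x).le).symm
      have hr : √t ^ 2 = t := Real.sq_sqrt (le_of_lt ht)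
      have hr0 : 0 < √t := Real.sqrt_pos.2 ht
      have e : φ x * pd i (v k) x = (√t * (φ x * w x)) * ((√t)⁻¹ * (pd i (v k) x * s)) := by
        simp only [hw, ← hs]
        field_simp
      rw [Real.norm_eq_abs, e, hsw]
      have h1 : t * (φ x * w x) ^ 2 = (√t * (φ x * w x)) ^ 2 := by rw [mul_pow √t, hr]
      have h2 : t⁻¹ * (pd i (v k) x ^ 2 * s ^ 2) = ((√t)⁻¹ * (pd i (v k) x * s)) ^ 2 := by
        rw [mul_pow, inv_pow, hr, mul_pow]
      rw [h1, h2, abs_le]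
      constructor
      · nlinarith [sq_nonneg (√t * (φ x * w x) + (√t)⁻¹ * (pd i (v k) x * s))]
      · nlinarith [sq_nonneg (√t * (φ x * w x) - (√t)⁻¹ * (pd i (v k) x * s))]
    · rw [integral_const_mul, integral_add ((hiφ hφ).const_mul t) ((hpw k).1.const_mul t⁻¹),
        integral_const_mul, integral_const_mul]
      have := mul_le_mul_of_nonneg_left (hpw k).2 (inv_pos.2 ht).le
      linarith
  have hiγ : ∀ {φ : Rn n → ℝ}, IsTest φ → Integrable fun x => pd i φ x * γ x := fun hφ =>
    hli.integrable_smul_left_of_hasCompactSupport (hφ.pd i).continuous (hφ.pd i).2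
  obtain ⟨F, hF, hrep⟩ := exists_integral_rep (ι := Unit)
    (L := fun φ => ∫ x, pd i φ x * γ x) (D := fun _ φ x => φ x * w x)
    (fun f g hf hg => by
      rw [← integral_add (hiγ hf) (hiγ hg)]
      simp only [pd_add hf.contDiff_one hg.contDiff_one, add_mul])
    (fun a f hf => by
      rw [← integral_const_mul]
      simp only [pd_const_mul hf.contDiff_one, mul_assoc])
    (fun _ f g _ _ => by simp only [add_mul])
    (fun _ a f _ => by simp only [mul_assoc])
    (fun _ f hf => ⟨hf.continuous.mul hwc, hf.2.mul_right⟩) hbound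
  refine ⟨fun x => w x * F () x, ?_, fun φ hφ => ?_⟩
  · have h1 : LocallyIntegrable (F ()) := (hF ()).2.locallyIntegrable (by norm_num)
    rw [← locallyIntegrableOn_univ] at h1 ⊢
    exact h1.continuousOn_mul hwc.continuousOn isOpen_univ.isLocallyClosed
  · rw [hrep φ hφ]
    simp only [Finset.univ_unique, Finset.sum_singleton, mul_assoc]

/-- The gradients of the mollifications are themselves mollifications of `-g i`, so they converge
almost everywhere, and Fatou carries the a priori bounds to the limit. -/
theorem WeakAdmissible.exists_gradient (hn : 0 < n) (hβ : 0 < β) (hε₀ : 0 < ε₀) (hc : 0 < c)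
    (hM : 0 ≤ M) (hγ : WeakAdmissible β ε₀ c M γ) : ∃ (g : Fin n → Rn n → ℝ) (C : ℝ), 0 ≤ C ∧
      (∀ i, LocallyIntegrable (g i)) ∧
      (∀ i φ, IsTest φ → ∫ x, pd i φ x * γ x = ∫ x, φ x * g i x) ∧
      (∀ x₀, IntegrableOn (fun x => ∑ i, g i x ^ 2) (ball x₀ 1) ∧
        ∫ x in ball x₀ 1, ∑ i, g i x ^ 2 ≤ C) ∧
      ∀ (x₀ : Rn n) (δ : ℝ), 0 < δ → δ ≤ 1 → ∃ b : Fin n → ℝ,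
        IntegrableOn (fun x => ∑ i, (g i x - b i) ^ 2) (ball x₀ δ) ∧
        ∫ x in ball x₀ δ, ∑ i, (g i x - b i) ^ 2 ≤
          C * δ ^ ((n : ℝ) + 2 * ((1 - β) / (1 + β))) := by
  obtain ⟨ρ, σ, hk⟩ := exists_kernelPair hn
  obtain ⟨C₁, hC₁, h₁⟩ := exists_gradient_bound (n := n) hβ hε₀ hc hM
  obtain ⟨C₂, hC₂, h₂⟩ := hk.exists_gradient_oscillation hβ hε₀ hc hM
  choose g hg hgw using hγ.exists_weak_deriv hβ hε₀ hc hM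
  have hli := locallyIntegrable_of_bounded hγ.measurable hγ.bound
  set v : ℕ → Rn n → ℝ := fun k => av (mollifier n k) 1 γ with hv
  have hadm : ∀ k, Admissible β ε₀ c M (v k) := hγ.admissible
  have hv1 : ∀ k, ContDiff ℝ 1 (v k) := fun k => (hadm k).contDiff.of_le (by simp)
  have hpd : ∀ k i x, pd i (v k) x = -av (mollifier n k) 1 (g i) x := by
    intro k i x
    have ht := (isTest_mollifier n k).dil_sub one_pos x
    have h := hgw i _ ht
    rw [hv, pd_av_one (isTest_mollifier n k) hli, av_eq_integral_dil_sub _ one_pos,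
      av_eq_integral_dil_sub _ one_pos]
    simp only [smul_eq_mul]
    rw [← h, ← integral_neg]
    refine integral_congr_ae (Eventually.of_forall fun y => ?_)
    simp only
    rw [pd_dil_sub (isTest_mollifier n k) one_pos]
    simp
  have hlim : ∀ᵐ x, ∀ i, Tendsto (fun k => pd i (v k) x) atTop (𝓝 (-g i x)) := by
    rw [ae_all_iff]
    intro i
    filter_upwards [tendsto_av_mollifier (hg i)] with x hx
    simp only [hpd]
    exact hx.neg
  have hInt : ∀ (k : ℕ) (b : Fin n → ℝ) (x₀ : Rn n) (r : ℝ),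
      IntegrableOn (fun x => ∑ i, (pd i (v k) x - b i) ^ 2) (ball x₀ r) := by
    intro k b x₀ r
    have hcont : Continuous fun x => ∑ i, (pd i (v k) x - b i) ^ 2 :=
      continuous_finsetSum _ fun i _ => ((continuous_pd (hv1 k) i).sub continuous_const).pow 2
    exact (hcont.continuousOn.integrableOn_compact (isCompact_closedBall x₀ r)).mono_set
      ball_subset_closedBall
  refine ⟨g, C₁ + C₂, by positivity, hg, hgw, fun x₀ => ?_, fun x₀ δ hδ hδ1 => ?_⟩
  · have h := setIntegral_le_of_tendsto (s := ball x₀ 1) (C := C₁ + C₂)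
      (f := fun k x => ∑ i, pd i (v k) x ^ 2) (g := fun x => ∑ i, (-g i x) ^ 2)
      (fun k => by simpa using hInt k 0 x₀ 1)
      (fun k x => Finset.sum_nonneg fun _ _ => sq_nonneg _)
      (ae_restrict_of_ae (hlim.mono fun x hx => tendsto_finsetSum _ fun i _ => (hx i).pow 2))
      (fun k => (h₁ _ (hadm k) x₀).trans (by linarith))
    simpa using h
  · choose b hb hbi using fun k => h₂ _ (hadm k) x₀ δ hδ hδ1
    -- The constants subtracted on the ball vary with the mollification. Being bounded by `C₂ *
    -- δ⁻¹`, they converge along a subsequence.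
    obtain ⟨a, -, θ, hθ, hθa⟩ := tendsto_subseq_of_bounded
      (isBounded_closedBall (x := (0 : Fin n → ℝ)) (r := C₂ * δ⁻¹)) (x := b) (fun k => by
        rw [mem_closedBall_zero_iff, pi_norm_le_iff_of_nonneg (by positivity)]
        exact hb k)
    rw [tendsto_pi_nhds] at hθa
    refine ⟨fun i => -a i, ?_⟩
    have h := setIntegral_le_of_tendsto (s := ball x₀ δ)
      (C := (C₁ + C₂) * δ ^ ((n : ℝ) + 2 * ((1 - β) / (1 + β))))
      (f := fun k x => ∑ i, (pd i (v (θ k)) x - b (θ k) i) ^ 2)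
      (g := fun x => ∑ i, (-g i x - a i) ^ 2)
      (fun k => hInt (θ k) (b (θ k)) x₀ δ)
      (fun k x => Finset.sum_nonneg fun _ _ => sq_nonneg _)
      (ae_restrict_of_ae (hlim.mono fun x hx => tendsto_finsetSum _ fun i _ =>
        (((hx i).comp hθ.tendsto_atTop).sub (hθa i)).pow 2))
      (fun k => (hbi (θ k)).trans (mul_le_mul_of_nonneg_right (by linarith) (by positivity)))
    have e : ∀ i x, (-g i x - a i) ^ 2 = (g i x - -a i) ^ 2 := fun i x => by ring
    simpa only [e] using h

end

end FormSubordination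

end

noncomputable section

namespace FormSubordination

open Metric Filter Topology
open scoped ENNReal Convolution

variable {n : ℕ}

/-! ### Necessity -/

section Complex

variable {γ : Rn n → ℂ} {M : ℝ}

theorem integral_ofReal_mul_eq (hγ : StronglyMeasurable γ) (hM : ∀ x, ‖γ x‖ ≤ M) {f : Rn n → ℝ}
    (hf : Integrable f) : ∫ x, (f x : ℂ) * γ x =
      ((∫ x, f x * (γ x).re : ℝ) : ℂ) + ((∫ x, f x * (γ x).im : ℝ) : ℂ) * Complex.I := by
  have hi := integrable_mul_of_bounded hγ hM hf.ofReal
  have h1 := integral_re_add_im (𝕜 := ℂ) hi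
  simpa using h1.symm

/-- The real and imaginary parts of the resolvent are weakly admissible. -/
theorem FormBdd.weakAdmissible {β ε₀ c : ℝ} {L : (Rn n → ℝ) → ℂ} (hL : FormBdd β ε₀ c L)
    (hγ : StronglyMeasurable γ) (hM : ∀ x, ‖γ x‖ ≤ M)
    (hw : ∀ f, IsTest f → L f = ∫ x, ((f x - lap f x : ℝ) : ℂ) * γ x) :
    WeakAdmissible β ε₀ c M (fun x => (γ x).re) ∧ WeakAdmissible β ε₀ c M (fun x => (γ x).im) := by
  have hre : ∀ f, IsTest f → weakPairing (fun x => (γ x).re) f = ((L f).re : ℂ) := by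
    intro f hf
    rw [weakPairing, hw f hf, integral_ofReal_mul_eq hγ hM (hf.sub hf.lap).integrable]
    simp
  have him : ∀ f, IsTest f → weakPairing (fun x => (γ x).im) f = ((L f).im : ℂ) := by
    intro f hf
    rw [weakPairing, hw f hf, integral_ofReal_mul_eq hγ hM (hf.sub hf.lap).integrable]
    simp
  refine ⟨⟨Complex.continuous_re.comp_stronglyMeasurable hγ,
      fun x => (Complex.abs_re_le_norm _).trans (hM x), fun f g hf hg => ?_, fun a f hf => ?_,
      fun ε hε hεε₀ u hu => ?_⟩, ⟨Complex.continuous_im.comp_stronglyMeasurable hγ,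
      fun x => (Complex.abs_im_le_norm _).trans (hM x), fun f g hf hg => ?_, fun a f hf => ?_,
      fun ε hε hεε₀ u hu => ?_⟩⟩
  · rw [hre _ hf, hre _ hg, hre _ (hf.add hg), hL.map_add _ _ hf hg, Complex.add_re,
      Complex.ofReal_add]
  · rw [hre _ hf, hre _ (hf.const_mul a), hL.map_mul _ _ hf, Complex.re_ofReal_mul,
      Complex.ofReal_mul]
  · rw [hre _ hu.sq, Complex.norm_real]
    exact (Complex.abs_re_le_norm _).trans (hL.bound ε hε hεε₀ u hu)
  · rw [him _ hf, him _ hg, him _ (hf.add hg), hL.map_add _ _ hf hg, Complex.add_im,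
      Complex.ofReal_add]
  · rw [him _ hf, him _ (hf.const_mul a), hL.map_mul _ _ hf, Complex.im_ofReal_mul,
      Complex.ofReal_mul]
  · rw [him _ hu.sq, Complex.norm_real]
    exact (Complex.abs_im_le_norm _).trans (hL.bound ε hε hεε₀ u hu)

end Complex

/-- The complex vector field with given real and imaginary parts. -/
def complexField (g h : Fin n → Rn n → ℝ) (x : Rn n) : Cn n :=
  WithLp.toLp 2 fun i => (g i x : ℂ) + (h i x : ℂ) * Complex.I

theorem norm_sub_complexField_sq (g h : Fin n → Rn n → ℝ) (a b : Fin n → ℝ) (x : Rn n) :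
    ‖complexField g h x - WithLp.toLp 2 fun i => (a i : ℂ) + (b i : ℂ) * Complex.I‖ ^ 2 =
      (∑ i, (g i x - a i) ^ 2) + ∑ i, (h i x - b i) ^ 2 := by
  rw [EuclideanSpace.norm_sq_eq, ← Finset.sum_add_distrib]
  refine Finset.sum_congr rfl fun i _ => ?_
  rw [Complex.sq_norm, Complex.normSq_apply]
  simp [complexField]
  ring

theorem norm_complexField_sq (g h : Fin n → Rn n → ℝ) (x : Rn n) :
    ‖complexField g h x‖ ^ 2 = (∑ i, g i x ^ 2) + ∑ i, h i x ^ 2 := by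
  have := norm_sub_complexField_sq g h 0 0 x
  simp only [Pi.zero_apply, Complex.ofReal_zero, zero_mul, add_zero, sub_zero] at this
  rw [← this]
  congr 2
  ext i
  simp

theorem isL2Loc_of_locallyIntegrable_sq {Γ : Rn n → Cn n} (hm : AEStronglyMeasurable Γ volume)
    (h : LocallyIntegrable fun x => ‖Γ x‖ ^ 2) : IsL2Loc Γ := by
  intro K hK
  rw [memLp_two_iff_integrable_sq_norm hm.restrict]
  exact h.integrableOn_isCompact hK

/-- Uniformly Hölder functions in `L²_unif` are bounded. -/
theorem IsL2Unif.memLp_top_of_holder {Γ : Rn n → Cn n} (hΓ : IsL2Unif Γ) {α : ℝ} (hα : 0 < α)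
    (h : IsLocallyUniformlyHolder α Γ) : MemLp Γ ⊤ volume := by
  obtain ⟨hL, A, hA⟩ := hΓ
  obtain ⟨δ₀, hδ₀, c, hc, Γ', hae, hH⟩ := h
  set r := min δ₀ 1 with hr
  have hr0 : 0 < r := lt_min hδ₀ one_pos
  have hr1 : r ≤ 1 := min_le_right _ _
  have hv : ∀ x : Rn n, volume.real (ball x r) = r ^ n * unitVol n := fun x => volume_real_ball x hr0
  have hV : 0 < r ^ n * unitVol n := by have := unitVol_pos n; positivity
  set V := r ^ n * unitVol n with hVdef
  have hbound : ∀ x, ‖Γ' x‖ ^ 2 ≤ V⁻¹ * (2 * A + 2 * c ^ 2 * V) := by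
    intro x
    have hInt := hL.integrableOn_norm_sq x r
    have h1 : ∫ _y in ball x r, ‖Γ' x‖ ^ 2 ≤ ∫ y in ball x r, (2 * ‖Γ y‖ ^ 2 + 2 * c ^ 2) := by
      refine integral_mono_ae (integrableOn_const measure_ball_lt_top.ne)
        ((hInt.const_mul 2).add (integrableOn_const measure_ball_lt_top.ne)) ?_
      filter_upwards [ae_restrict_of_ae hae, ae_restrict_mem measurableSet_ball] with y hy hyx
      rw [mem_ball, dist_comm, dist_eq_norm] at hyx
      have h2 := hH x y (hyx.trans_le (min_le_left _ _))
      have h3 : ‖x - y‖ ^ α ≤ 1 :=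
        Real.rpow_le_one (norm_nonneg _) (hyx.le.trans hr1) hα.le
      have h4 : ‖Γ' x‖ ≤ ‖Γ y‖ + c := by
        have h5 := norm_le_norm_add_norm_sub' (Γ' x) (Γ' y)
        rw [hy] at h5 h2
        nlinarith
      have h6 : ‖Γ' x‖ ^ 2 ≤ (‖Γ y‖ + c) ^ 2 := pow_le_pow_left₀ (norm_nonneg _) h4 2
      nlinarith [sq_nonneg (‖Γ y‖ - c)]
    rw [setIntegral_const, integral_add (hInt.const_mul 2)
      (integrableOn_const measure_ball_lt_top.ne), setIntegral_const, integral_const_mul, hv,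
      smul_eq_mul, smul_eq_mul] at h1
    have h2 : ∫ y in ball x r, ‖Γ y‖ ^ 2 ≤ A :=
      (setIntegral_mono_set (hL.integrableOn_norm_sq x 1)
        (Eventually.of_forall fun _ => by positivity)
        (ball_subset_ball hr1).eventuallyLE).trans (hA x)
    rw [le_inv_mul_iff₀ hV]
    linarith
  refine memLp_top_of_bound hL.locallyIntegrable.aestronglyMeasurable
    √(V⁻¹ * (2 * A + 2 * c ^ 2 * V)) ?_
  filter_upwards [hae] with x hx
  rw [← hx]
  exact Real.le_sqrt_of_sq_le (hbound x)

theorem massBound_of_bounded {β : ℝ} (hβ : 0 < β) {γ : Rn n → ℂ} {M : ℝ} (hM : ∀ x, ‖γ x‖ ≤ M) :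
    MassBound β 1 (M * unitVol n + 1) γ := by
  intro x₀ δ hδ hδ1
  have hM0 : 0 ≤ M := (norm_nonneg _).trans (hM 0)
  have hω := unitVol_pos n
  have h1 := norm_setIntegral_le_of_norm_le_const (μ := volume) (s := ball x₀ δ)
    (f := fun x => ‖γ x‖) (C := M) measure_ball_lt_top (fun x _ => by simpa using hM x)
  rw [volume_real_ball x₀ hδ] at h1
  have h2 : δ ^ n ≤ δ ^ ((n : ℝ) - 2 * β / (β + 1)) := by
    rw [← Real.rpow_natCast]
    refine Real.rpow_le_rpow_of_exponent_ge hδ hδ1.le ?_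
    have : 0 ≤ 2 * β / (β + 1) := by positivity
    linarith
  have h3 : 0 < δ ^ ((n : ℝ) - 2 * β / (β + 1)) := by positivity
  calc ∫ x in ball x₀ δ, ‖γ x‖ ≤ M * (δ ^ n * unitVol n) := (Real.le_norm_self _).trans h1
    _ = M * unitVol n * δ ^ n := by ring
    _ ≤ M * unitVol n * δ ^ ((n : ℝ) - 2 * β / (β + 1)) :=
        mul_le_mul_of_nonneg_left h2 (by positivity)
    _ ≤ _ := by nlinarith

/-- `Q = (1 - Δ)γ` with `γ` bounded. The real and imaginary parts of `γ` are treated separately, and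
their negative weak gradients are assembled into `Γ`, so that `-Δγ` is `div Γ`. -/
theorem TrudingerSubordinate.exists_decomposition {β : ℝ} (hn : 0 < n) (hβ : 0 < β) {Q : Distr n}
    (hQ : TrudingerSubordinate Q β) :
    ∃ T : Tempered n, Agrees T Q ∧
      ∃ (Γ : Rn n → Cn n) (γ : Rn n → ℂ),
        IsL2Loc Γ ∧ LocallyIntegrable γ volume ∧
        IsNegGradResolvent T Γ ∧ IsResolvent T γ ∧
        Q = divergence Γ + ofFun γ ∧
        (∃ δ₀ > 0, ∃ c > 0, OscillationBound β δ₀ c Γ ∧ MassBound β δ₀ c γ) ∧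
        (1 ≤ β → IsL2Unif Γ) ∧
        (β < 1 → MemLp Γ ⊤ volume) := by
  obtain ⟨T, γ, M, hT, hγ, hM, hR⟩ := hQ.exists_bounded_resolvent hn hβ
  obtain ⟨ε₀, hε₀, c, hc, hL⟩ := hQ.formBdd
  have hM0 : 0 ≤ M := (norm_nonneg _).trans (hM 0)
  have hγl : LocallyIntegrable γ :=
    (memLp_top_of_bounded hγ hM).locallyIntegrable le_top
  have hQγ : ∀ φ : RealTest n, Q φ = ∫ x, ((φ x - lap φ x : ℝ) : ℂ) * γ x := by
    intro φ
    have h1 : T (toSchwartz φ) = resolvent n T (toSchwartz φ) -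
        resolvent n T (toSchwartz (isTest_coe φ).lap.mk) := by
      conv_lhs => rw [← resolvent_sub_laplacian n T]
      rw [sub_apply, TemperedDistribution.laplacian_apply_apply, laplacian_toSchwartz]
    rw [← hT φ, h1, hR, hR, ← integral_sub
      (integrable_mul_of_bounded hγ hM (toSchwartz φ).integrable)
      (integrable_mul_of_bounded hγ hM (toSchwartz _).integrable)]
    refine integral_congr_ae (Eventually.of_forall fun x => ?_)
    simp only [toSchwartz_apply]
    rw [← sub_mul, ← Complex.ofReal_sub]
    rfl
  obtain ⟨hre, him⟩ := hL.weakAdmissible hγ hM fun f hf => by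
    rw [eval_eq Q hf, hQγ]
    rfl
  obtain ⟨g, Cg, hCg, hgl, hgw, hg1, hgo⟩ := hre.exists_gradient hn hβ hε₀ hc hM0
  obtain ⟨h, Ch, hCh, hhl, hhw, hh1, hho⟩ := him.exists_gradient hn hβ hε₀ hc hM0
  set Γ := complexField g h with hΓ
  have hlc : ∀ {F : Rn n → ℝ}, LocallyIntegrable F → LocallyIntegrable fun x => (F x : ℂ) := by
    intro F hF x
    obtain ⟨U, hU, hFU⟩ := hF x
    exact ⟨U, hU, hFU.ofReal⟩
  have hΓi : ∀ i, LocallyIntegrable fun x => Γ x i := by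
    intro i
    refine (hlc (hgl i)).add ?_
    intro x
    obtain ⟨U, hU, hFU⟩ := hlc (hhl i) x
    exact ⟨U, hU, hFU.mul_const _⟩
  have hΓm : AEStronglyMeasurable Γ volume :=
    (PiLp.continuous_toLp 2 _).comp_aestronglyMeasurable
      (aemeasurable_pi_lambda _ fun i =>
        (hΓi i).aestronglyMeasurable.aemeasurable).aestronglyMeasurable
  have hΓ1 : ∀ x₀, IntegrableOn (fun x => ‖Γ x‖ ^ 2) (ball x₀ 1) ∧
      ∫ x in ball x₀ 1, ‖Γ x‖ ^ 2 ≤ Cg + Ch := by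
    intro x₀
    simp only [hΓ, norm_complexField_sq]
    refine ⟨(hg1 x₀).1.add (hh1 x₀).1, ?_⟩
    rw [integral_add (hg1 x₀).1 (hh1 x₀).1]
    exact add_le_add (hg1 x₀).2 (hh1 x₀).2
  have hΓ2 : IsL2Loc Γ := isL2Loc_of_locallyIntegrable_sq hΓm fun x =>
    ⟨ball x 1, ball_mem_nhds x one_pos, (hΓ1 x).1⟩
  have hunif : IsL2Unif Γ := ⟨hΓ2, Cg + Ch, fun x₀ => (hΓ1 x₀).2⟩
  -- A common constant for (A) and (B): the factor `4` comes from replacing the constants `a`, `b`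
  -- by the mean, and the last summand is the constant of the mass bound.
  have hosc : OscillationBound β 1 (4 * (Cg + Ch) + 1 + (M * unitVol n + 1)) Γ := by
    rw [oscillationBound_iff hβ]
    intro x₀ δ hδ hδ1
    obtain ⟨a, ha, ha'⟩ := hgo x₀ δ hδ hδ1.le
    obtain ⟨b, hb, hb'⟩ := hho x₀ δ hδ hδ1.le
    refine (integral_norm_sub_average_sq_le hΓ2 x₀ hδ
      (WithLp.toLp 2 fun i => (a i : ℂ) + (b i : ℂ) * Complex.I)).trans ?_
    simp only [hΓ, norm_sub_complexField_sq]
    rw [integral_add ha hb]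
    have hp : 0 < δ ^ ((n : ℝ) + 2 * ((1 - β) / (1 + β))) := by positivity
    have hω : 0 ≤ M * unitVol n := mul_nonneg hM0 (unitVol_pos n).le
    nlinarith [mul_nonneg hω hp.le]
  have hω : 0 ≤ M * unitVol n := mul_nonneg hM0 (unitVol_pos n).le
  have hmass : MassBound β 1 (4 * (Cg + Ch) + 1 + (M * unitVol n + 1)) γ := by
    intro x₀ δ hδ hδ1
    refine (massBound_of_bounded hβ hM x₀ δ hδ hδ1).trans ?_
    exact mul_le_mul_of_nonneg_right (by linarith) (by positivity)
  have hweak : ∀ i (f : Rn n → ℝ), IsTest f →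
      ∫ x, ((pd i f x : ℝ) : ℂ) * γ x = ∫ x, f x • Γ x i := by
    intro i f hf
    have i1 : Integrable fun x => f x * g i x :=
      (hgl i).integrable_smul_left_of_hasCompactSupport hf.continuous hf.2
    have i2 : Integrable fun x => f x * h i x :=
      (hhl i).integrable_smul_left_of_hasCompactSupport hf.continuous hf.2
    rw [integral_ofReal_mul_eq hγ hM (hf.pd i).integrable, hgw i f hf, hhw i f hf,
      ← integral_complex_ofReal, ← integral_complex_ofReal, ← integral_mul_const,
      ← integral_add i1.ofReal (i2.ofReal.mul_const _)]
    refine integral_congr_ae (Eventually.of_forall fun x => ?_)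
    simp only [hΓ, complexField, Complex.real_smul]
    push_cast
    ring
  refine ⟨T, hT, Γ, γ, hΓ2, hγl, fun i φ => ?_, fun φ => ?_, ?_,
    ⟨1, one_pos, _, by positivity, hosc, hmass⟩, fun _ => hunif, fun hβ1 => ?_⟩
  · rw [ofFun_apply (hΓi i), ← hweak i φ (isTest_coe φ), neg_apply,
      TemperedDistribution.lineDerivOp_apply_apply, map_neg, neg_neg, lineDeriv_toSchwartz, hR]
    rfl
  · rw [ofFun_apply hγl, hR]
    rfl
  · ext φ
    rw [add_apply, divergence_apply hΓi, ofFun_apply hγl, hQγ]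
    have hφ := isTest_coe φ
    have e1 : ∀ i, ∫ x, pd i φ x • Γ x i = ∫ x, ((pd i (pd i φ) x : ℝ) : ℂ) * γ x :=
      fun i => (hweak i _ (hφ.pd i)).symm
    simp only [e1]
    have j1 : ∀ {f : Rn n → ℝ}, IsTest f → Integrable fun x => (f x : ℂ) * γ x := fun hf =>
      integrable_mul_of_bounded hγ hM hf.integrable.ofReal
    rw [← integral_finsetSum _ fun i _ => j1 ((hφ.pd i).pd i), neg_add_eq_sub]
    have e2 : ∀ x, ∑ i, ((pd i (pd i φ) x : ℝ) : ℂ) * γ x = ((lap φ x : ℝ) : ℂ) * γ x := fun x => by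
      rw [lap, Complex.ofReal_sum, Finset.sum_mul]
    simp only [e2, Complex.real_smul]
    rw [← integral_sub (j1 hφ) (j1 hφ.lap)]
    refine integral_congr_ae (Eventually.of_forall fun x => ?_)
    simp only
    push_cast
    ring
  -- For `β < 1` the oscillation bound makes the field locally uniformly Hölder, and its `L²` norms
  -- over unit balls are uniformly bounded.
  · exact hunif.memLp_top_of_holder (div_pos (by linarith) (by linarith))
      ((holder_iff hβ hβ1 hΓ2).1 ⟨1, one_pos, _, by positivity, hosc⟩)

end FormSubordination

end

theorem mainTheorem3 (n : ℕ) (hn : 2 ≤ n) (β : ℝ) (hβ : 0 < β) (Q : Distr n) :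
    -- necessity
    (TrudingerSubordinate Q β →
      ∃ T : Tempered n, Agrees T Q ∧
      ∃ (Γ : Rn n → Cn n) (γ : Rn n → ℂ),
        IsL2Loc Γ ∧ LocallyIntegrable γ volume ∧
        IsNegGradResolvent T Γ ∧ IsResolvent T γ ∧
        Q = divergence Γ + ofFun γ ∧
        (∃ δ₀ > 0, ∃ c > 0, OscillationBound β δ₀ c Γ ∧ MassBound β δ₀ c γ) ∧
        (1 ≤ β → IsL2Unif Γ) ∧
        (β < 1 → MemLp Γ ⊤ volume)) ∧
    -- sufficiency
    (∀ (Γ : Rn n → Cn n) (γ : Rn n → ℂ),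
      IsL2Loc Γ → LocallyIntegrable γ volume →
      Q = divergence Γ + ofFun γ →
      (∃ δ₀ > 0, ∃ c > 0, OscillationBound β δ₀ c Γ ∧ MassBound β δ₀ c γ) →
      TrudingerSubordinate Q β) ∧
    -- the meaning of the oscillation condition in the three ranges of `β`
    (∀ Γ : Rn n → Cn n, IsL2Loc Γ →
      (1 < β →
        ((IsL2Unif Γ ∧ ∃ δ₀ > 0, ∃ c > 0, OscillationBound β δ₀ c Γ) ↔
          ∃ δ₀ > 0, ∃ c > 0, MorreyBound β δ₀ c Γ)) ∧
      (β = 1 →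
        ((IsL2Unif Γ ∧ ∃ δ₀ > 0, ∃ c > 0, OscillationBound β δ₀ c Γ) ↔ IsLocalBMO Γ)) ∧
      (β < 1 →
        ((∃ δ₀ > 0, ∃ c > 0, OscillationBound β δ₀ c Γ) ↔
          IsLocallyUniformlyHolder ((1 - β) / (1 + β)) Γ))) := by
  refine ⟨fun hQ => hQ.exists_decomposition (by omega) hβ, ?_, fun Γ hΓ => ⟨fun hβ1 => ?_, ?_, ?_⟩⟩
  · rintro Γ γ hΓ hγ hQ ⟨δ₀, hδ₀, c, hc, ho, hm⟩
    exact trudingerSubordinate_of_bounds hβ hΓ hγ hQ hδ₀ hc ho hm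
  · exact morrey_iff hβ1 hΓ
  · rintro rfl
    exact localBMO_iff
  · exact fun hβ1 => holder_iff hβ hβ1 hΓ
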